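/- **Lemma (block heavy hitters).** For $b\ge 1$ with $b\mid n$, partition $\{1,\dots,n\}$ into the $n/b$ blocks $T_i=\{(i-1)b+1,\dots,ib\}$. A vector is $(k,b)$-block-sparse if its support is contained in a union of at most $k/b$ blocks. For $x\in\mathbb R^n$ let $$\mathrm{Err}_2^{k,b}(x)=\min_{(k,b)\text{-block-sparse }\hat x}\|x-\hat x\|_2 ,$$ and for $S\subseteq\{1,\dots,n\}$ let $x_S$ be equal to $x$ on $S$ and zero elsewhere. There are absolute constants $C,c>0$ and one deterministic recovery algorithm such that for all $n\ge 2$, $b\ge 1$ with $b\mid n$, $k\ge 0$ and $0<\varepsilon\le 1$ there is a probability distribution on real $M\times n$ matrices $A$, with $$M\le C\,\frac{k}{\varepsilon^5 b}\log n$$ rows, for which the following hold. * Almost surely, every column of $A$ has at most $\frac{C}{\varepsilon^2}\log n$ nonzero entries, and for every $x\in\mathbb R^n$ the algorithm, given $n,b,k,M,\varepsilon$, the matrix $A$ and the sketch $Ax$, halts within $C\,\frac{n}{\varepsilon^2 b}\log n$ steps and outputs a list of block indices in which at most $k/b$ different blocks occur. Let $S$ be the union of these blocks. * For every $x\in\mathbb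 R^n$, with probability at least $1-n^{-c}$ over $A$, $$\|x-x_S\|_2\le(1+\varepsilon)\,\mathrm{Err}_2^{k,b}(x).$$ Running time is counted on a real RAM: unit cost for each addition, subtraction and comparison of natural numbers, for each exact addition, subtraction, multiplication, division and comparison of real numbers, and for each memory access. The sketch is stored in an array, and $A$ is accessible in sparse column form: for each column, the number of its nonzero entries and, for each $r$, the row and the value of the $r$-th nonzero entry, each at unit cost. -/

import Mathlib

open MeasureTheory Matrix

namespace BlockSparse

/-! ### Block-sparse vectors

Coordinates are `0, …, n - 1`; the block `q` consists of the coordinates `i` with `i / b = q`, that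
is, of `q * b, …, q * b + b - 1`. For `b ∣ n` the blocks are `0, …, n / b - 1`. -/

/-- The restriction `x_S`, where `S` is the union of the blocks with index in `U`. -/
noncomputable def restrictBlocks {n : ℕ} (b : ℕ) (U : Finset ℕ) (x : EuclideanSpace ℝ (Fin n)) :
    EuclideanSpace ℝ (Fin n) :=
  WithLp.toLp 2 fun i => if (i : ℕ) / b ∈ U then x i else 0

/-- The support of `x` is contained in a union of at most `k / b` blocks
(the natural-number quotient: a number of blocks is at most `k / b` iff it is at most `⌊k / b⌋`). -/
def IsBlockSparse {n : ℕ} (k b : ℕ) (x : EuclideanSpace ℝ (Fin n)) : Prop :=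
  ∃ U : Finset ℕ, U ⊆ Finset.range (n / b) ∧ U.card ≤ k / b ∧ ∀ i, x i ≠ 0 → (i : ℕ) / b ∈ U

/-- `Err₂^{k,b}(x)`: the distance from `x` to the `(k, b)`-block-sparse vectors. -/
noncomputable def blockErr {n : ℕ} (k b : ℕ) (x : EuclideanSpace ℝ (Fin n)) : ℝ :=
  sInf {r : ℝ | ∃ z : EuclideanSpace ℝ (Fin n), IsBlockSparse k b z ∧ r = ‖x - z‖}

/-- The product (Borel) σ-algebra on matrices. -/
instance instMeasurableSpaceMatrix {M n : ℕ} : MeasurableSpace (Matrix (Fin M) (Fin n) ℝ) :=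
  inferInstanceAs (MeasurableSpace (Fin M → Fin n → ℝ))

/-! ### Sparse matrices given by the lists of nonzero entries of their columns -/

open Classical in
/-- The rows of the nonzero entries of column `j`, in increasing order. -/
noncomputable def colSupport {M n : ℕ} (A : Matrix (Fin M) (Fin n) ℝ) (j : Fin n) :
    List (Fin M) :=
  (List.finRange M).filter fun i => A i j ≠ 0

/-- The number of nonzero entries of column `j`. -/
noncomputable def colNnz {M n : ℕ} (A : Matrix (Fin M) (Fin n) ℝ) (j : Fin n) : ℕ :=
  (colSupport A j).length

/-- A matrix as a program sees it: `nnz j` is the number of nonzero entries of column `j`, and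
`row j r` and `val j r` are the row and the value of the `r`-th of them. -/
structure ColumnData where
  nnz : ℕ → ℕ
  row : ℕ → ℕ → ℕ
  val : ℕ → ℕ → ℝ

noncomputable def columnData {M n : ℕ} (A : Matrix (Fin M) (Fin n) ℝ) : ColumnData where
  nnz j := if h : j < n then colNnz A ⟨j, h⟩ else 0
  row j r := if h : j < n then ((colSupport A ⟨j, h⟩).map fun i => (i : ℕ)).getD r 0 else 0
  val j r := if h : j < n then ((colSupport A ⟨j, h⟩).map fun i => A i ⟨j, h⟩).getD r 0 else 0

/-! ### Programs of a real RAM and their running time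

Registers and arrays hold natural numbers or real numbers. Natural numbers can be added,
subtracted (truncated at `0`), compared and used as addresses; real numbers can be added,
subtracted, multiplied, divided and compared exactly. Each operation costs one step. -/

/-- Registers and arrays; `natMem a i` and `realMem a i` are the cells `i` of the arrays `a`. -/
structure State where
  nat : ℕ → ℕ
  real : ℕ → ℝ
  natMem : ℕ → ℕ → ℕ
  realMem : ℕ → ℕ → ℝ

inductive NatExpr where
  | lit (m : ℕ)
  | reg (r : ℕ)
  | mem (a : ℕ) (i : NatExpr)
  | add (e f : NatExpr)
  | sub (e f : NatExpr)
  | nnz (j : NatExpr)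
  | row (j r : NatExpr)

inductive RealExpr where
  | ofNat (e : NatExpr)
  | reg (r : ℕ)
  | mem (a : ℕ) (i : NatExpr)
  | add (e f : RealExpr)
  | sub (e f : RealExpr)
  | mul (e f : RealExpr)
  | div (e f : RealExpr)
  | val (j r : NatExpr)

inductive Test where
  | natLt (e f : NatExpr)
  | realLt (e f : RealExpr)
  | not (t : Test)
  | and (t u : Test)

def NatExpr.eval (D : ColumnData) (s : State) : NatExpr → ℕ
  | lit m => m
  | reg r => s.nat r
  | mem a i => s.natMem a (i.eval D s)
  | add e f => e.eval D s + f.eval D s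
  | sub e f => e.eval D s - f.eval D s
  | nnz j => D.nnz (j.eval D s)
  | row j r => D.row (j.eval D s) (r.eval D s)

noncomputable def RealExpr.eval (D : ColumnData) (s : State) : RealExpr → ℝ
  | ofNat e => (e.eval D s : ℝ)
  | reg r => s.real r
  | mem a i => s.realMem a (i.eval D s)
  | add e f => e.eval D s + f.eval D s
  | sub e f => e.eval D s - f.eval D s
  | mul e f => e.eval D s * f.eval D s
  | div e f => e.eval D s / f.eval D s
  | val j r => D.val (j.eval D s) (r.eval D s)

def Test.holds (D : ColumnData) (s : State) : Test → Prop
  | natLt e f => e.eval D s < f.eval D s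
  | realLt e f => e.eval D s < f.eval D s
  | not t => ¬ t.holds D s
  | and t u => t.holds D s ∧ u.holds D s

/-! The cost of evaluating an expression is its number of operations and operands. -/

def NatExpr.cost : NatExpr → ℕ
  | lit _ => 1
  | reg _ => 1
  | mem _ i => i.cost + 1
  | add e f => e.cost + f.cost + 1
  | sub e f => e.cost + f.cost + 1
  | nnz j => j.cost + 1
  | row j r => j.cost + r.cost + 1

def RealExpr.cost : RealExpr → ℕ
  | ofNat e => e.cost + 1
  | reg _ => 1
  | mem _ i => i.cost + 1
  | add e f => e.cost + f.cost + 1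
  | sub e f => e.cost + f.cost + 1
  | mul e f => e.cost + f.cost + 1
  | div e f => e.cost + f.cost + 1
  | val j r => j.cost + r.cost + 1

def Test.cost : Test → ℕ
  | natLt e f => e.cost + f.cost + 1
  | realLt e f => e.cost + f.cost + 1
  | not t => t.cost + 1
  | and t u => t.cost + u.cost + 1

inductive Cmd where
  | skip
  | setNat (r : ℕ) (e : NatExpr)
  | setReal (r : ℕ) (e : RealExpr)
  | putNat (a : ℕ) (i e : NatExpr)
  | putReal (a : ℕ) (i : NatExpr) (e : RealExpr)
  | seq (p q : Cmd)
  | ite (t : Test) (p q : Cmd)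
  | loop (t : Test) (p : Cmd)
  | call (f : ℕ)

/-- A main command and a list of procedures without parameters, which may call one another. -/
structure Program where
  main : Cmd
  procs : List Cmd

/-- `Exec F D p s s' c`: the command `p`, started in the state `s` with the procedures `F` and
read access to the matrix `D`, halts in the state `s'` after `c` steps. -/
inductive Exec (F : List Cmd) (D : ColumnData) : Cmd → State → State → ℕ → Prop
  | skip (s : State) : Exec F D .skip s s 1
  | setNat (s : State) (r : ℕ) (e : NatExpr) :
      Exec F D (.setNat r e) s { s with nat := Function.update s.nat r (e.eval D s) }
        (e.cost + 1)
  | setReal (s : State) (r : ℕ) (e : RealExpr) :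
      Exec F D (.setReal r e) s { s with real := Function.update s.real r (e.eval D s) }
        (e.cost + 1)
  | putNat (s : State) (a : ℕ) (i e : NatExpr) :
      Exec F D (.putNat a i e) s
        { s with natMem := Function.update s.natMem a
                   (Function.update (s.natMem a) (i.eval D s) (e.eval D s)) }
        (i.cost + e.cost + 1)
  | putReal (s : State) (a : ℕ) (i : NatExpr) (e : RealExpr) :
      Exec F D (.putReal a i e) s
        { s with realMem := Function.update s.realMem a
                   (Function.update (s.realMem a) (i.eval D s) (e.eval D s)) }
        (i.cost + e.cost + 1)
  | seq {p q : Cmd} {s s' s'' : State} {c d : ℕ} :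
      Exec F D p s s' c → Exec F D q s' s'' d → Exec F D (.seq p q) s s'' (c + d)
  | iteTrue {t : Test} {p q : Cmd} {s s' : State} {c : ℕ} :
      t.holds D s → Exec F D p s s' c → Exec F D (.ite t p q) s s' (t.cost + c)
  | iteFalse {t : Test} {p q : Cmd} {s s' : State} {c : ℕ} :
      ¬ t.holds D s → Exec F D q s s' c → Exec F D (.ite t p q) s s' (t.cost + c)
  | loopTrue {t : Test} {p : Cmd} {s s' s'' : State} {c d : ℕ} :
      t.holds D s → Exec F D p s s' c → Exec F D (.loop t p) s' s'' d →
      Exec F D (.loop t p) s s'' (t.cost + c + d)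
  | loopFalse {t : Test} {p : Cmd} {s : State} :
      ¬ t.holds D s → Exec F D (.loop t p) s s t.cost
  | call {f : ℕ} {p : Cmd} {s s' : State} {c : ℕ} :
      F[f]? = some p → Exec F D p s s' c → Exec F D (.call f) s s' (c + 1)

/-- Programs are deterministic, so the result and the number of steps are unique. -/
theorem Exec.unique {F : List Cmd} {D : ColumnData} {p : Cmd} {s s₁ s₂ : State} {c₁ c₂ : ℕ}
    (h₁ : Exec F D p s s₁ c₁) (h₂ : Exec F D p s s₂ c₂) : s₁ = s₂ ∧ c₁ = c₂ := by
  induction h₁ generalizing s₂ c₂ with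
  | skip | setNat | setReal | putNat | putReal => cases h₂; exact ⟨rfl, rfl⟩
  | seq _ _ ih ih' =>
    cases h₂ with
    | seq g g' =>
      obtain ⟨rfl, rfl⟩ := ih g
      obtain ⟨rfl, rfl⟩ := ih' g'
      exact ⟨rfl, rfl⟩
  | iteTrue ht _ ih =>
    cases h₂ with
    | iteTrue _ g => obtain ⟨rfl, rfl⟩ := ih g; exact ⟨rfl, rfl⟩
    | iteFalse hn _ => exact absurd ht hn
  | iteFalse hn _ ih =>
    cases h₂ with
    | iteTrue ht _ => exact absurd ht hn
    | iteFalse _ g => obtain ⟨rfl, rfl⟩ := ih g; exact ⟨rfl, rfl⟩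
  | loopTrue ht _ _ ih ih' =>
    cases h₂ with
    | loopTrue _ g g' =>
      obtain ⟨rfl, rfl⟩ := ih g
      obtain ⟨rfl, rfl⟩ := ih' g'
      exact ⟨rfl, rfl⟩
    | loopFalse hn => exact absurd ht hn
  | loopFalse hn =>
    cases h₂ with
    | loopTrue ht _ _ => exact absurd ht hn
    | loopFalse _ => exact ⟨rfl, rfl⟩
  | call hf _ ih =>
    cases h₂ with
    | call hg g =>
      obtain rfl := Option.some.inj (hf.symm.trans hg)
      obtain ⟨rfl, rfl⟩ := ih g
      exact ⟨rfl, rfl⟩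

/-- The initial state: natural registers `0, 1, 2, 3` hold `n, b, k, M`, real register `0` holds
`ε`, the real array `0` holds the sketch `y`, and everything else is `0`. -/
noncomputable def initState {M : ℕ} (n b k : ℕ) (ε : ℝ) (y : Fin M → ℝ) : State where
  nat r := [n, b, k, M].getD r 0
  real r := if r = 0 then ε else 0
  natMem _ _ := 0
  realMem a i := if a = 0 then (if h : i < M then y ⟨i, h⟩ else 0) else 0

/-- The output is a list of block indices: natural register `0` holds its length, and the natural
array `0` its entries. -/
def State.output (s : State) : Finset ℕ :=
  (Finset.range (s.nat 0)).image (s.natMem 0)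

/-- On the parameters `n, b, k, ε`, the matrix `A` and the sketch `y`, the program `P` halts after
`τ` steps and outputs (a list of) the set `U` of block indices. -/
def Program.Outputs (P : Program) {M n : ℕ} (b k : ℕ) (ε : ℝ) (A : Matrix (Fin M) (Fin n) ℝ)
    (y : Fin M → ℝ) (U : Finset ℕ) (τ : ℕ) : Prop :=
  ∃ s : State, Exec P.procs (columnData A) P.main (initState n b k ε y) s τ ∧ s.output = U

end BlockSparse

/-! The sketch consists of `L = 4 ^ (d + 1)` independent groups, with `L` of order `log n`. A group
hashes the `n / b` blocks at random into `W` buckets, `W` of order `k / (b * ε)`, and for every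
bucket it stores `m` sums with random signs, `m` of order `1 / ε ^ 2`, of the coordinates in the
bucket. The sum of the squares of these `m` numbers, divided by `m`, estimates the energy of any
block in the bucket.

Fix `x`, let `H` be the best `K = min (k / b) (n / b)` blocks and `E` the energy outside `H`. For a
given block `q`, a group can fail in three ways: another block of `H` falls into the bucket of `q`
(union bound), the other blocks bring more than `Δ = 2 ^ 14 * E / W` into it (Markov), or the signed
sums deviate by a factor `1 ± η`, `η = ε / 4` (Chebyshev, from the fourth moment of a sign sum).
`card_badSamples_le` bounds the total probability by `3 / 2 ^ 14`. If fewer than a quarter of the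
groups fail for `q`, every value with at least a quarter of the group energies on either side lies
between `(1 - η) * m * s q` and `(1 + η) * m * (s q + Δ)`, where `s q` is the energy of `q`. By
`card_manyBad_le` this holds for all blocks at once with probability at least `1 - 1 / n`.

Taking the `K` largest estimates is then nearly optimal (`sum_compl_le_of_estimates`): a block of
`H` that is left out has been replaced by one with almost the same energy up to `Δ`, and `K * Δ ≤ η
* E`. The squared error is at most `(1 + 5 * η) * E`, and `1 + 5 * ε / 4 ≤ (1 + ε) ^ 2`.

All columns of a block have their nonzero entries in the same rows, so the program reads a single
column per block. Sorting its `L` group energies would cost an extra factor `log L`, which the time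
bound does not allow. Instead, `approxMedian` finds a central value in linear time: it keeps sorted
runs, repeatedly merges four of them into one and discards every other entry. The array halves each
time, so the cost is a geometric series, and the ranks are distorted by a controlled amount. Only
the `n / b` final estimates are sorted, at a cost of order `(n / b) * log n`.

The program is verified with the total correctness triples `Halts`, which carry a step budget.
Halting and the size of the output hold for every choice of the random bits; only the quality of the
output is probabilistic. The distribution is uniform on a finite sample space, so probabilities are
cardinalities. -/

namespace BlockSparse

/-! ### Total correctness with a bound on the number of steps -/

/-- Started in `s`, the command `p` halts within `c` steps in a state that satisfies `Q`. -/
def Halts (F : List Cmd) (D : ColumnData) (p : Cmd) (s : State) (c : ℕ) (Q : State → Prop) : Prop :=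
  ∃ s' c', Exec F D p s s' c' ∧ c' ≤ c ∧ Q s'

section rules

variable {F : List Cmd} {D : ColumnData} {p q : Cmd} {s : State} {c c₁ c₂ : ℕ}
  {Q R : State → Prop}

theorem Halts.mono (h : Halts F D p s c₁ R) (hc : c₁ ≤ c) (hQ : ∀ s', R s' → Q s') :
    Halts F D p s c Q := by
  obtain ⟨s', c', h1, h2, h3⟩ := h
  exact ⟨s', c', h1, h2.trans hc, hQ _ h3⟩

theorem Halts.seq (h : Halts F D p s c₁ R) (h' : ∀ s', R s' → Halts F D q s' c₂ Q)
    (hc : c₁ + c₂ ≤ c) : Halts F D (.seq p q) s c Q := by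
  obtain ⟨s', c', h1, h2, h3⟩ := h
  obtain ⟨s'', c'', h4, h5, h6⟩ := h' _ h3
  exact ⟨s'', c' + c'', .seq h1 h4, by omega, h6⟩

theorem Halts.setNat {r : ℕ} {e : NatExpr} (hc : e.cost + 1 ≤ c)
    (hQ : Q { s with nat := Function.update s.nat r (e.eval D s) }) :
    Halts F D (.setNat r e) s c Q := ⟨_, _, .setNat s r e, hc, hQ⟩

theorem Halts.setReal {r : ℕ} {e : RealExpr} (hc : e.cost + 1 ≤ c)
    (hQ : Q { s with real := Function.update s.real r (e.eval D s) }) :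
    Halts F D (.setReal r e) s c Q := ⟨_, _, .setReal s r e, hc, hQ⟩

theorem Halts.putNat {a : ℕ} {i e : NatExpr} (hc : i.cost + e.cost + 1 ≤ c)
    (hQ : Q { s with natMem := Function.update s.natMem a
                       (Function.update (s.natMem a) (i.eval D s) (e.eval D s)) }) :
    Halts F D (.putNat a i e) s c Q := ⟨_, _, .putNat s a i e, hc, hQ⟩

theorem Halts.putReal {a : ℕ} {i : NatExpr} {e : RealExpr} (hc : i.cost + e.cost + 1 ≤ c)
    (hQ : Q { s with realMem := Function.update s.realMem a
                       (Function.update (s.realMem a) (i.eval D s) (e.eval D s)) }) :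
    Halts F D (.putReal a i e) s c Q := ⟨_, _, .putReal s a i e, hc, hQ⟩

/-- Fusing an assignment with the sequencing rule leaves the updated state explicit in the next
goal, so straight-line code is executed symbolically without intermediate assertions. -/
theorem Halts.setNat_seq {r : ℕ} {e : NatExpr}
    (h : Halts F D q { s with nat := Function.update s.nat r (e.eval D s) } c₂ Q)
    (hc : e.cost + 1 + c₂ ≤ c) : Halts F D (.seq (.setNat r e) q) s c Q :=
  Halts.seq (R := fun s' => s' = _) (.setNat le_rfl rfl) (fun _ h' => h' ▸ h) hc

theorem Halts.setReal_seq {r : ℕ} {e : RealExpr}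
    (h : Halts F D q { s with real := Function.update s.real r (e.eval D s) } c₂ Q)
    (hc : e.cost + 1 + c₂ ≤ c) : Halts F D (.seq (.setReal r e) q) s c Q :=
  Halts.seq (R := fun s' => s' = _) (.setReal le_rfl rfl) (fun _ h' => h' ▸ h) hc

theorem Halts.putNat_seq {a : ℕ} {i e : NatExpr}
    (h : Halts F D q { s with
      natMem := Function.update s.natMem a
        (Function.update (s.natMem a) (i.eval D s) (e.eval D s)) } c₂ Q)
    (hc : i.cost + e.cost + 1 + c₂ ≤ c) : Halts F D (.seq (.putNat a i e) q) s c Q :=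
  Halts.seq (R := fun s' => s' = _) (.putNat le_rfl rfl) (fun _ h' => h' ▸ h) hc

theorem Halts.putReal_seq {a : ℕ} {i : NatExpr} {e : RealExpr}
    (h : Halts F D q { s with
      realMem := Function.update s.realMem a
        (Function.update (s.realMem a) (i.eval D s) (e.eval D s)) } c₂ Q)
    (hc : i.cost + e.cost + 1 + c₂ ≤ c) : Halts F D (.seq (.putReal a i e) q) s c Q :=
  Halts.seq (R := fun s' => s' = _) (.putReal le_rfl rfl) (fun _ h' => h' ▸ h) hc

theorem Halts.ite {t : Test} (h₁ : t.holds D s → Halts F D p s c₁ Q)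
    (h₂ : ¬ t.holds D s → Halts F D q s c₁ Q) (hc : t.cost + c₁ ≤ c) :
    Halts F D (.ite t p q) s c Q := by
  by_cases ht : t.holds D s
  · obtain ⟨s', c', h1, h2, h3⟩ := h₁ ht
    exact ⟨s', _, .iteTrue ht h1, by omega, h3⟩
  · obtain ⟨s', c', h1, h2, h3⟩ := h₂ ht
    exact ⟨s', _, .iteFalse ht h1, by omega, h3⟩

/-- A loop that runs `T` times, with the invariant `I` and the potential `Φ`. -/
theorem Halts.loop {t : Test} (T : ℕ) (I : ℕ → State → Prop) (Φ cost : ℕ → ℕ) (h0 : I 0 s)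
    (hstep : ∀ x < T, ∀ s, I x s → t.holds D s ∧ Halts F D p s (cost x) (I (x + 1)))
    (hend : ∀ s, I T s → ¬ t.holds D s)
    (hΦ : ∀ x < T, t.cost + cost x + Φ (x + 1) ≤ Φ x) (hT : t.cost ≤ Φ T)
    (hc : Φ 0 ≤ c) (hQ : ∀ s, I T s → Q s) : Halts F D (.loop t p) s c Q := by
  have key : ∀ y x s, x + y = T → I x s → Halts F D (.loop t p) s (Φ x) (I T) := by
    intro y
    induction y with
    | zero =>
      intro x s hx hI
      obtain rfl : x = T := by omega
      exact ⟨s, _, .loopFalse (hend s hI), hT, hI⟩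
    | succ y ih =>
      intro x s hx hI
      obtain ⟨ht, s', c', h1, h2, h3⟩ := hstep x (by omega) s hI
      obtain ⟨s'', c'', h4, h5, h6⟩ := ih (x + 1) s' (by omega) h3
      have := hΦ x (by omega)
      exact ⟨s'', _, .loopTrue ht h1 h4, by omega, h6⟩
  exact (key T 0 s (by omega) h0).mono hc hQ

/-- A loop that runs `T` times, with the invariant `I` and a constant bound for the body. -/
theorem Halts.loop_const {t : Test} (T : ℕ) (I : ℕ → State → Prop) (d : ℕ) (h0 : I 0 s)
    (hstep : ∀ x < T, ∀ s, I x s → t.holds D s ∧ Halts F D p s d (I (x + 1)))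
    (hend : ∀ s, I T s → ¬ t.holds D s) (hc : T * (t.cost + d) + t.cost ≤ c)
    (hQ : ∀ s, I T s → Q s) : Halts F D (.loop t p) s c Q := by
  refine Halts.loop T I (fun x => (T - x) * (t.cost + d) + t.cost) (fun _ => d) h0 hstep hend
    (fun x hx => ?_) (by simp) (by simpa using hc) hQ
  obtain ⟨y, rfl⟩ : ∃ y, T = x + 1 + y := ⟨T - (x + 1), by omega⟩
  rw [show x + 1 + y - x = y + 1 by omega, show x + 1 + y - (x + 1) = y by omega]
  rw [add_mul]
  omega

end rules

/-! ### Segments of arrays -/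

/-- The multiset of the entries `p a, …, p (a + l - 1)`. -/
def seg (p : ℕ → ℕ) (a l : ℕ) : Multiset ℕ := (Multiset.range l).map fun i => p (a + i)

/-- The keys of the entries `p a, …, p (a + l - 1)` increase. -/
def SortedSeg (key : ℕ → ℝ) (p : ℕ → ℕ) (a l : ℕ) : Prop :=
  ∀ i j, i ≤ j → j < l → key (p (a + i)) ≤ key (p (a + j))

@[simp] theorem seg_zero (p : ℕ → ℕ) (a : ℕ) : seg p a 0 = 0 := by simp [seg]

theorem seg_succ (p : ℕ → ℕ) (a l : ℕ) : seg p a (l + 1) = seg p a l + {p (a + l)} := by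
  simp only [seg, Multiset.range_succ, Multiset.map_cons]
  rw [← Multiset.singleton_add, add_comm]

theorem seg_add (p : ℕ → ℕ) (a l k : ℕ) : seg p a (l + k) = seg p a l + seg p (a + l) k := by
  induction k with
  | zero => simp
  | succ k ih => rw [← add_assoc, seg_succ, ih, seg_succ, add_assoc, add_assoc]

theorem seg_congr {p q : ℕ → ℕ} {a l : ℕ} (h : ∀ i < l, p (a + i) = q (a + i)) :
    seg p a l = seg q a l :=
  Multiset.map_congr rfl fun i hi => h i (Multiset.mem_range.1 hi)

theorem SortedSeg.congr {key : ℕ → ℝ} {p q : ℕ → ℕ} {a l : ℕ} (hp : SortedSeg key p a l)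
    (h : ∀ i < l, q (a + i) = p (a + i)) : SortedSeg key q a l := by
  intro i j hij hj
  rw [h i (by omega), h j hj]
  exact hp i j hij hj

theorem sortedSeg_one (key : ℕ → ℝ) (p : ℕ → ℕ) (a : ℕ) : SortedSeg key p a 1 := by
  intro i j hij hj
  obtain rfl : i = j := by omega
  exact le_rfl

/-- The invariant of merging the runs `p a, …` and `p (a + w), …` of length `w` to `q a, …`, after
`x` entries of the first and `y` entries of the second run. -/
structure MergeInv (key : ℕ → ℝ) (p q : ℕ → ℕ) (a w x y : ℕ) : Prop where
  seg_eq : seg q a (x + y) = seg p a x + seg p (a + w) y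
  sorted : SortedSeg key q a (x + y)
  le_left : x < w → ∀ u < x + y, key (q (a + u)) ≤ key (p (a + x))
  le_right : y < w → ∀ u < x + y, key (q (a + u)) ≤ key (p (a + w + y))

theorem MergeInv.zero (key : ℕ → ℝ) (p q : ℕ → ℕ) (a w : ℕ) : MergeInv key p q a w 0 0 where
  seg_eq := by simp
  sorted := by intro i j _ hj; simp at hj
  le_left _ u hu := by simp at hu
  le_right _ u hu := by simp at hu

theorem sortedSeg_push {key : ℕ → ℝ} {q : ℕ → ℕ} {a l v : ℕ} (h : SortedSeg key q a l)
    (hv : ∀ u < l, key (q (a + u)) ≤ key v) :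
    SortedSeg key (Function.update q (a + l) v) a (l + 1) := by
  intro i j hij hj
  rcases Nat.lt_or_ge j l with h1 | h1
  · rw [Function.update_of_ne (by omega), Function.update_of_ne (by omega)]
    exact h i j hij h1
  · obtain rfl : j = l := by omega
    rw [Function.update_self]
    rcases Nat.lt_or_ge i j with h2 | h2
    · rw [Function.update_of_ne (by omega)]; exact hv i h2
    · obtain rfl : i = j := by omega
      rw [Function.update_self]

theorem seg_push (q : ℕ → ℕ) (a l v : ℕ) :
    seg (Function.update q (a + l) v) a (l + 1) = seg q a l + {v} := by
  rw [seg_succ, Function.update_self]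
  congr 1
  exact seg_congr fun i hi => Function.update_of_ne (by omega) _ _

theorem push_le {key : ℕ → ℝ} {q : ℕ → ℕ} {a l v : ℕ} {z : ℝ}
    (h : ∀ u < l, key (q (a + u)) ≤ z) (hv : key v ≤ z) :
    ∀ u < l + 1, key (Function.update q (a + l) v (a + u)) ≤ z := by
  intro u hu
  rcases Nat.lt_or_ge u l with h1 | h1
  · rw [Function.update_of_ne (by omega)]; exact h u h1
  · obtain rfl : u = l := by omega
    rwa [Function.update_self]

/-- By `le_left` the entry to be written dominates everything written so far, so sortedness
survives. The comparison `hk`, needed only while the second run is not exhausted, keeps the next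
entry of that run dominant. -/
theorem MergeInv.left {key : ℕ → ℝ} {p q : ℕ → ℕ} {a w x y : ℕ} (h : MergeInv key p q a w x y)
    (hp : SortedSeg key p a w) (hx : x < w)
    (hk : y < w → key (p (a + x)) ≤ key (p (a + w + y))) :
    MergeInv key p (Function.update q (a + (x + y)) (p (a + x))) a w (x + 1) y where
  seg_eq := by
    rw [show x + 1 + y = x + y + 1 by omega, seg_push, h.seg_eq, seg_succ, add_right_comm]
  sorted := by
    rw [show x + 1 + y = x + y + 1 by omega]
    exact sortedSeg_push h.sorted (h.le_left hx)
  le_left hx' := by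
    rw [show x + 1 + y = x + y + 1 by omega]
    have := hp x (x + 1) (by omega) hx'
    exact push_le (fun u hu => (h.le_left hx u hu).trans this) this
  le_right hy := by
    rw [show x + 1 + y = x + y + 1 by omega]
    exact push_le (h.le_right hy) (hk hy)

theorem MergeInv.right {key : ℕ → ℝ} {p q : ℕ → ℕ} {a w x y : ℕ} (h : MergeInv key p q a w x y)
    (hp : SortedSeg key p (a + w) w) (hy : y < w)
    (hk : x < w → key (p (a + w + y)) ≤ key (p (a + x))) :
    MergeInv key p (Function.update q (a + (x + y)) (p (a + w + y))) a w x (y + 1) where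
  seg_eq := by
    rw [show x + (y + 1) = x + y + 1 by omega, seg_push, h.seg_eq, seg_succ, add_assoc]
  sorted := by
    rw [show x + (y + 1) = x + y + 1 by omega]
    exact sortedSeg_push h.sorted (h.le_right hy)
  le_left hx := by
    rw [show x + (y + 1) = x + y + 1 by omega]
    exact push_le (h.le_left hx) (hk hx)
  le_right hy' := by
    rw [show x + (y + 1) = x + y + 1 by omega]
    have := hp y (y + 1) (by omega) hy'
    exact push_le (fun u hu => (h.le_right hy u hu).trans this) this

/-! ### Merging -/

infixr:50 " ;; " => Cmd.seq

/-- Write the smaller one of the next entries of two runs. -/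
def mergeStep : Cmd :=
  Cmd.ite (.and (.natLt (.reg 16) (.reg 18))
      (.not (.and (.natLt (.reg 17) (.reg 19))
        (.realLt (.mem 1 (.mem 1 (.reg 17))) (.mem 1 (.mem 1 (.reg 16)))))))
    (.putNat 2 (.reg 20) (.mem 1 (.reg 16)) ;; .setNat 16 (.add (.reg 16) (.lit 1)))
    (.putNat 2 (.reg 20) (.mem 1 (.reg 17)) ;; .setNat 17 (.add (.reg 17) (.lit 1))) ;;
  .setNat 20 (.add (.reg 20) (.lit 1))

/-- Merge the two runs of length `w` (register 12) that start at register 15. -/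
def mergeRuns : Cmd :=
  .setNat 18 (.add (.reg 15) (.reg 12)) ;;
  .setNat 19 (.add (.reg 18) (.reg 12)) ;;
  .setNat 16 (.reg 15) ;;
  .setNat 17 (.reg 18) ;;
  .setNat 20 (.reg 15) ;;
  .loop (.natLt (.reg 20) (.reg 19)) mergeStep ;;
  .setNat 15 (.reg 19)

/-- Merge the runs of length `w` (register 12) in the array 1 of length `N` (register 11) to runs
of length `2 * w`. -/
def mergePass : Cmd :=
  .setNat 15 (.lit 0) ;;
  .loop (.natLt (.reg 15) (.reg 11)) mergeRuns ;;
  .setNat 20 (.lit 0) ;;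
  .loop (.natLt (.reg 20) (.reg 11))
    (.putNat 1 (.reg 20) (.mem 2 (.reg 20)) ;; .setNat 20 (.add (.reg 20) (.lit 1)))

/-- `s'` differs from `s` at most in natural registers from `r` on and in the natural arrays 1
and 2. -/
structure Frame (r : ℕ) (s s' : State) : Prop where
  real : s'.real = s.real
  realMem : s'.realMem = s.realMem
  nat : ∀ i < r, s'.nat i = s.nat i
  natMem : ∀ a, a ≠ 1 → a ≠ 2 → s'.natMem a = s.natMem a

theorem Frame.trans {r : ℕ} {s s' s'' : State} (h : Frame r s s') (h' : Frame r s' s'') :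
    Frame r s s'' :=
  ⟨h'.real.trans h.real, h'.realMem.trans h.realMem, fun i hi => (h'.nat i hi).trans (h.nat i hi),
    fun a h1 h2 => (h'.natMem a h1 h2).trans (h.natMem a h1 h2)⟩

theorem Frame.mono {r r' : ℕ} {s s' : State} (h : Frame r s s') (hr : r' ≤ r) : Frame r' s s' :=
  ⟨h.real, h.realMem, fun i hi => h.nat i (by omega), h.natMem⟩

theorem Frame.of_setNat {r k v : ℕ} {s s' : State}
    (h : Frame r { s with nat := Function.update s.nat k v } s') (hk : r ≤ k) : Frame r s s' :=
  ⟨h.real, h.realMem, fun i hi => (h.nat i hi).trans (Function.update_of_ne (by omega) _ _),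
    h.natMem⟩

theorem mergeStep_halts {F : List Cmd} {D : ColumnData} {s : State} {a w x y : ℕ}
    (hx : x ≤ w) (hy : y ≤ w) (hlt : x + y < 2 * w)
    (h16 : s.nat 16 = a + x) (h17 : s.nat 17 = a + w + y) (h18 : s.nat 18 = a + w)
    (h19 : s.nat 19 = a + 2 * w) (h20 : s.nat 20 = a + (x + y))
    (hp : SortedSeg (s.realMem 1) (s.natMem 1) a w)
    (hp' : SortedSeg (s.realMem 1) (s.natMem 1) (a + w) w)
    (hI : MergeInv (s.realMem 1) (s.natMem 1) (s.natMem 2) a w x y) :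
    Halts F D mergeStep s 32 fun s' => ∃ x' y', x' ≤ w ∧ y' ≤ w ∧ x' + y' = x + y + 1 ∧
      s'.nat 16 = a + x' ∧ s'.nat 17 = a + w + y' ∧ s'.nat 18 = a + w ∧
      s'.nat 19 = a + 2 * w ∧ s'.nat 20 = a + (x' + y') ∧ s'.natMem 1 = s.natMem 1 ∧
      (∀ u < a, s'.natMem 2 u = s.natMem 2 u) ∧
      MergeInv (s.realMem 1) (s.natMem 1) (s'.natMem 2) a w x' y' ∧ Frame 16 s s' := by
  unfold mergeStep
  refine Halts.seq (c₁ := 28) (c₂ := 4) (R := fun s' => ∃ x' y', x' ≤ w ∧ y' ≤ w ∧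
      x' + y' = x + y + 1 ∧
      s'.nat 16 = a + x' ∧ s'.nat 17 = a + w + y' ∧ s'.nat 18 = a + w ∧
      s'.nat 19 = a + 2 * w ∧ s'.nat 20 = a + (x + y) ∧ s'.natMem 1 = s.natMem 1 ∧
      (∀ u < a, s'.natMem 2 u = s.natMem 2 u) ∧
      MergeInv (s.realMem 1) (s.natMem 1) (s'.natMem 2) a w x' y' ∧ Frame 16 s s')
    (Halts.ite (c₁ := 8) (fun ht => ?_) (fun ht => ?_)
      (by simp [Test.cost, NatExpr.cost, RealExpr.cost])) ?_ le_rfl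
  · simp only [Test.holds, NatExpr.eval, RealExpr.eval, h16, h17, h18, h19, not_and, not_lt] at ht
    refine Halts.putNat_seq (c₂ := 4) (Halts.setNat (by simp [NatExpr.cost]) ?_) (by simp [NatExpr.cost])
    refine ⟨x + 1, y, by omega, hy, by omega, ?_, ?_, ?_, ?_, ?_, ?_, ?_, ?_, ?_⟩ <;>
      simp [NatExpr.eval, h16, h17, h18, h19, h20]
    · omega
    · intro u hu; rw [Function.update_of_ne (by omega)]
    · exact hI.left hp (by omega) (fun hy => ht.2 (by omega))
    · refine ⟨rfl, rfl, fun i hi => ?_, fun b hb hb' => ?_⟩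
      · simp [Function.update_of_ne (show i ≠ 16 by omega)]
      · simp [Function.update_of_ne hb']
  · simp only [Test.holds, NatExpr.eval, RealExpr.eval, h16, h17, h18, h19] at ht
    refine Halts.putNat_seq (c₂ := 4) (Halts.setNat (by simp [NatExpr.cost]) ?_) (by simp [NatExpr.cost])
    have hy' : y < w := by
      by_contra hcon
      exact ht ⟨by omega, fun h => by omega⟩
    have hk : x < w → s.realMem 1 (s.natMem 1 (a + w + y)) ≤ s.realMem 1 (s.natMem 1 (a + x)) := by
      intro hxw
      by_contra hcon
      exact ht ⟨by omega, fun h => hcon h.2.le⟩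
    refine ⟨x, y + 1, by omega, by omega, by omega, ?_, ?_, ?_, ?_, ?_, ?_, ?_, ?_, ?_⟩ <;>
      simp [NatExpr.eval, h16, h17, h18, h19, h20]
    · omega
    · intro u hu; rw [Function.update_of_ne (by omega)]
    · exact hI.right hp' hy' hk
    · refine ⟨rfl, rfl, fun i hi => ?_, fun b hb hb' => ?_⟩
      · simp [Function.update_of_ne (show i ≠ 17 by omega)]
      · simp [Function.update_of_ne hb']
  · rintro s' ⟨x', y', h1, h2, h3, h4, h5, h6, h7, h8, h9, h10, h11, h12⟩
    refine Halts.setNat (by simp [NatExpr.cost]) ⟨x', y', h1, h2, h3, ?_, ?_, ?_, ?_, ?_, ?_, ?_, ?_, ?_⟩ <;>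
      simp [NatExpr.eval, h4, h5, h6, h7, h8, h9]
    · omega
    · exact h10
    · exact h11
    · refine h12.trans ⟨rfl, rfl, fun i hi => ?_, fun b hb hb' => rfl⟩
      simp [Function.update_of_ne (show i ≠ 20 by omega)]

/-- Both runs have the full length `w`: all arrays that are merged have a multiple of `2 * w`
entries, so no incomplete run has to be treated. The cells of the target below `a`, where earlier
merged runs lie, are untouched. -/
theorem mergeRuns_halts {F : List Cmd} {D : ColumnData} {s : State} {a w : ℕ}
    (h12 : s.nat 12 = w) (h15 : s.nat 15 = a)
    (hp : SortedSeg (s.realMem 1) (s.natMem 1) a w)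
    (hp' : SortedSeg (s.realMem 1) (s.natMem 1) (a + w) w) :
    Halts F D mergeRuns s (70 * w + 30) fun s' =>
      s'.nat 15 = a + 2 * w ∧ s'.natMem 1 = s.natMem 1 ∧
      (∀ u < a, s'.natMem 2 u = s.natMem 2 u) ∧
      seg (s'.natMem 2) a (2 * w) = seg (s.natMem 1) a (2 * w) ∧
      SortedSeg (s.realMem 1) (s'.natMem 2) a (2 * w) ∧ Frame 15 s s' := by
  unfold mergeRuns
  refine Halts.setNat_seq (c₂ := 70 * w + 26) ?_ (by simp [NatExpr.cost]; omega)
  refine Halts.setNat_seq (c₂ := 70 * w + 22) ?_ (by simp [NatExpr.cost]; omega)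
  refine Halts.setNat_seq (c₂ := 70 * w + 20) ?_ (by simp [NatExpr.cost]; omega)
  refine Halts.setNat_seq (c₂ := 70 * w + 18) ?_ (by simp [NatExpr.cost]; omega)
  refine Halts.setNat_seq (c₂ := 70 * w + 16) ?_ (by simp [NatExpr.cost]; omega)
  simp only [NatExpr.eval]
  refine Halts.seq (c₁ := 70 * w + 3) (c₂ := 2) (R := fun s' =>
      s'.nat 19 = a + 2 * w ∧ s'.natMem 1 = s.natMem 1 ∧
      (∀ u < a, s'.natMem 2 u = s.natMem 2 u) ∧
      MergeInv (s.realMem 1) (s.natMem 1) (s'.natMem 2) a w w w ∧ Frame 15 s s') ?_ ?_ (by omega)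
  · refine Halts.loop_const (2 * w) (fun o s' => ∃ x y, x ≤ w ∧ y ≤ w ∧ x + y = o ∧
      s'.nat 16 = a + x ∧ s'.nat 17 = a + w + y ∧ s'.nat 18 = a + w ∧
      s'.nat 19 = a + 2 * w ∧ s'.nat 20 = a + (x + y) ∧ s'.natMem 1 = s.natMem 1 ∧
      (∀ u < a, s'.natMem 2 u = s.natMem 2 u) ∧
      MergeInv (s.realMem 1) (s.natMem 1) (s'.natMem 2) a w x y ∧ Frame 15 s s') 32
      ⟨0, 0, by omega, by omega, by omega, ?_, ?_, ?_, ?_, ?_, ?_, ?_, ?_, ?_⟩ ?_ ?_ ?_ ?_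
    any_goals simp [h12, h15]
    · omega
    · exact MergeInv.zero _ _ _ _ _
    · refine ⟨rfl, rfl, fun i hi => ?_, fun b hb hb' => rfl⟩
      simp [Function.update_of_ne (show i ≠ 16 by omega), Function.update_of_ne (show i ≠ 17 by omega),
        Function.update_of_ne (show i ≠ 18 by omega), Function.update_of_ne (show i ≠ 19 by omega),
        Function.update_of_ne (show i ≠ 20 by omega)]
    · rintro o ho s' x hx y hy rfl h1 h2 h3 h4 h5 h6 h7 h8 h9
      refine ⟨by simp [Test.holds, NatExpr.eval, h4, h5]; omega, ?_⟩
      rw [← h6, ← h9.realMem] at h8 hp hp'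
      refine (mergeStep_halts hx hy (by omega) h1 h2 h3 h4 h5 hp hp' h8).mono le_rfl ?_
      rintro s'' ⟨x', y', g1, g2, g3, g4, g5, g6, g7, g8, g9, g10, g11, g12⟩
      rw [h6, h9.realMem] at g11
      exact ⟨x', g1, y', g2, g3, g4, g5, g6, g7, g8, g9.trans h6,
        fun u hu => (g10 u hu).trans (h7 u hu), g11, h9.trans (g12.mono (by omega))⟩
    · rintro s' x hx y hy hxy h1 h2 h3 h4 h5 h6 h7 h8 h9
      simp [Test.holds, NatExpr.eval, h4, h5]; omega
    · simp [Test.cost, NatExpr.cost]; omega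
    · rintro s' x hx y hy hxy h1 h2 h3 h4 h5 h6 h7 h8 h9
      obtain rfl : x = w := by omega
      obtain rfl : y = x := by omega
      exact ⟨h4, h6, h7, h8, h9⟩
  · rintro s' ⟨h1, h2, h3, h4, h5⟩
    refine Halts.setNat (by simp [NatExpr.cost]) ⟨by simp [NatExpr.eval, h1], h2, h3, ?_, ?_, ?_⟩
    · have := h4.seg_eq
      rw [← seg_add, ← two_mul] at this
      exact this
    · have := h4.sorted
      rwa [← two_mul] at this
    · refine h5.trans ⟨rfl, rfl, fun i hi => ?_, fun b hb hb' => rfl⟩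
      simp [Function.update_of_ne (show i ≠ 15 by omega)]

theorem mergePass_halts {F : List Cmd} {D : ColumnData} {s : State} {g w : ℕ}
    (h11 : s.nat 11 = g * (2 * w)) (h12 : s.nat 12 = w) (hw : 0 < w)
    (hp : ∀ u < 2 * g, SortedSeg (s.realMem 1) (s.natMem 1) (u * w) w) :
    Halts F D mergePass s (100 * (g * (2 * w)) + 10) fun s' =>
      (∀ u < g, SortedSeg (s.realMem 1) (s'.natMem 1) (u * (2 * w)) (2 * w)) ∧
      seg (s'.natMem 1) 0 (g * (2 * w)) = seg (s.natMem 1) 0 (g * (2 * w)) ∧ Frame 15 s s' := by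
  unfold mergePass
  refine Halts.setNat_seq (c₂ := 100 * (g * (2 * w)) + 8) ?_ (by simp [NatExpr.cost]; omega)
  simp only [NatExpr.eval]
  -- Absorbs the constant overhead per pair of runs into a bound linear in the length of the array.
  have hg : g ≤ g * w := Nat.le_mul_of_pos_right g hw
  refine Halts.seq (c₁ := 70 * (g * w) + 33 * g + 3) (c₂ := 24 * (g * w) + 5) (R := fun s' =>
      s'.natMem 1 = s.natMem 1 ∧
      (∀ u < g, SortedSeg (s.realMem 1) (s'.natMem 2) (u * (2 * w)) (2 * w)) ∧
      seg (s'.natMem 2) 0 (g * (2 * w)) = seg (s.natMem 1) 0 (g * (2 * w)) ∧ Frame 15 s s')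
    ?_ ?_ (by rw [show g * (2 * w) = 2 * (g * w) by ring]; omega)
  · refine Halts.loop_const g (fun x s' => s'.nat 15 = x * (2 * w) ∧ s'.natMem 1 = s.natMem 1 ∧
      (∀ u < x, SortedSeg (s.realMem 1) (s'.natMem 2) (u * (2 * w)) (2 * w)) ∧
      seg (s'.natMem 2) 0 (x * (2 * w)) = seg (s.natMem 1) 0 (x * (2 * w)) ∧ Frame 15 s s')
      (70 * w + 30) ⟨by simp, rfl, by simp, by simp, ?_⟩ ?_ ?_ ?_ (fun s' h => h.2)
    · refine ⟨rfl, rfl, fun i hi => ?_, fun b hb hb' => rfl⟩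
      simp [Function.update_of_ne (show i ≠ 15 by omega)]
    · rintro x hx s' ⟨h1, h2, h3, h4, h5⟩
      refine ⟨?_, ?_⟩
      · simp only [Test.holds, NatExpr.eval, h1, h5.nat 11 (by omega), h11]
        exact Nat.mul_lt_mul_of_pos_right hx (by omega)
      have e1 := hp (2 * x) (by omega)
      have e2 := hp (2 * x + 1) (by omega)
      rw [show 2 * x * w = x * (2 * w) by ring] at e1
      rw [show (2 * x + 1) * w = x * (2 * w) + w by ring] at e2
      rw [← h2, ← h5.realMem] at e1 e2
      refine (mergeRuns_halts ((h5.nat 12 (by omega)).trans h12) h1 e1 e2).mono le_rfl ?_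
      rintro s'' ⟨g1, g2, g3, g4, g5, g6⟩
      refine ⟨by rw [g1]; ring, g2.trans h2, ?_, ?_, h5.trans g6⟩
      · intro u hu
        rcases Nat.lt_or_ge u x with hux | hux
        · refine (h3 u hux).congr fun i hi => g3 _ ?_
          have : (u + 1) * (2 * w) ≤ x * (2 * w) := Nat.mul_le_mul_right _ hux
          rw [add_mul, one_mul] at this
          omega
        · obtain rfl : u = x := by omega
          rwa [h5.realMem] at g5
      · rw [add_mul, one_mul, seg_add, seg_add, zero_add, g4, h2, ← h4]
        congr 1
        exact seg_congr fun i hi => by rw [zero_add]; exact g3 _ hi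
    · rintro s' ⟨h1, h2, h3, h4, h5⟩
      simp [Test.holds, NatExpr.eval, h1, h5.nat 11 (by omega), h11]
    · simp only [Test.cost, NatExpr.cost]
      apply le_of_eq
      ring
  · rintro s' ⟨h1, h2, h3, h4⟩
    refine Halts.setNat_seq (c₂ := 24 * (g * w) + 3) ?_ (by simp [NatExpr.cost]; omega)
    refine Halts.loop_const (g * (2 * w)) (fun x s'' => s''.nat 20 = x ∧
      s''.natMem 2 = s'.natMem 2 ∧ (∀ u < x, s''.natMem 1 u = s'.natMem 2 u) ∧ Frame 15 s s'')
      8 ⟨by simp [NatExpr.eval], rfl, by simp, ?_⟩ ?_ ?_ ?_ ?_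
    · refine h4.trans ⟨rfl, rfl, fun i hi => ?_, fun b hb hb' => rfl⟩
      simp [Function.update_of_ne (show i ≠ 20 by omega)]
    · rintro x hx s'' ⟨g1, g2, g3, g4⟩
      refine ⟨?_, ?_⟩
      · simpa only [Test.holds, NatExpr.eval, g1, g4.nat 11 (by omega), h11]
      refine Halts.putNat_seq (c₂ := 4) (Halts.setNat (by simp [NatExpr.cost]) ?_)
        (by simp [NatExpr.cost])
      refine ⟨by simp [NatExpr.eval, g1], by simp [g2], ?_, g4.trans ⟨rfl, rfl, fun i hi => ?_,
        fun b hb hb' => ?_⟩⟩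
      · intro u hu
        simp only [NatExpr.eval, g1, g2, Function.update_self]
        rcases eq_or_ne u x with rfl | hux
        · simp
        · rw [Function.update_of_ne hux]; exact g3 u (by omega)
      · simp [Function.update_of_ne (show i ≠ 20 by omega)]
      · simp [Function.update_of_ne hb]
    · rintro s'' ⟨g1, g2, g3, g4⟩
      simp [Test.holds, NatExpr.eval, g1, g4.nat 11 (by omega), h11]
    · simp only [Test.cost, NatExpr.cost]
      rw [show g * (2 * w) = 2 * (g * w) by ring]; omega
    · rintro s'' ⟨g1, g2, g3, g4⟩
      refine ⟨fun u hu => (h2 u hu).congr fun i hi => g3 _ ?_, ?_, g4⟩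
      · have : (u + 1) * (2 * w) ≤ g * (2 * w) := Nat.mul_le_mul_right _ hu
        rw [add_mul, one_mul] at this
        omega
      · rw [← h3]
        exact seg_congr fun i hi => by rw [zero_add]; exact g3 _ hi


/-! ### Approximate medians in linear time -/

/-- The number of entries among `p 0, …, p (N - 1)` with the property `X`. -/
def cnt (X : ℕ → Prop) [DecidablePred X] (p : ℕ → ℕ) (N : ℕ) : ℕ :=
  ∑ i ∈ Finset.range N, if X (p i) then 1 else 0

/-- Merging only permutes entries; hence it changes no counts, and ranks are distorted by the
discarding step alone. -/
theorem cnt_eq_of_seg_eq (X : ℕ → Prop) [DecidablePred X] {p q : ℕ → ℕ} {N : ℕ}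
    (h : seg p 0 N = seg q 0 N) : cnt X p N = cnt X q N := by
  have key : ∀ p : ℕ → ℕ, cnt X p N = ((seg p 0 N).map fun v => if X v then 1 else 0).sum := by
    intro p
    simp only [cnt, seg, Multiset.map_map, Finset.sum, Finset.range_val, zero_add]
    rfl
  rw [key, key, h]

theorem sum_range_two_mul (f : ℕ → ℕ) (h : ℕ) :
    ∑ i ∈ Finset.range (2 * h), f i = ∑ i ∈ Finset.range h, (f (2 * i) + f (2 * i + 1)) := by
  induction h with
  | zero => simp
  | succ h ih =>
    rw [show 2 * (h + 1) = 2 * h + 1 + 1 by ring, Finset.sum_range_succ, Finset.sum_range_succ, ih,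
      Finset.sum_range_succ, add_assoc]

/-- Keeping every other entry of sorted runs does not increase the fraction of large keys. -/
theorem two_mul_cnt_high_le {key : ℕ → ℝ} {p p' : ℕ → ℕ} {g r : ℕ} (hr : 0 < r)
    (hp : ∀ u < g, SortedSeg key p (u * (2 * r)) (2 * r))
    (hp' : ∀ i < g * r, p' i = p (2 * i)) (z : ℝ) [DecidablePred fun v => z < key v] :
    2 * cnt (fun v => z < key v) p' (g * r) ≤ cnt (fun v => z < key v) p (g * (2 * r)) := by
  unfold cnt
  rw [show g * (2 * r) = 2 * (g * r) by ring, sum_range_two_mul, Finset.mul_sum]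
  refine Finset.sum_le_sum fun i hi => ?_
  have hi := Finset.mem_range.1 hi
  rw [hp' i hi]
  have h1 : i / r < g := Nat.div_lt_of_lt_mul (by rwa [mul_comm] at hi)
  have h2 := Nat.div_add_mod i r
  have h3 := Nat.mod_lt i hr
  have h4 := hp (i / r) h1 (2 * (i % r)) (2 * (i % r) + 1) (by omega) (by omega)
  have h5 : i / r * (2 * r) = 2 * (r * (i / r)) := by ring
  rw [show i / r * (2 * r) + 2 * (i % r) = 2 * i by omega,
    show i / r * (2 * r) + (2 * (i % r) + 1) = 2 * i + 1 by omega] at h4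
  -- A kept large entry is followed in its run by a discarded one that is at least as large.
  by_cases hz : z < key (p (2 * i))
  · simp [hz, hz.trans_le h4]
  · simp [hz]

theorem sum_range_dvd (g r : ℕ) (hr : 0 < r) :
    (∑ i ∈ Finset.range (g * r), if i % r = 0 then 1 else 0) = g := by
  induction g with
  | zero => simp
  | succ g ih =>
    rw [add_mul, one_mul, Finset.sum_range_add, ih]
    congr 1
    rw [Finset.sum_eq_single 0]
    · simp
    · intro i hi h0
      have := Finset.mem_range.1 hi
      rw [Nat.add_comm, Nat.add_mul_mod_self_right, Nat.mod_eq_of_lt this]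
      simp [h0]
    · simp; omega

/-- Keeping every other entry of sorted runs increases the number of small keys, relative to the
number of entries, by at most one per run. -/
theorem two_mul_cnt_low_le {key : ℕ → ℝ} {p p' : ℕ → ℕ} {g r : ℕ} (hr : 0 < r)
    (hp : ∀ u < g, SortedSeg key p (u * (2 * r)) (2 * r))
    (hp' : ∀ i < g * r, p' i = p (2 * i)) (z : ℝ) [DecidablePred fun v => key v < z] :
    2 * cnt (fun v => key v < z) p' (g * r) ≤ cnt (fun v => key v < z) p (g * (2 * r)) + g := by
  unfold cnt
  rw [show g * (2 * r) = 2 * (g * r) by ring, sum_range_two_mul, Finset.sum_add_distrib]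
  have h1 : ∑ i ∈ Finset.range (g * r), (if key (p' i) < z then 1 else 0) =
      ∑ i ∈ Finset.range (g * r), (if key (p (2 * i)) < z then 1 else 0) :=
    Finset.sum_congr rfl fun i hi => by rw [hp' i (Finset.mem_range.1 hi)]
  have h2 : ∑ i ∈ Finset.range (g * r), (if key (p (2 * i)) < z then 1 else 0) ≤
      ∑ i ∈ Finset.range (g * r), (if key (p (2 * i + 1)) < z then 1 else 0) + g := by
    rcases hN : g * r with _ | N
    · simp
    · rw [← hN]
      -- A small entry at position `2 * i` is charged to position `2 * i - 1`, which is small too if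
      -- it lies in the same run. The `g` entries that start a run have no such predecessor and are
      -- charged to the second summand.
      calc ∑ i ∈ Finset.range (g * r), (if key (p (2 * i)) < z then 1 else 0)
          ≤ ∑ i ∈ Finset.range (g * r), ((if i = 0 then 0 else
              if key (p (2 * (i - 1) + 1)) < z then 1 else 0) + if i % r = 0 then 1 else 0) := by
            refine Finset.sum_le_sum fun i hi => ?_
            have hi := Finset.mem_range.1 hi
            by_cases h0 : i % r = 0
            · simp only [h0, if_true]; split_ifs <;> omega
            · have hi0 : i ≠ 0 := by rintro rfl; simp at h0
              simp only [h0, hi0, if_false, add_zero]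
              have h1 : i / r < g := Nat.div_lt_of_lt_mul (by rwa [mul_comm] at hi)
              have h2 := Nat.div_add_mod i r
              have h3 := Nat.mod_lt i hr
              have h4 := hp (i / r) h1 (2 * (i % r) - 1) (2 * (i % r)) (by omega) (by omega)
              have h5 : i / r * (2 * r) = 2 * (r * (i / r)) := by ring
              rw [show i / r * (2 * r) + 2 * (i % r) = 2 * i by omega,
                show i / r * (2 * r) + (2 * (i % r) - 1) = 2 * (i - 1) + 1 by omega] at h4
              by_cases hz : key (p (2 * i)) < z
              · simp [hz, h4.trans_lt hz]
              · simp [hz]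
        _ ≤ _ := by
            rw [Finset.sum_add_distrib, sum_range_dvd g r hr, hN, Finset.sum_range_succ']
            simp only [if_true, Nat.add_sub_cancel, add_zero, Nat.succ_ne_zero, if_false]
            rw [Finset.sum_range_succ]
            omega
  beta_reduce
  omega

/-- Keep every other entry of the array 1 of length `N` (register 11). -/
def compact : Cmd :=
  .setNat 15 (.lit 0) ;;
  .setNat 16 (.lit 0) ;;
  .loop (.natLt (.reg 16) (.reg 11))
    (.putNat 1 (.reg 15) (.mem 1 (.reg 16)) ;;
      .setNat 15 (.add (.reg 15) (.lit 1)) ;; .setNat 16 (.add (.reg 16) (.lit 2))) ;;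
  .setNat 11 (.reg 15)

/-- Compaction in place is safe because the writing position `x` never overtakes the reading
position `2 * x`; the invariant records that the cells from `x` on are still original. -/
theorem compact_halts {F : List Cmd} {D : ColumnData} {s : State} {h : ℕ}
    (h11 : s.nat 11 = 2 * h) :
    Halts F D compact s (15 * h + 9) fun s' => s'.nat 11 = h ∧
      (∀ i < h, s'.natMem 1 i = s.natMem 1 (2 * i)) ∧ s'.nat 12 = s.nat 12 ∧
      s'.nat 13 = s.nat 13 ∧ Frame 11 s s' := by
  unfold compact
  refine Halts.setNat_seq (c₂ := 15 * h + 7) ?_ (by simp [NatExpr.cost]; omega)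
  refine Halts.setNat_seq (c₂ := 15 * h + 5) ?_ (by simp [NatExpr.cost]; omega)
  simp only [NatExpr.eval]
  refine Halts.seq (c₁ := 15 * h + 3) (c₂ := 2) (R := fun s' => s'.nat 15 = h ∧
      (∀ i < h, s'.natMem 1 i = s.natMem 1 (2 * i)) ∧ Frame 14 s s') ?_ ?_ (by omega)
  · refine Halts.loop_const h (fun x s' => s'.nat 15 = x ∧ s'.nat 16 = 2 * x ∧
      (∀ i < x, s'.natMem 1 i = s.natMem 1 (2 * i)) ∧
      (∀ i ≥ x, s'.natMem 1 i = s.natMem 1 i) ∧ Frame 14 s s') 12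
      ⟨by simp, by simp, by simp, by simp, ?_⟩ ?_ ?_ ?_ ?_
    · refine ⟨rfl, rfl, fun i hi => ?_, fun b hb hb' => rfl⟩
      simp [Function.update_of_ne (show i ≠ 15 by omega),
        Function.update_of_ne (show i ≠ 16 by omega)]
    · rintro x hx s' ⟨h1, h2, h3, h4, h5⟩
      refine ⟨?_, ?_⟩
      · simp only [Test.holds, NatExpr.eval, h2, h5.nat 11 (by omega), h11]; omega
      refine Halts.putNat_seq (c₂ := 8) (Halts.setNat_seq (c₂ := 4)
        (Halts.setNat (by simp [NatExpr.cost]) ?_) (by simp [NatExpr.cost])) (by simp [NatExpr.cost])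
      simp only [NatExpr.eval, h1, h2]
      refine ⟨by simp, ?_, ?_, ?_, h5.trans ⟨rfl, rfl, fun i hi => ?_, fun b hb hb' => ?_⟩⟩
      · simp [h2]; omega
      · intro i hi
        rw [Function.update_self]
        rcases eq_or_ne i x with rfl | hix
        · rw [Function.update_self]; exact h4 _ (by omega)
        · rw [Function.update_of_ne hix]; exact h3 i (by omega)
      · intro i hi
        rw [Function.update_self, Function.update_of_ne (by omega)]
        exact h4 i (by omega)
      · simp [Function.update_of_ne (show i ≠ 15 by omega),
          Function.update_of_ne (show i ≠ 16 by omega)]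
      · simp [Function.update_of_ne hb]
    · rintro s' ⟨h1, h2, h3, h4, h5⟩
      simp [Test.holds, NatExpr.eval, h2, h5.nat 11 (by omega), h11]
    · simp only [Test.cost, NatExpr.cost]; omega
    · rintro s' ⟨h1, h2, h3, h4, h5⟩
      exact ⟨h1, h3, h5⟩
  · rintro s' ⟨h1, h2, h3⟩
    refine Halts.setNat (by simp [NatExpr.cost]) ⟨by simp [NatExpr.eval, h1], h2,
      by simpa using h3.nat 12 (by omega), by simpa using h3.nat 13 (by omega),
      (h3.mono (by omega)).trans ⟨rfl, rfl, fun i hi => ?_, fun b hb hb' => rfl⟩⟩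
    simp [Function.update_of_ne (show i ≠ 11 by omega)]

/-- Replace four sorted runs of length `w` by every other entry of the merged run. -/
def medianStage : Cmd :=
  .setNat 13 (.reg 12) ;;
  mergePass ;;
  .setNat 12 (.add (.reg 12) (.reg 12)) ;;
  mergePass ;;
  compact ;;
  .setNat 12 (.add (.reg 13) (.reg 13))

-- The number of runs falls by a factor of four and the number of entries only by two. Each stage
-- adds an error of one per run to the low count, so the errors, rescaled to the original array,
-- form a decreasing geometric series.
open Classical in
theorem medianStage_halts {F : List Cmd} {D : ColumnData} {s : State} {g w : ℕ}
    (h11 : s.nat 11 = 4 * g * w) (h12 : s.nat 12 = w) (hw : 0 < w) (hg : 0 < g)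
    (hp : ∀ u < 4 * g, SortedSeg (s.realMem 1) (s.natMem 1) (u * w) w) :
    Halts F D medianStage s (290 * (4 * g * w)) fun s' =>
      s'.nat 11 = g * (2 * w) ∧ s'.nat 12 = 2 * w ∧
      (∀ u < g, SortedSeg (s.realMem 1) (s'.natMem 1) (u * (2 * w)) (2 * w)) ∧
      (∀ z, 2 * cnt (fun v => z < s.realMem 1 v) (s'.natMem 1) (g * (2 * w)) ≤
        cnt (fun v => z < s.realMem 1 v) (s.natMem 1) (4 * g * w)) ∧
      (∀ z, 2 * cnt (fun v => s.realMem 1 v < z) (s'.natMem 1) (g * (2 * w)) ≤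
        cnt (fun v => s.realMem 1 v < z) (s.natMem 1) (4 * g * w) + g) ∧ Frame 11 s s' := by
  have hgw : 0 < g * w := Nat.mul_pos hg hw
  have e1 : 4 * g * w = 2 * g * (2 * w) := by ring
  have e2 : 4 * g * w = g * (2 * (2 * w)) := by ring
  have e3 : 4 * g * w = 4 * (g * w) := by ring
  unfold medianStage
  refine Halts.setNat_seq (c₂ := 288 * (4 * g * w)) ?_ (by simp [NatExpr.cost]; omega)
  refine Halts.seq (c₁ := 103 * (4 * g * w)) (c₂ := 185 * (4 * g * w)) (R := fun s' =>
      (∀ u < 2 * g, SortedSeg (s.realMem 1) (s'.natMem 1) (u * (2 * w)) (2 * w)) ∧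
      seg (s'.natMem 1) 0 (4 * g * w) = seg (s.natMem 1) 0 (4 * g * w) ∧ s'.nat 13 = w ∧
      s'.nat 12 = w ∧ s'.nat 11 = 4 * g * w ∧ Frame 11 s s') ?_ ?_ (by omega)
  · refine (mergePass_halts (g := 2 * g) (w := w) ?_ ?_ hw ?_).mono ?_ ?_
    · simp [h11]; ring
    · simp [h12]
    · rw [← mul_assoc]
      exact hp
    · rw [← e1]; omega
    · rintro s' ⟨h1, h2, h3⟩
      rw [← e1] at h2
      refine ⟨h1, h2, ?_, ?_, ?_, ?_⟩
      · simp [h3.nat 13 (by omega), h12, NatExpr.eval]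
      · simp [h3.nat 12 (by omega), h12]
      · simp [h3.nat 11 (by omega), h11]
      · exact (h3.mono (by norm_num)).of_setNat (by norm_num)
  · rintro s₁ ⟨h1, h2, h3, h4, h5, h6⟩
    refine Halts.setNat_seq (c₂ := 183 * (4 * g * w)) ?_ (by simp [NatExpr.cost]; omega)
    refine Halts.seq (c₁ := 103 * (4 * g * w)) (c₂ := 80 * (4 * g * w)) (R := fun s' =>
      (∀ u < g, SortedSeg (s.realMem 1) (s'.natMem 1) (u * (2 * (2 * w))) (2 * (2 * w))) ∧
      seg (s'.natMem 1) 0 (4 * g * w) = seg (s.natMem 1) 0 (4 * g * w) ∧ s'.nat 13 = w ∧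
      s'.nat 11 = 4 * g * w ∧ Frame 11 s s') ?_ ?_ (by omega)
    · refine (mergePass_halts (g := g) (w := 2 * w) ?_ ?_ (by omega) ?_).mono ?_ ?_
      · simp [h5]; ring
      · simp [h4, NatExpr.eval]; omega
      · simp only [h6.realMem]
        exact h1
      · rw [← e2]; omega
      · rintro s' ⟨g1, g2, g3⟩
        simp only [h6.realMem] at g1
        rw [← e2] at g2
        refine ⟨g1, g2.trans h2, ?_, ?_, h6.trans ((g3.mono (by norm_num)).of_setNat (by norm_num))⟩
        · simp [g3.nat 13 (by omega), h3]
        · simp [g3.nat 11 (by omega), h5]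
    · rintro s₂ ⟨k1, k2, k3, k4, k5⟩
      refine Halts.seq (compact_halts (h := g * (2 * w)) (by rw [k4]; ring)) (c₂ := 4) ?_
        (by rw [show g * (2 * w) = 2 * (g * w) by ring]; omega)
      rintro s₃ ⟨l1, l2, l3, l4, l5⟩
      refine Halts.setNat (by simp [NatExpr.cost]) ⟨by simpa using l1, ?_, ?_, ?_, ?_, ?_⟩
      · simp [NatExpr.eval, l4, k3]; ring
      · intro u hu i j hij hj
        have e4 : (u + 1) * (2 * w) ≤ g * (2 * w) := Nat.mul_le_mul_right _ hu
        rw [add_mul, one_mul] at e4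
        rw [l2 _ (by omega), l2 _ (by omega)]
        have := k1 u hu (2 * i) (2 * j) (by omega) (by omega)
        rwa [show u * (2 * (2 * w)) + 2 * i = 2 * (u * (2 * w) + i) by ring,
          show u * (2 * (2 * w)) + 2 * j = 2 * (u * (2 * w) + j) by ring] at this
      · intro z
        have := two_mul_cnt_high_le (r := 2 * w) (by omega) k1 l2 z
        rwa [← e2, cnt_eq_of_seg_eq _ k2] at this
      · intro z
        have := two_mul_cnt_low_le (r := 2 * w) (by omega) k1 l2 z
        rwa [← e2, cnt_eq_of_seg_eq _ k2] at this
      · refine k5.trans (l5.trans ⟨rfl, rfl, fun i hi => ?_, fun b hb hb' => rfl⟩)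
        simp [Function.update_of_ne (show i ≠ 12 by omega)]

/-- Of the numbers `v 0, …, v (N - 1)`, at least a quarter are at most `e`, and at least a quarter
are at least `e`. -/
structure IsCentral (v : ℕ → ℝ) (N : ℕ) (e : ℝ) : Prop where
  le : ∀ z, 4 * ((Finset.range N).filter fun l => v l < z).card < N → z ≤ e
  ge : ∀ z, 4 * ((Finset.range N).filter fun l => z < v l).card < N → e ≤ z

theorem IsCentral.congr {v v' : ℕ → ℝ} {N : ℕ} {e : ℝ} (h : IsCentral v N e)
    (hv : ∀ l < N, v' l = v l) : IsCentral v' N e where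
  le z hz := by
    refine h.le z ?_
    rwa [Finset.filter_congr fun l hl => by rw [← hv l (Finset.mem_range.1 hl)]]
  ge z hz := by
    refine h.ge z ?_
    rwa [Finset.filter_congr fun l hl => by rw [← hv l (Finset.mem_range.1 hl)]]

theorem SortedSeg.lt_cnt_low {key : ℕ → ℝ} {p : ℕ → ℕ} {N i : ℕ} (h : SortedSeg key p 0 N)
    (hi : i < N) {z : ℝ} (hz : key (p i) < z) [DecidablePred fun v => key v < z] :
    i < cnt (fun v => key v < z) p N := by
  unfold cnt
  calc i < ∑ j ∈ Finset.range (i + 1), 1 := by simp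
    _ ≤ ∑ j ∈ Finset.range (i + 1), if key (p j) < z then 1 else 0 := by
        refine Finset.sum_le_sum fun j hj => ?_
        have := h j i (by simpa [Nat.lt_succ_iff] using hj) hi
        rw [zero_add, zero_add] at this
        rw [if_pos (this.trans_lt hz)]
    _ ≤ _ := Finset.sum_le_sum_of_subset (by simpa using hi)

theorem SortedSeg.le_cnt_high {key : ℕ → ℝ} {p : ℕ → ℕ} {N i : ℕ} (h : SortedSeg key p 0 N)
    {z : ℝ} (hz : z < key (p i)) [DecidablePred fun v => z < key v] :
    N - i ≤ cnt (fun v => z < key v) p N := by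
  unfold cnt
  calc N - i = ∑ j ∈ Finset.Ico i N, 1 := by simp
    _ ≤ ∑ j ∈ Finset.Ico i N, if z < key (p j) then 1 else 0 := by
        refine Finset.sum_le_sum fun j hj => ?_
        rw [Finset.mem_Ico] at hj
        have := h i j hj.1 hj.2
        rw [zero_add, zero_add] at this
        rw [if_pos (hz.trans_le this)]
    _ ≤ _ := Finset.sum_le_sum_of_subset (by intro j hj; simp at hj ⊢; omega)

/-- Find (an address in register 14 of an address of) an approximate median of the real array 1. -/
def approxMedian : Cmd :=
  .setNat 12 (.lit 1) ;;
  .loop (.natLt (.reg 12) (.reg 11)) medianStage ;;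
  .setNat 14 (.lit 0) ;;
  .loop (.natLt (.add (.add (.reg 14) (.reg 14)) (.add (.reg 14) (.reg 14)))
    (.add (.reg 12) (.add (.reg 12) (.reg 12)))) (.setNat 14 (.add (.reg 14) (.lit 1)))

-- After `d` stages a single sorted run of `2 ^ d` entries represents the `4 ^ d` keys. The fraction
-- of large keys has not grown, and the fraction of small keys has grown by less than one half. The
-- position at three quarters of the run therefore has a quarter of the original keys on either
-- side.
open Classical in
theorem approxMedian_halts {F : List Cmd} {D : ColumnData} {s : State} {d : ℕ} (hd : 2 ≤ d)
    (h11 : s.nat 11 = 4 ^ d) (hp : ∀ i < 4 ^ d, s.natMem 1 i = i) :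
    Halts F D approxMedian s (700 * 4 ^ d) fun s' =>
      IsCentral (s.realMem 1) (4 ^ d) (s.realMem 1 (s'.natMem 1 (s'.nat 14))) ∧ Frame 11 s s' := by
  have hd2 : (2 : ℕ) ^ d = 4 * 2 ^ (d - 2) := by
    obtain ⟨k, rfl⟩ := Nat.exists_eq_add_of_le hd
    rw [Nat.add_sub_cancel_left, pow_add]; norm_num
  have hd3 : (4 : ℕ) ^ d = 2 ^ d * 2 ^ d := by rw [← mul_pow]; norm_num
  have hpos : 0 < (2 : ℕ) ^ (d - 2) := by positivity
  have hle : (2 : ℕ) ^ d * 4 ≤ 4 ^ d := by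
    rw [hd3]; exact Nat.mul_le_mul_left _ (by omega)
  unfold approxMedian
  refine Halts.setNat_seq (c₂ := 700 * 4 ^ d - 2) ?_ (by simp [NatExpr.cost]; omega)
  simp only [NatExpr.eval]
  refine Halts.seq (c₁ := 600 * 4 ^ d) (c₂ := 90 * 4 ^ d) (R := fun s' => s'.nat 12 = 2 ^ d ∧
      SortedSeg (s.realMem 1) (s'.natMem 1) 0 (2 ^ d) ∧
      (∀ z, 2 ^ d * cnt (fun v => z < s.realMem 1 v) (s'.natMem 1) (2 ^ d) ≤
        cnt (fun v => z < s.realMem 1 v) (s.natMem 1) (4 ^ d)) ∧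
      (∀ z, 2 * 2 ^ d * cnt (fun v => s.realMem 1 v < z) (s'.natMem 1) (2 ^ d) + 2 ^ d ≤
        2 * cnt (fun v => s.realMem 1 v < z) (s.natMem 1) (4 ^ d) + 4 ^ d) ∧
      Frame 11 s s') ?_ ?_ (by omega)
  · refine Halts.loop d (fun t s' => s'.nat 11 = 4 ^ (d - t) * 2 ^ t ∧ s'.nat 12 = 2 ^ t ∧
      (∀ u < 4 ^ (d - t), SortedSeg (s.realMem 1) (s'.natMem 1) (u * 2 ^ t) (2 ^ t)) ∧
      (∀ z, 2 ^ t * cnt (fun v => z < s.realMem 1 v) (s'.natMem 1) (4 ^ (d - t) * 2 ^ t) ≤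
        cnt (fun v => z < s.realMem 1 v) (s.natMem 1) (4 ^ d)) ∧
      -- The second summand on the left is the error still available: in one stage it drops by `2 *
      -- 2 ^ t * 4 ^ (d - (t + 1))`, exactly what the new `4 ^ (d - (t + 1))` runs cost.
      (∀ z, 2 * 2 ^ t * cnt (fun v => s.realMem 1 v < z) (s'.natMem 1) (4 ^ (d - t) * 2 ^ t) +
        4 ^ (d - t) * 2 ^ t ≤
        2 * cnt (fun v => s.realMem 1 v < z) (s.natMem 1) (4 ^ d) + 4 ^ d) ∧
      Frame 11 s s') (fun t => 600 * (4 ^ (d - t) * 2 ^ t))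
      (fun t => 290 * (4 ^ (d - t) * 2 ^ t)) ?_ ?_ ?_ ?_ ?_ (by simp) ?_
    · refine ⟨by simp [h11], by simp, ?_, by simp, by simp, rfl, rfl, fun i hi => ?_,
        fun b hb hb' => rfl⟩
      · intro u hu; exact sortedSeg_one _ _ _
      · simp [Function.update_of_ne (show i ≠ 12 by omega)]
    · rintro t ht s' ⟨h1, h2, h3, h4, h5, h6⟩
      have e1 : 4 ^ (d - t) * 2 ^ t = 4 * 4 ^ (d - (t + 1)) * 2 ^ t := by
        rw [show d - t = d - (t + 1) + 1 by omega, pow_succ]; ring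
      have e2 : 4 ^ (d - (t + 1)) * (2 * 2 ^ t) = 4 ^ (d - (t + 1)) * 2 ^ (t + 1) := by
        rw [pow_succ]; ring
      have e3 : 4 ^ (d - t) = 4 * 4 ^ (d - (t + 1)) := by
        rw [show d - t = d - (t + 1) + 1 by omega, pow_succ]; ring
      refine ⟨?_, ?_⟩
      · simp only [Test.holds, NatExpr.eval, h1, h2]
        have : 0 < 2 ^ t := by positivity
        have h4 : 4 ≤ 4 ^ (d - t) := by rw [e3]; have : 0 < 4 ^ (d - (t + 1)) := by positivity
                                        omega
        nlinarith
      rw [e1] at h1 h4 h5 ⊢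
      rw [e3, ← h6.realMem] at h3
      refine (medianStage_halts h1 h2 (by positivity) (by positivity) h3).mono le_rfl ?_
      rintro s'' ⟨g1, g2, g3, g4, g5, g6⟩
      simp only [h6.realMem] at g3 g4 g5
      rw [e2] at g1 g4 g5
      rw [← pow_succ'] at g2 g3
      refine ⟨g1, g2, g3, fun z => ?_, fun z => ?_, h6.trans g6⟩
      · have := Nat.mul_le_mul_left (2 ^ t) (g4 z)
        refine le_trans (le_of_eq ?_) (this.trans (h4 z))
        rw [pow_succ]; ring
      · have := Nat.mul_le_mul_left (2 * 2 ^ t) (g5 z)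
        have h5 := h5 z
        rw [pow_succ] at *
        nlinarith
    · rintro s' ⟨h1, h2, h3, h4, h5, h6⟩
      simp [Test.holds, NatExpr.eval, h1, h2]
    -- The length of the array halves, so a potential of 600 per entry pays for a stage (290 per
    -- entry), for the test and for the rest of the loop (300 per entry).
    · intro t ht
      have e3 : 4 ^ (d - t) = 4 * 4 ^ (d - (t + 1)) := by
        rw [show d - t = d - (t + 1) + 1 by omega, pow_succ]; ring
      rw [e3, pow_succ]
      simp only [Test.cost, NatExpr.cost]
      have h1 : 0 < 4 ^ (d - (t + 1)) * 2 ^ t := by positivity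
      nlinarith
    · simp only [Test.cost, NatExpr.cost, Nat.sub_self]
      omega
    · rintro s' ⟨h1, h2, h3, h4, h5, h6⟩
      simp only [Nat.sub_self, pow_zero, one_mul, Nat.lt_one_iff, forall_eq, zero_mul] at h3 h4 h5
      exact ⟨h2, h3, h4, h5, h6⟩
  · rintro s' ⟨h1, h2, h3, h4, h5⟩
    refine Halts.setNat_seq (c₂ := 80 * 4 ^ d) ?_ (by simp [NatExpr.cost]; omega)
    simp only [NatExpr.eval]
    -- The loop counts up to the first `x` with `4 * x ≥ 3 * 2 ^ d`, a way to take three quarters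
    -- without division. It is exact since `d ≥ 2`.
    refine Halts.loop_const (3 * 2 ^ (d - 2)) (fun x s'' => s''.nat 14 = x ∧ s''.nat 12 = 2 ^ d ∧
      s''.natMem 1 = s'.natMem 1 ∧ Frame 11 s s'') 4 ⟨by simp, by simpa using h1, rfl, ?_⟩
      ?_ ?_ ?_ ?_
    · refine h5.trans ⟨rfl, rfl, fun i hi => ?_, fun b hb hb' => rfl⟩
      simp [Function.update_of_ne (show i ≠ 14 by omega)]
    · rintro x hx s'' ⟨g1, g2, g3, g4⟩
      refine ⟨by simp only [Test.holds, NatExpr.eval, g1, g2]; omega, ?_⟩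
      refine Halts.setNat (by simp [NatExpr.cost]) ⟨by simp [NatExpr.eval, g1], by simpa using g2,
        g3, g4.trans ⟨rfl, rfl, fun i hi => ?_, fun b hb hb' => rfl⟩⟩
      simp [Function.update_of_ne (show i ≠ 14 by omega)]
    · rintro s'' ⟨g1, g2, g3, g4⟩
      simp only [Test.holds, NatExpr.eval, g1, g2]; omega
    · simp only [Test.cost, NatExpr.cost]; omega
    · rintro s'' ⟨g1, g2, g3, g4⟩
      refine ⟨?_, g4⟩
      have hc : ∀ (X : ℕ → Prop), cnt X (s.natMem 1) (4 ^ d) =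
          ((Finset.range (4 ^ d)).filter X).card := by
        intro X
        rw [cnt, Finset.card_filter]
        exact Finset.sum_congr rfl fun i hi => by rw [hp i (Finset.mem_range.1 hi)]
      rw [g1, g3]
      -- If the chosen key were below `z`, more than `3 * 2 ^ (d - 2)` sampled keys would be,
      -- whereas a quarter plus the error of one half leaves fewer than three quarters. If it were
      -- above `z`, so would be the last `2 ^ (d - 2)` sampled keys, a full quarter.
      refine ⟨fun z hz => ?_, fun z hz => ?_⟩
      · by_contra! hcon
        have a1 := h2.lt_cnt_low (by omega) hcon
        have a2 := h4 z
        rw [hc] at a2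
        have a2' := Nat.mul_le_mul_left (2 * 2 ^ d) (Nat.succ_le_of_lt a1)
        have a4 : 4 * (2 ^ d * 2 ^ (d - 2)) = 4 ^ d := by rw [hd3]; nlinarith
        have a5 : 4 * ((Finset.range (4 ^ d)).filter fun l => s.realMem 1 l < z).card < 4 ^ d := by
          convert hz using 2
        have a6 : 2 * 2 ^ d * (3 * 2 ^ (d - 2)).succ = 6 * (2 ^ d * 2 ^ (d - 2)) + 2 * 2 ^ d := by
          rw [Nat.succ_eq_add_one]; ring
        omega
      · by_contra! hcon
        have a1 := h2.le_cnt_high hcon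
        have a2 := h3 z
        rw [hc] at a2
        have a2' := Nat.mul_le_mul_left (2 ^ d) a1
        have a4 : 4 * (2 ^ d * 2 ^ (d - 2)) = 4 ^ d := by rw [hd3]; nlinarith
        have a5 : 4 * ((Finset.range (4 ^ d)).filter fun l => z < s.realMem 1 l).card < 4 ^ d := by
          convert hz using 2
        rw [show 2 ^ d - 3 * 2 ^ (d - 2) = 2 ^ (d - 2) by omega] at a2'
        omega


/-! ### Estimating the norms of the blocks -/

/-- The energy of the sketch entries that belong to the group `l` of `m` entries of a column. -/
noncomputable def groupEnergy (D : ColumnData) (y : ℕ → ℝ) (m col l : ℕ) : ℝ :=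
  ∑ t ∈ Finset.range m, y (D.row col (l * m + t)) ^ 2

theorem groupEnergy_nonneg (D : ColumnData) (y : ℕ → ℝ) (m col l : ℕ) :
    0 ≤ groupEnergy D y m col l := Finset.sum_nonneg fun _ _ => sq_nonneg _

/-- Append the energy of the next group of entries of the column in register 8 to the array 1. -/
def readGroup : Cmd :=
  .setReal 1 (.ofNat (.lit 0)) ;;
  .setNat 10 (.lit 0) ;;
  .loop (.natLt (.reg 10) (.reg 6))
    (.setReal 1 (.add (.reg 1) (.mul (.mem 0 (.row (.reg 8) (.reg 9)))
        (.mem 0 (.row (.reg 8) (.reg 9))))) ;;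
      .setNat 10 (.add (.reg 10) (.lit 1)) ;; .setNat 9 (.add (.reg 9) (.lit 1))) ;;
  .putReal 1 (.reg 11) (.reg 1) ;;
  .putNat 1 (.reg 11) (.reg 11) ;;
  .setNat 11 (.add (.reg 11) (.lit 1))

/-- `s'` agrees with `s` in the natural registers below `9` and in the real arrays except `1`. -/
structure ReadFrame (s s' : State) : Prop where
  realMem : ∀ a, a ≠ 1 → s'.realMem a = s.realMem a
  nat : ∀ i < 9, s'.nat i = s.nat i

theorem ReadFrame.trans {s s' s'' : State} (h : ReadFrame s s') (h' : ReadFrame s' s'') :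
    ReadFrame s s'' :=
  ⟨fun a ha => (h'.realMem a ha).trans (h.realMem a ha),
    fun i hi => (h'.nat i hi).trans (h.nat i hi)⟩

theorem readGroup_halts {F : List Cmd} {D : ColumnData} {s : State} {m col l : ℕ}
    (h6 : s.nat 6 = m) (h8 : s.nat 8 = col) (h9 : s.nat 9 = l * m) (h11 : s.nat 11 = l) :
    Halts F D readGroup s (23 * m + 18) fun s' =>
      s'.nat 9 = (l + 1) * m ∧ s'.nat 11 = l + 1 ∧
      s'.realMem 1 l = groupEnergy D (s.realMem 0) m col l ∧ s'.natMem 1 l = l ∧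
      (∀ i < l, s'.realMem 1 i = s.realMem 1 i) ∧ (∀ i < l, s'.natMem 1 i = s.natMem 1 i) ∧
      ReadFrame s s' := by
  unfold readGroup
  refine Halts.setReal_seq (c₂ := 23 * m + 15) ?_ (by simp [NatExpr.cost, RealExpr.cost]; omega)
  refine Halts.setNat_seq (c₂ := 23 * m + 13) ?_ (by simp [NatExpr.cost]; omega)
  simp only [NatExpr.eval, RealExpr.eval]
  refine Halts.seq (c₁ := 23 * m + 3) (c₂ := 10) (R := fun s' => s'.nat 9 = (l + 1) * m ∧
      s'.nat 11 = l ∧ s'.real 1 = groupEnergy D (s.realMem 0) m col l ∧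
      s'.realMem = s.realMem ∧ s'.natMem = s.natMem ∧ ∀ i < 9, s'.nat i = s.nat i) ?_ ?_ (by omega)
  · refine Halts.loop_const m (fun x s' => s'.nat 10 = x ∧ s'.nat 9 = l * m + x ∧
      s'.nat 11 = l ∧ s'.real 1 = ∑ t ∈ Finset.range x,
        s.realMem 0 (D.row col (l * m + t)) ^ 2 ∧
      s'.realMem = s.realMem ∧ s'.natMem = s.natMem ∧ ∀ i < 9, s'.nat i = s.nat i) 20
      ⟨by simp, by simp [h9], by simp [h11], by simp, rfl, rfl, fun i hi => ?_⟩ ?_ ?_ ?_ ?_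
    · simp [Function.update_of_ne (show i ≠ 10 by omega)]
    · rintro x hx s' ⟨h1, h2, h3, h4, h5, h7, h10⟩
      refine ⟨?_, ?_⟩
      · simp only [Test.holds, NatExpr.eval, h1, h10 6 (by omega), h6]; omega
      refine Halts.setReal_seq (c₂ := 8) (Halts.setNat_seq (c₂ := 4)
        (Halts.setNat (by simp [NatExpr.cost]) ?_) (by simp [NatExpr.cost]))
        (by simp [NatExpr.cost, RealExpr.cost])
      refine ⟨by simp [NatExpr.eval, h1], by simp [NatExpr.eval, h2]; omega, by simp [h3], ?_, h5, h7,
        fun i hi => ?_⟩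
      · simp [NatExpr.eval, RealExpr.eval, h2, h4, h5, h10 8 (by omega), h8,
          Finset.sum_range_succ, sq]
      · simp [Function.update_of_ne (show i ≠ 10 by omega),
          Function.update_of_ne (show i ≠ 9 by omega), h10 i hi]
    · rintro s' ⟨h1, h2, h3, h4, h5, h7, h10⟩
      simp [Test.holds, NatExpr.eval, h1, h10 6 (by omega), h6]
    · simp only [Test.cost, NatExpr.cost]; omega
    · rintro s' ⟨h1, h2, h3, h4, h5, h7, h10⟩
      exact ⟨by rw [h2]; ring, h3, h4, h5, h7, h10⟩
  · rintro s' ⟨h1, h2, h3, h4, h5, h7⟩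
    refine Halts.putReal_seq (c₂ := 7) (Halts.putNat_seq (c₂ := 4)
        (Halts.setNat (by simp [NatExpr.cost]) ?_) (by simp [NatExpr.cost]))
        (by simp [NatExpr.cost, RealExpr.cost])
    refine ⟨by simp [h1], by simp [NatExpr.eval, h2], by simp [NatExpr.eval, RealExpr.eval, h2, h3],
      by simp [NatExpr.eval, h2], fun i hi => ?_, fun i hi => ?_, fun a ha => ?_, fun i hi => ?_⟩
    · simp [NatExpr.eval, h2, h4, Function.update_of_ne (show i ≠ l by omega)]
    · simp [NatExpr.eval, h2, h5, Function.update_of_ne (show i ≠ l by omega)]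
    · simp [h4, Function.update_of_ne ha]
    · simp [Function.update_of_ne (show i ≠ 11 by omega), h7 i hi]

/-- Store an estimate for the block in register 7 with the first column in register 8. -/
def estimateBlock : Cmd :=
  .setNat 9 (.lit 0) ;;
  .setNat 11 (.lit 0) ;;
  .loop (.natLt (.reg 9) (.nnz (.reg 8))) readGroup ;;
  approxMedian ;;
  .putReal 2 (.reg 7) (.mem 1 (.mem 1 (.reg 14))) ;;
  .setNat 7 (.add (.reg 7) (.lit 1)) ;;
  .setNat 8 (.add (.reg 8) (.reg 1))

/-- The cost is linear in the number of nonzero entries of the one column read: the median costs a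
constant per group, and a group has `m ≥ 1` entries. -/
theorem estimateBlock_halts {F : List Cmd} {D : ColumnData} {s : State} {m col q d : ℕ}
    (hd : 2 ≤ d) (hm : 0 < m) (h6 : s.nat 6 = m) (h7 : s.nat 7 = q) (h8 : s.nat 8 = col)
    (hnnz : D.nnz col = 4 ^ d * m) :
    Halts F D estimateBlock s (780 * (4 ^ d * m)) fun s' =>
      s'.nat 7 = q + 1 ∧ s'.nat 8 = col + s.nat 1 ∧ s'.realMem 0 = s.realMem 0 ∧
      (∀ i < q, s'.realMem 2 i = s.realMem 2 i) ∧
      IsCentral (groupEnergy D (s.realMem 0) m col) (4 ^ d) (s'.realMem 2 q) ∧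
      ∀ i < 7, s'.nat i = s.nat i := by
  have hR : 4 ^ d ≤ 4 ^ d * m := Nat.le_mul_of_pos_right _ hm
  have h16 : 16 ≤ 4 ^ d := by
    calc 16 = 4 ^ 2 := by norm_num
      _ ≤ 4 ^ d := Nat.pow_le_pow_right (by norm_num) hd
  unfold estimateBlock
  refine Halts.setNat_seq (c₂ := 780 * (4 ^ d * m) - 2) ?_ (by simp [NatExpr.cost]; omega)
  refine Halts.setNat_seq (c₂ := 780 * (4 ^ d * m) - 4) ?_ (by simp [NatExpr.cost]; omega)
  simp only [NatExpr.eval]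
  refine Halts.seq (c₁ := 45 * (4 ^ d * m) + 4) (c₂ := 700 * 4 ^ d + 13) (R := fun s' =>
      s'.nat 11 = 4 ^ d ∧
      (∀ i < 4 ^ d, s'.realMem 1 i = groupEnergy D (s.realMem 0) m col i) ∧
      (∀ i < 4 ^ d, s'.natMem 1 i = i) ∧ ReadFrame s s') ?_ ?_ (by omega)
  · refine Halts.loop_const (4 ^ d) (fun x s' => s'.nat 9 = x * m ∧ s'.nat 11 = x ∧
      (∀ i < x, s'.realMem 1 i = groupEnergy D (s.realMem 0) m col i) ∧
      (∀ i < x, s'.natMem 1 i = i) ∧ ReadFrame s s') (23 * m + 18)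
      ⟨by simp, by simp, by simp, by simp, fun a ha => rfl, fun i hi => ?_⟩ ?_ ?_ ?_ (fun s' h => h.2)
    · simp [Function.update_of_ne (show i ≠ 9 by omega),
        Function.update_of_ne (show i ≠ 11 by omega)]
    · rintro x hx s' ⟨h1, h2, h3, h4, h5⟩
      have g8 := (h5.nat 8 (by omega)).trans h8
      refine ⟨?_, ?_⟩
      · simp only [Test.holds, NatExpr.eval, h1, g8, hnnz]
        exact Nat.mul_lt_mul_of_pos_right hx hm
      refine (readGroup_halts ((h5.nat 6 (by omega)).trans h6) g8 h1 h2).mono le_rfl ?_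
      rintro s'' ⟨g1, g2, g3, g4, g5, g6, g7⟩
      rw [h5.realMem 0 (by norm_num)] at g3
      refine ⟨g1, g2, fun i hi => ?_, fun i hi => ?_, h5.trans g7⟩
      · rcases Nat.lt_or_ge i x with hix | hix
        · rw [g5 i hix, h3 i hix]
        · obtain rfl : i = x := by omega
          exact g3
      · rcases Nat.lt_or_ge i x with hix | hix
        · rw [g6 i hix, h4 i hix]
        · obtain rfl : i = x := by omega
          exact g4
    · rintro s' ⟨h1, h2, h3, h4, h5⟩
      simp [Test.holds, NatExpr.eval, h1, (h5.nat 8 (by omega)).trans h8, hnnz]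
    · simp only [Test.cost, NatExpr.cost]
      nlinarith
  · rintro s' ⟨h1, h2, h3, h4⟩
    refine Halts.seq (approxMedian_halts hd h1 h3) (c₂ := 13) ?_ (by omega)
    rintro s'' ⟨g1, g2⟩
    refine Halts.putReal_seq (c₂ := 8) (Halts.setNat_seq (c₂ := 4)
        (Halts.setNat (by simp [NatExpr.cost]) ?_) (by simp [NatExpr.cost]))
        (by simp [NatExpr.cost, RealExpr.cost])
    simp only [NatExpr.eval, RealExpr.eval]
    have k : ∀ i < 9, s''.nat i = s.nat i := fun i hi =>
      (g2.nat i (by omega)).trans (h4.nat i hi)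
    refine ⟨by simp [k 7 (by omega), h7], by simp [k 8 (by omega), k 1 (by omega), h8], ?_,
      fun i hi => ?_, ?_, fun i hi => ?_⟩
    · simp [g2.realMem, h4.realMem 0 (by norm_num)]
    · simp [k 7 (by omega), h7, Function.update_of_ne (show i ≠ q by omega), g2.realMem,
        h4.realMem 2 (by norm_num)]
    · simp only [k 7 (by omega), h7, Function.update_self, g2.realMem]
      exact g1.congr fun l hl => (h2 l hl).symm
    · simp [Function.update_of_ne (show i ≠ 7 by omega),
        Function.update_of_ne (show i ≠ 8 by omega), k i (by omega)]

/-! ### Selecting the blocks with the largest estimates -/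

/-- Fill the array 1 with `0, …, N - 1` and set its keys to the estimates. -/
def fillKeys : Cmd :=
  .setNat 10 (.lit 0) ;;
  .loop (.natLt (.reg 10) (.reg 11))
    (.ite (.natLt (.reg 10) (.reg 4)) (.putReal 1 (.reg 10) (.mem 2 (.reg 10)))
        (.putReal 1 (.reg 10) (.sub (.ofNat (.lit 0)) (.ofNat (.lit 1)))) ;;
      .putNat 1 (.reg 10) (.reg 10) ;; .setNat 10 (.add (.reg 10) (.lit 1)))

/-- The array is padded to length `N` for the merge sort. The padding key `-1` is below every
estimate, as estimates are nonnegative, so padding never reaches the top `K ≤ B` positions. -/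
theorem fillKeys_halts {F : List Cmd} {D : ColumnData} {s : State} {N B : ℕ}
    (h4 : s.nat 4 = B) (h11 : s.nat 11 = N) :
    Halts F D fillKeys s (21 * N + 5) fun s' =>
      (∀ i < N, s'.realMem 1 i = if i < B then s.realMem 2 i else -1) ∧
      (∀ i < N, s'.natMem 1 i = i) ∧ s'.nat 11 = N ∧ ∀ i < 9, s'.nat i = s.nat i := by
  unfold fillKeys
  refine Halts.setNat_seq (c₂ := 21 * N + 3) ?_ (by simp [NatExpr.cost]; omega)
  simp only [NatExpr.eval]
  refine Halts.loop_const N (fun x s' => s'.nat 10 = x ∧ s'.realMem 2 = s.realMem 2 ∧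
    (∀ i < x, s'.realMem 1 i = if i < B then s.realMem 2 i else -1) ∧
      (∀ i < x, s'.natMem 1 i = i) ∧ s'.nat 11 = N ∧ ∀ i < 9, s'.nat i = s.nat i) 18
    ⟨by simp, rfl, by simp, by simp, by simp [h11], fun i hi => ?_⟩ ?_ ?_ ?_
    (fun s' h => h.2.2)
  · simp [Function.update_of_ne (show i ≠ 10 by omega)]
  · rintro x hx s' ⟨h1, h2, h3, h5, h6, h7⟩
    refine ⟨by simp [Test.holds, NatExpr.eval, h1, h6, hx], ?_⟩
    refine Halts.seq (c₁ := 11) (c₂ := 7) (R := fun s' => s'.nat 10 = x ∧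
      s'.realMem 2 = s.realMem 2 ∧
      (∀ i < x + 1, s'.realMem 1 i = if i < B then s.realMem 2 i else -1) ∧
      (∀ i < x, s'.natMem 1 i = i) ∧ s'.nat 11 = N ∧ ∀ i < 9, s'.nat i = s.nat i)
      (Halts.ite (c₁ := 7) (fun ht => ?_) (fun ht => ?_)
        (by simp [Test.cost, NatExpr.cost])) ?_ le_rfl
    · simp only [Test.holds, NatExpr.eval, h1, h7 4 (by omega), h4] at ht
      refine Halts.putReal (by simp [NatExpr.cost, RealExpr.cost])
        ⟨h1, by simp [h2], fun i hi => ?_, h5, h6, h7⟩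
      simp only [NatExpr.eval, RealExpr.eval, h1, h2, Function.update_self]
      rcases eq_or_ne i x with rfl | hix
      · simp [ht]
      · rw [Function.update_of_ne hix]; exact h3 i (by omega)
    · simp only [Test.holds, NatExpr.eval, h1, h7 4 (by omega), h4] at ht
      refine Halts.putReal (by simp [NatExpr.cost, RealExpr.cost])
        ⟨h1, by simp [h2], fun i hi => ?_, h5, h6, h7⟩
      simp only [NatExpr.eval, RealExpr.eval, h1, Function.update_self]
      rcases eq_or_ne i x with rfl | hix
      · simp [ht]
      · rw [Function.update_of_ne hix]; exact h3 i (by omega)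
    · rintro s' ⟨h1, h2, h3, h5, h6, h7⟩
      refine Halts.putNat_seq (c₂ := 4) (Halts.setNat (by simp [NatExpr.cost]) ?_)
        (by simp [NatExpr.cost])
      refine ⟨by simp [NatExpr.eval, h1], h2, h3, fun i hi => ?_, by simp [h6], fun i hi => ?_⟩
      · simp only [NatExpr.eval, h1, Function.update_self]
        rcases eq_or_ne i x with rfl | hix
        · simp
        · rw [Function.update_of_ne hix]; exact h5 i (by omega)
      · simp [Function.update_of_ne (show i ≠ 10 by omega), h7 i hi]
  · rintro s' ⟨h1, h2, h3, h5, h6, h7⟩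
    simp [Test.holds, NatExpr.eval, h1, h6]
  · simp only [Test.cost, NatExpr.cost]; omega

/-- Sort the array 1, whose length is a power of two. -/
def sortKeys : Cmd :=
  .setNat 12 (.lit 1) ;;
  .loop (.natLt (.reg 12) (.reg 11)) (mergePass ;; .setNat 12 (.add (.reg 12) (.reg 12)))

theorem sortKeys_halts {F : List Cmd} {D : ColumnData} {s : State} {d : ℕ}
    (h11 : s.nat 11 = 2 ^ d) :
    Halts F D sortKeys s (120 * (d * 2 ^ d) + 5) fun s' =>
      SortedSeg (s.realMem 1) (s'.natMem 1) 0 (2 ^ d) ∧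
      seg (s'.natMem 1) 0 (2 ^ d) = seg (s.natMem 1) 0 (2 ^ d) ∧ Frame 12 s s' := by
  unfold sortKeys
  refine Halts.setNat_seq (c₂ := 120 * (d * 2 ^ d) + 3) ?_ (by simp [NatExpr.cost]; omega)
  simp only [NatExpr.eval]
  refine Halts.loop_const d (fun t s' => s'.nat 12 = 2 ^ t ∧
      (∀ u < 2 ^ (d - t), SortedSeg (s.realMem 1) (s'.natMem 1) (u * 2 ^ t) (2 ^ t)) ∧
      seg (s'.natMem 1) 0 (2 ^ d) = seg (s.natMem 1) 0 (2 ^ d) ∧ Frame 12 s s')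
      (100 * 2 ^ d + 14) ⟨by simp, ?_, rfl, rfl, rfl, fun i hi => ?_, fun b hb hb' => rfl⟩
      ?_ ?_ ?_ ?_
  · intro u hu; exact sortedSeg_one _ _ _
  · simp [Function.update_of_ne (show i ≠ 12 by omega)]
  · rintro t ht s' ⟨h1, h2, h3, h4⟩
    have e1 : 2 ^ (d - (t + 1)) * (2 * 2 ^ t) = 2 ^ d := by
      rw [← pow_succ', ← pow_add]; congr 1; omega
    have e2 : 2 ^ (d - t) = 2 * 2 ^ (d - (t + 1)) := by
      rw [← pow_succ']; congr 1; omega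
    refine ⟨?_, ?_⟩
    · simp only [Test.holds, NatExpr.eval, h1, h4.nat 11 (by omega), h11]
      exact Nat.pow_lt_pow_right (by norm_num) ht
    refine Halts.seq (mergePass_halts (g := 2 ^ (d - (t + 1))) (w := 2 ^ t)
      (by rw [h4.nat 11 (by omega), h11, e1]) h1 (by positivity) ?_) (c₂ := 4) ?_
      (by rw [e1])
    · rw [← e2, h4.realMem]; exact h2
    · rintro s'' ⟨g1, g2, g3⟩
      rw [e1] at g2
      rw [h4.realMem] at g1
      refine Halts.setNat (by simp [NatExpr.cost]) ⟨?_, ?_, g2.trans h3, ?_⟩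
      · simp [NatExpr.eval, g3.nat 12 (by omega), h1, pow_succ]; omega
      · rw [pow_succ']; exact g1
      · refine h4.trans ((g3.mono (by norm_num)).trans ⟨rfl, rfl, fun i hi => ?_,
          fun b hb hb' => rfl⟩)
        simp [Function.update_of_ne (show i ≠ 12 by omega)]
  · rintro s' ⟨h1, h2, h3, h4⟩
    simp [Test.holds, NatExpr.eval, h1, h4.nat 11 (by omega), h11]
  · simp only [Test.cost, NatExpr.cost]
    have : d ≤ d * 2 ^ d := Nat.le_mul_of_pos_right _ (by positivity)
    nlinarith
  · rintro s' ⟨h1, h2, h3, h4⟩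
    refine ⟨?_, h3, h4⟩
    have := h2 0 (by simp)
    rwa [zero_mul] at this

/-- `U` consists of `K` of the indices `0, …, B - 1`, with the largest values of `e`. -/
structure IsTop (e : ℕ → ℝ) (B K : ℕ) (U : Finset ℕ) : Prop where
  subset : U ⊆ Finset.range B
  card : U.card = K
  le : ∀ i < B, i ∉ U → ∀ j ∈ U, e i ≤ e j

/-- Equality of multisets makes `p` a permutation of the indices below `N`, so reading the sorted
array from its end yields distinct indices with the largest keys. -/
theorem isTop_of_sorted {e key : ℕ → ℝ} {p out : ℕ → ℕ} {B K N : ℕ} (hKB : K ≤ B) (hBN : B ≤ N)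
    (he : ∀ i < B, 0 ≤ e i) (hkey : ∀ i < N, key i = if i < B then e i else -1)
    (hp : SortedSeg key p 0 N) (hseg : seg p 0 N = Multiset.range N)
    (hout : ∀ t < K, out t = p (N - (t + 1))) :
    IsTop e B K ((Finset.range K).image out) := by
  have hmap : (Multiset.range N).map p = Multiset.range N := by
    simpa [seg] using hseg
  have hinj : ∀ i < N, ∀ j < N, p i = p j → i = j := by
    have hnd : ((Multiset.range N).map p).Nodup := by rw [hmap]; exact Multiset.nodup_range N
    intro i hi j hj hij
    exact Multiset.inj_on_of_nodup_map hnd i (Multiset.mem_range.2 hi) j (Multiset.mem_range.2 hj) hij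
  have hlt : ∀ i < N, p i < N := by
    intro i hi
    have : p i ∈ (Multiset.range N).map p := Multiset.mem_map_of_mem _ (Multiset.mem_range.2 hi)
    rwa [hmap, Multiset.mem_range] at this
  have hsurj : ∀ v < N, ∃ i < N, p i = v := by
    intro v hv
    have : v ∈ (Multiset.range N).map p := by rw [hmap]; exact Multiset.mem_range.2 hv
    obtain ⟨i, hi, rfl⟩ := Multiset.mem_map.1 this
    exact ⟨i, Multiset.mem_range.1 hi, rfl⟩
  have hmono : ∀ i j, i ≤ j → j < N → key (p i) ≤ key (p j) := by
    intro i j hij hj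
    simpa using hp i j hij hj
  -- If padding stood at this position, sortedness would force padding at all the `N - t` positions
  -- up to it, but there are only `N - B < N - t` padding indices.
  have hB : ∀ t < B, p (N - (t + 1)) < B := by
    intro t ht
    by_contra! hcon
    have hsub : (Finset.range (N - t)).image p ⊆ Finset.Ico B N := by
      intro v hv
      obtain ⟨i, hi, rfl⟩ := Finset.mem_image.1 hv
      rw [Finset.mem_range] at hi
      rw [Finset.mem_Ico]
      refine ⟨?_, hlt i (by omega)⟩
      by_contra! hi'
      have h1 := hmono i (N - (t + 1)) (by omega) (by omega)
      rw [hkey _ (hlt i (by omega)), hkey _ (hlt _ (by omega)), if_pos hi', if_neg (by omega)] at h1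
      linarith [he _ hi']
    have hcard := Finset.card_le_card hsub
    rw [Finset.card_image_of_injOn, Finset.card_range, Nat.card_Ico] at hcard
    · omega
    · intro i hi j hj hij
      simp only [Finset.coe_range, Set.mem_Iio] at hi hj
      exact hinj i (by omega) j (by omega) hij
  refine ⟨?_, ?_, ?_⟩
  · intro v hv
    obtain ⟨t, ht, rfl⟩ := Finset.mem_image.1 hv
    rw [Finset.mem_range] at ht ⊢
    rw [hout t ht]
    exact hB t (by omega)
  · rw [Finset.card_image_of_injOn, Finset.card_range]
    intro i hi j hj hij
    simp only [Finset.coe_range, Set.mem_Iio] at hi hj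
    rw [hout i hi, hout j hj] at hij
    have := hinj _ (by omega) _ (by omega) hij
    omega
  · intro v hv hvU j hj
    obtain ⟨t, ht, rfl⟩ := Finset.mem_image.1 hj
    rw [Finset.mem_range] at ht
    obtain ⟨i, hi, rfl⟩ := hsurj v (by omega)
    rw [hout t ht]
    have hi' : i ≤ N - (t + 1) := by
      by_contra! hcon
      refine hvU (Finset.mem_image.2 ⟨N - (i + 1), Finset.mem_range.2 (by omega), ?_⟩)
      rw [hout _ (by omega)]
      congr 1
      omega
    have h1 := hmono _ _ hi' (by omega)
    rwa [hkey _ (by omega), hkey _ (hlt _ (by omega)), if_pos hv, if_pos (hB t (by omega))] at h1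

/-- Output the `K` (register 5) of the `B` (register 4) blocks with the largest estimates. -/
def selectTop : Cmd :=
  .setNat 11 (.lit 1) ;;
  .loop (.natLt (.reg 11) (.reg 4)) (.setNat 11 (.add (.reg 11) (.reg 11))) ;;
  fillKeys ;;
  sortKeys ;;
  .setNat 10 (.lit 0) ;;
  .loop (.natLt (.reg 10) (.reg 5))
    (.putNat 0 (.reg 10) (.mem 1 (.sub (.reg 11) (.add (.reg 10) (.lit 1)))) ;;
      .setNat 10 (.add (.reg 10) (.lit 1))) ;;
  .setNat 0 (.reg 5)

theorem selectTop_halts {F : List Cmd} {D : ColumnData} {s : State} {B K : ℕ} (hB : 0 < B)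
    (h4 : s.nat 4 = B) (h5 : s.nat 5 = K) (hKB : K ≤ B) (he : ∀ i < B, 0 ≤ s.realMem 2 i) :
    Halts F D selectTop s (400 * (B * (Nat.clog 2 B + 1))) fun s' =>
      IsTop (s.realMem 2) B K s'.output := by
  set d := Nat.clog 2 B with hd
  have hBN : B ≤ 2 ^ d := Nat.le_pow_clog (by norm_num) B
  -- Padding to a power of two at most doubles the array, so sorting still costs order `B * log B`.
  have hN : 2 ^ d ≤ 2 * B := by
    rcases Nat.lt_or_ge 1 B with h1 | h1
    · have h2 := Nat.pow_pred_clog_lt_self (b := 2) (by norm_num) h1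
      have h3 : 0 < d := Nat.clog_pos (by norm_num) (by omega)
      rw [← hd] at h2
      obtain ⟨d', hd'⟩ := Nat.exists_eq_succ_of_ne_zero h3.ne'
      rw [hd'] at h2 ⊢
      simp only [Nat.pred_succ] at h2
      rw [pow_succ]; omega
    · obtain rfl : B = 1 := by omega
      simp [hd]
  have hlt : ∀ t < d, 2 ^ t < B := fun t ht => (Nat.lt_clog_iff_pow_lt (by norm_num)).1 ht
  have hc1 : d * 2 ^ d ≤ 2 * (B * d) := by nlinarith
  have hc2 : d ≤ B * d := Nat.le_mul_of_pos_left _ hB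
  rw [mul_add, mul_one]
  unfold selectTop
  refine Halts.setNat_seq (c₂ := 398 * (B * d + B)) ?_ (by simp [NatExpr.cost]; omega)
  simp only [NatExpr.eval]
  refine Halts.seq (c₁ := 7 * d + 3) (c₂ := 380 * (B * d + B)) (R := fun s' =>
    s'.nat 11 = 2 ^ d ∧ s'.realMem = s.realMem ∧ ∀ i < 9, s'.nat i = s.nat i) ?_ ?_ (by omega)
  · refine Halts.loop_const d (fun t s' => s'.nat 11 = 2 ^ t ∧ s'.realMem = s.realMem ∧
      ∀ i < 9, s'.nat i = s.nat i) 4 ⟨by simp, rfl, fun i hi => ?_⟩ ?_ ?_ ?_ (fun s' h => h)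
    · simp [Function.update_of_ne (show i ≠ 11 by omega)]
    · rintro t ht s' ⟨g1, g2, g3⟩
      refine ⟨?_, Halts.setNat (by simp [NatExpr.cost]) ⟨?_, g2, fun i hi => ?_⟩⟩
      · simp only [Test.holds, NatExpr.eval, g1, g3 4 (by omega), h4]; exact hlt t ht
      · simp [NatExpr.eval, g1, pow_succ]; omega
      · simp [Function.update_of_ne (show i ≠ 11 by omega), g3 i hi]
    · rintro s' ⟨g1, g2, g3⟩
      simp only [Test.holds, NatExpr.eval, g1, g3 4 (by omega), h4]; omega
    · simp only [Test.cost, NatExpr.cost]; omega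
  rintro s₁ ⟨g1, g2, g3⟩
  refine Halts.seq (fillKeys_halts ((g3 4 (by omega)).trans h4) g1) (c₂ := 320 * (B * d + B)) ?_
    (by omega)
  rintro s₂ ⟨k1, k2, k3, k4⟩
  refine Halts.seq (sortKeys_halts k3) (c₂ := 70 * (B * d + B)) ?_ (by omega)
  rintro s₃ ⟨l1, l2, l3⟩
  refine Halts.setNat_seq (c₂ := 60 * (B * d + B)) ?_ (by simp [NatExpr.cost]; omega)
  simp only [NatExpr.eval]
  refine Halts.seq (c₁ := 20 * K + 3) (c₂ := 2) (R := fun s' => s'.nat 5 = K ∧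
    ∀ t < K, s'.natMem 0 t = s₃.natMem 1 (2 ^ d - (t + 1))) ?_ ?_ (by omega)
  · refine Halts.loop_const K (fun x s' => s'.nat 10 = x ∧ s'.nat 5 = K ∧ s'.nat 11 = 2 ^ d ∧
      s'.natMem 1 = s₃.natMem 1 ∧ ∀ t < x, s'.natMem 0 t = s₃.natMem 1 (2 ^ d - (t + 1))) 12
      ⟨by simp, ?_, ?_, rfl, by simp⟩ ?_ ?_ ?_ (fun s' h => ⟨h.2.1, h.2.2.2.2⟩)
    · simp [l3.nat 5 (by omega), k4 5 (by omega), g3 5 (by omega), h5]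
    · simp [l3.nat 11 (by omega), k3]
    · rintro x hx s' ⟨a1, a2, a3, a4, a5⟩
      refine ⟨by simp [Test.holds, NatExpr.eval, a1, a2, hx], ?_⟩
      refine Halts.putNat_seq (c₂ := 4) (Halts.setNat (by simp [NatExpr.cost]) ?_)
        (by simp [NatExpr.cost])
      refine ⟨by simp [NatExpr.eval, a1], by simp [a2], by simp [a3], by simp [a4], ?_⟩
      intro t ht
      simp only [NatExpr.eval, a1, a3, a4, Function.update_self]
      rcases eq_or_ne t x with rfl | htx
      · simp
      · rw [Function.update_of_ne htx]; exact a5 t (by omega)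
    · rintro s' ⟨a1, a2, a3, a4, a5⟩
      simp [Test.holds, NatExpr.eval, a1, a2]
    · simp only [Test.cost, NatExpr.cost]; omega
  · rintro s' ⟨a1, a2⟩
    refine Halts.setNat (by simp [NatExpr.cost]) ?_
    simp only [State.output, NatExpr.eval, a1, Function.update_self]
    rw [g2] at k1
    refine isTop_of_sorted hKB hBN he k1 l1 ?_ a2
    rw [l2]
    simp only [seg, zero_add]
    refine (Multiset.map_congr rfl fun i hi => k2 i (Multiset.mem_range.1 hi)).trans ?_
    simp


/-! ### The program -/

/-- Count the blocks (register 4) and the blocks to be selected (register 5), and compute the number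
of entries in a group (register 6). -/
def prepare : Cmd :=
  .setNat 4 (.lit 0) ;;
  .setNat 8 (.lit 0) ;;
  .loop (.natLt (.reg 8) (.reg 0))
    (.setNat 4 (.add (.reg 4) (.lit 1)) ;; .setNat 8 (.add (.reg 8) (.reg 1))) ;;
  .setNat 5 (.lit 0) ;;
  .setNat 8 (.reg 1) ;;
  .loop (.and (.not (.natLt (.reg 2) (.reg 8))) (.natLt (.reg 5) (.reg 4)))
    (.setNat 5 (.add (.reg 5) (.lit 1)) ;; .setNat 8 (.add (.reg 8) (.reg 1))) ;;
  .setNat 6 (.lit 0) ;;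
  .loop (.realLt (.mul (.ofNat (.reg 6)) (.mul (.reg 0) (.reg 0))) (.ofNat (.lit (2 ^ 19))))
    (.setNat 6 (.add (.reg 6) (.lit 1)))

/-- The number of sketch entries in a group. -/
noncomputable def groupSize (ε : ℝ) : ℕ := ⌈2 ^ 19 / ε ^ 2⌉₊

/-- The machine cannot round a real number; `prepare` counts up instead until this multiplied-out
test fails, which happens exactly at the ceiling. -/
theorem lt_groupSize_iff {ε : ℝ} (hε : 0 < ε) (x : ℕ) :
    x < groupSize ε ↔ (x : ℝ) * (ε * ε) < ((2 ^ 19 : ℕ) : ℝ) := by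
  rw [groupSize, Nat.lt_ceil, lt_div_iff₀ (by positivity), sq]
  norm_num

/-- The quotients by `b` are computed by repeated addition. Capping `k / b` at the number of blocks
keeps the time independent of `k`, which may be much larger than `n`. -/
theorem prepare_halts {F : List Cmd} {D : ColumnData} {s : State} {B b k : ℕ} {ε : ℝ}
    (hε : 0 < ε) (hb : 0 < b) (h0 : s.nat 0 = B * b) (h1 : s.nat 1 = b) (h2 : s.nat 2 = k)
    (hr : s.real 0 = ε) :
    Halts F D prepare s (30 * B + 20 * groupSize ε + 40) fun s' =>
      s'.nat 1 = b ∧ s'.nat 4 = B ∧ s'.nat 5 = min (k / b) B ∧ s'.nat 6 = groupSize ε ∧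
      s'.realMem = s.realMem := by
  unfold prepare
  refine Halts.setNat_seq (c₂ := 30 * B + 20 * groupSize ε + 38) ?_ (by simp [NatExpr.cost]; omega)
  refine Halts.setNat_seq (c₂ := 30 * B + 20 * groupSize ε + 36) ?_ (by simp [NatExpr.cost]; omega)
  simp only [NatExpr.eval]
  refine Halts.seq (c₁ := 11 * B + 3) (c₂ := 19 * B + 20 * groupSize ε + 33) (R := fun s' =>
    s'.nat 4 = B ∧ s'.nat 1 = b ∧ s'.nat 2 = k ∧ s'.real 0 = ε ∧ s'.realMem = s.realMem)
    ?_ ?_ (by omega)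
  · refine Halts.loop_const B (fun x s' => s'.nat 8 = x * b ∧ s'.nat 4 = x ∧ s'.nat 0 = B * b ∧
      s'.nat 1 = b ∧ s'.nat 2 = k ∧ s'.real 0 = ε ∧ s'.realMem = s.realMem) 8
      ⟨by simp, by simp, by simp [h0], by simp [h1], by simp [h2], hr, rfl⟩ ?_ ?_ ?_
      (fun s' h => ⟨h.2.1, h.2.2.2⟩)
    · rintro x hx s' ⟨g1, g2, g3, g4, g5, g6, g7⟩
      refine ⟨?_, Halts.setNat_seq (c₂ := 4) (Halts.setNat (by simp [NatExpr.cost]) ?_)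
        (by simp [NatExpr.cost])⟩
      · simp only [Test.holds, NatExpr.eval, g1, g3]
        exact Nat.mul_lt_mul_of_pos_right hx hb
      · simp only [NatExpr.eval]
        exact ⟨by simp [g1, g4]; ring, by simp [g2], by simp [g3], by simp [g4], by simp [g5], g6, g7⟩
    · rintro s' ⟨g1, g2, g3, g4, g5, g6, g7⟩
      simp [Test.holds, NatExpr.eval, g1, g3]
    · simp only [Test.cost, NatExpr.cost]; omega
  rintro s₁ ⟨g1, g2, g3, g4, g5⟩
  refine Halts.setNat_seq (c₂ := 19 * B + 20 * groupSize ε + 31) ?_ (by simp [NatExpr.cost]; omega)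
  refine Halts.setNat_seq (c₂ := 19 * B + 20 * groupSize ε + 29) ?_ (by simp [NatExpr.cost]; omega)
  simp only [NatExpr.eval]
  refine Halts.seq (c₁ := 19 * B + 8) (c₂ := 20 * groupSize ε + 21) (R := fun s' =>
    s'.nat 5 = min (k / b) B ∧ s'.nat 4 = B ∧ s'.nat 1 = b ∧ s'.real 0 = ε ∧
    s'.realMem = s.realMem) ?_ ?_ (by omega)
  · refine Halts.loop_const (min (k / b) B) (fun x s' => s'.nat 8 = (x + 1) * b ∧ s'.nat 2 = k ∧
      s'.nat 5 = x ∧ s'.nat 4 = B ∧ s'.nat 1 = b ∧ s'.real 0 = ε ∧ s'.realMem = s.realMem) 8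
      ⟨by simp [g2], by simp [g3], by simp, by simp [g1], by simp [g2], g4, g5⟩ ?_ ?_ ?_
      (fun s' h => h.2.2)
    · rintro x hx s' ⟨k1, k2, k3, k4, k5, k6, k7⟩
      refine ⟨?_, Halts.setNat_seq (c₂ := 4) (Halts.setNat (by simp [NatExpr.cost]) ?_)
        (by simp [NatExpr.cost])⟩
      · simp only [Test.holds, NatExpr.eval, k1, k2, k3, k4, not_lt]
        rw [← Nat.le_div_iff_mul_le hb]
        omega
      · simp only [NatExpr.eval]
        exact ⟨by simp [k1, k5]; ring, by simp [k2], by simp [k3], by simp [k4], by simp [k5], k6, k7⟩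
    · rintro s' ⟨k1, k2, k3, k4, k5, k6, k7⟩
      simp only [Test.holds, NatExpr.eval, k1, k2, k3, k4, not_lt]
      rw [← Nat.le_div_iff_mul_le hb]
      omega
    · simp only [Test.cost, NatExpr.cost]; omega
  rintro s₂ ⟨k1, k2, k3, k4, k5⟩
  refine Halts.setNat_seq (c₂ := 20 * groupSize ε + 19) ?_ (by simp [NatExpr.cost]; omega)
  simp only [NatExpr.eval]
  refine Halts.loop_const (groupSize ε) (fun x s' => s'.nat 6 = x ∧ s'.nat 1 = b ∧ s'.nat 4 = B ∧
    s'.nat 5 = min (k / b) B ∧ s'.real 0 = ε ∧ s'.realMem = s.realMem) 4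
    ⟨by simp, by simp [k3], by simp [k2], by simp [k1], k4, k5⟩ ?_ ?_ ?_
    (fun s' h => ⟨h.2.1, h.2.2.1, h.2.2.2.1, h.1, h.2.2.2.2.2⟩)
  · rintro x hx s' ⟨l1, l2, l3, l4, l5, l6⟩
    refine ⟨?_, Halts.setNat (by simp [NatExpr.cost]) ?_⟩
    · simp only [Test.holds, NatExpr.eval, RealExpr.eval, l1, l5]
      exact (lt_groupSize_iff hε x).1 hx
    · simp only [NatExpr.eval]
      exact ⟨by simp [l1], by simp [l2], by simp [l3], by simp [l4], l5, l6⟩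
  · rintro s' ⟨l1, l2, l3, l4, l5, l6⟩
    simp only [Test.holds, NatExpr.eval, RealExpr.eval, l1, l5]
    rw [← lt_groupSize_iff hε]
    exact lt_irrefl _
  · simp only [Test.cost, NatExpr.cost, RealExpr.cost]; omega

/-- The recovery algorithm: estimate the energies of all blocks and select the largest ones. -/
def recovery : Program where
  main := .ite (.natLt (.reg 2) (.reg 1)) (.setNat 0 (.lit 0))
    (prepare ;;
      .setNat 7 (.lit 0) ;;
      .setNat 8 (.lit 0) ;;
      .loop (.natLt (.reg 7) (.reg 4)) estimateBlock ;;
      selectTop)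
  procs := []

/-- With `k < b` no block may be output, and for `k = 0` no row is available either; so the program
stops without looking at the sketch. -/
theorem recovery_outputs_empty {M n b k : ℕ} {ε : ℝ} (hkb : k < b)
    (A : Matrix (Fin M) (Fin n) ℝ) (y : Fin M → ℝ) : recovery.Outputs b k ε A y ∅ 5 := by
  refine ⟨_, .iteTrue ?_ (.setNat _ _ _), ?_⟩
  · simpa [Test.holds, NatExpr.eval, initState] using hkb
  · simp [State.output, NatExpr.eval]

/-- The deterministic half of the argument: of the matrix it needs only the number of nonzero
entries in the first column of each block, and `y` need not be a sketch of anything. -/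
theorem recovery_outputs {M B b k d : ℕ} {ε : ℝ} (hε : 0 < ε) (hb : 0 < b) (hB : 0 < B)
    (hd : 2 ≤ d) (hkb : b ≤ k) (A : Matrix (Fin M) (Fin (B * b)) ℝ) (y : Fin M → ℝ)
    (hnnz : ∀ q < B, (columnData A).nnz (q * b) = 4 ^ d * groupSize ε) :
    ∃ U τ e, recovery.Outputs b k ε A y U τ ∧
      τ ≤ 2000 * (B * (4 ^ d * groupSize ε + Nat.clog 2 B)) ∧ IsTop e B (min (k / b) B) U ∧
      ∀ q < B, IsCentral (groupEnergy (columnData A) (fun i => if h : i < M then y ⟨i, h⟩ else 0)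
        (groupSize ε) (q * b)) (4 ^ d) (e q) := by
  set D := columnData A
  set m := groupSize ε with hm
  set y' : ℕ → ℝ := fun i => if h : i < M then y ⟨i, h⟩ else 0 with hy'
  have hm0 : 0 < m := Nat.ceil_pos.2 (by positivity)
  have h4 : 0 < 4 ^ d := by positivity
  have hR1 : 1 ≤ 4 ^ d * m := Nat.mul_pos h4 hm0
  have hBR : B ≤ B * (4 ^ d * m) := Nat.le_mul_of_pos_right _ hR1
  have hmR : m ≤ B * (4 ^ d * m) := by
    rw [← mul_assoc]; exact Nat.le_mul_of_pos_left _ (Nat.mul_pos hB h4)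
  set R := 4 ^ d * m with hR
  set P := B * R with hP
  suffices H : Halts [] D recovery.main (initState (B * b) b k ε y)
      (2000 * (B * (R + Nat.clog 2 B))) fun s' => ∃ e, IsTop e B (min (k / b) B) s'.output ∧
        ∀ q < B, IsCentral (groupEnergy D y' m (q * b)) (4 ^ d) (e q) by
    obtain ⟨s', τ, h1, h2, e, h3, h4⟩ := H
    exact ⟨s'.output, τ, e, ⟨s', h1, rfl⟩, h2, h3, h4⟩
  have hc : B * (R + Nat.clog 2 B) = P + B * Nat.clog 2 B := mul_add _ _ _
  have hc' : B * (Nat.clog 2 B + 1) = B * Nat.clog 2 B + B := by ring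
  rw [hc]
  unfold recovery
  refine Halts.ite (c₁ := 1990 * (P + B * Nat.clog 2 B)) (fun ht => ?_) (fun _ => ?_)
    (by simp only [Test.cost, NatExpr.cost]; omega)
  · simp [Test.holds, NatExpr.eval, initState] at ht
    omega
  refine Halts.seq (prepare_halts (B := B) hε hb (by simp [initState]) (by simp [initState])
    (k := k) (by simp [initState]) (by simp [initState]))
    (c₂ := 1400 * (P + B * Nat.clog 2 B)) ?_ (by omega)
  rintro s₁ ⟨g1, g2, g3, g4, g5⟩
  have hs₁ : s₁.realMem 0 = y' := by rw [g5]; funext i; simp [initState, hy']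
  refine Halts.setNat_seq (c₂ := 1390 * (P + B * Nat.clog 2 B)) ?_ (by simp [NatExpr.cost]; omega)
  refine Halts.setNat_seq (c₂ := 1380 * (P + B * Nat.clog 2 B)) ?_ (by simp [NatExpr.cost]; omega)
  simp only [NatExpr.eval]
  refine Halts.seq (c₁ := 800 * P) (c₂ := 400 * (B * (Nat.clog 2 B + 1))) (R := fun s' =>
    s'.nat 4 = B ∧ s'.nat 5 = min (k / b) B ∧
    ∀ q < B, IsCentral (groupEnergy D y' m (q * b)) (4 ^ d) (s'.realMem 2 q)) ?_ ?_ (by omega)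
  · refine Halts.loop_const B (fun x s' => s'.nat 7 = x ∧ s'.nat 8 = x * b ∧ s'.nat 1 = b ∧
      s'.nat 6 = m ∧ s'.realMem 0 = y' ∧ s'.nat 4 = B ∧ s'.nat 5 = min (k / b) B ∧
      ∀ q < x, IsCentral (groupEnergy D y' m (q * b)) (4 ^ d) (s'.realMem 2 q)) (780 * R)
      ⟨by simp, by simp, by simp [g1], by simp [g4, hm], hs₁, by simp [g2], by simp [g3], by simp⟩
      ?_ ?_ ?_ (fun s' h => h.2.2.2.2.2)
    · rintro x hx s' ⟨a1, a2, a3, a4, a5, a6, a7, a8⟩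
      refine ⟨by simpa [Test.holds, NatExpr.eval, a1, a6] using hx, ?_⟩
      refine (estimateBlock_halts hd hm0 a4 a1 a2 (hnnz x hx)).mono le_rfl ?_
      rintro s'' ⟨b1, b2, b3, b4, b5, b6⟩
      rw [a5] at b3 b5
      refine ⟨b1, ?_, (b6 1 (by omega)).trans a3, (b6 6 (by omega)).trans a4, b3,
        (b6 4 (by omega)).trans a6, (b6 5 (by omega)).trans a7, fun q hq => ?_⟩
      · rw [b2, a3]; ring
      · rcases Nat.lt_or_ge q x with hqx | hqx
        · rw [b4 q hqx]; exact a8 q hqx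
        · obtain rfl : q = x := by omega
          exact b5
    · rintro s' ⟨a1, a2, a3, a4, a5, a6, a7, a8⟩
      simp [Test.holds, NatExpr.eval, a1, a6]
    · simp only [Test.cost, NatExpr.cost]
      have : B * (1 + 1 + 1 + 780 * R) = 3 * B + 780 * P := by rw [hP]; ring
      omega
  · rintro s₂ ⟨a1, a2, a3⟩
    refine (selectTop_halts hB a1 a2 (by omega) fun q hq => ?_).mono le_rfl
      fun s' hs' => ⟨_, hs', a3⟩
    -- No group energy is below `0`, hence neither is a central value. `selectTop` needs this
    -- because of the padding key `-1`.
    refine (a3 q hq).le 0 ?_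
    rw [Finset.filter_false_of_mem]
    · simp
    · intro l _
      exact not_lt.2 (groupEnergy_nonneg _ _ _ _ _)


/-! ### Moments of random signs -/

theorem sum_fin_succ_pi {α : Type*} [Fintype α] {n : ℕ} (f : (Fin (n + 1) → α) → ℝ) :
    ∑ σ, f σ = ∑ a, ∑ σ : Fin n → α, f (Fin.cons a σ) := by
  rw [← Fintype.sum_prod_type']
  exact (Fintype.sum_equiv (Fin.consEquiv fun _ => α) _ _ fun _ => rfl).symm

/-- The sign that belongs to a truth value. -/
def sgn (a : Bool) : ℝ := if a then 1 else -1

theorem sum_sign_sq {n : ℕ} (z : Fin n → ℝ) :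
    ∑ σ : Fin n → Bool, (∑ j, sgn (σ j) * z j) ^ 2 = 2 ^ n * ∑ j, z j ^ 2 := by
  induction n with
  | zero => simp
  | succ n ih =>
    rw [sum_fin_succ_pi]
    simp only [Fin.sum_univ_succ, Fin.cons_zero, Fin.cons_succ, Fintype.sum_bool]
    rw [← Finset.sum_add_distrib]
    have : ∀ S : ℝ, (sgn true * z 0 + S) ^ 2 + (sgn false * z 0 + S) ^ 2 =
        2 * z 0 ^ 2 + 2 * S ^ 2 := fun S => by simp only [sgn]; norm_num; ring
    simp only [this]
    rw [Finset.sum_add_distrib, ← Finset.mul_sum, ← Finset.mul_sum, ih]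
    simp
    ring

/-- Averaging over the first sign kills the odd powers and leaves `z 0 ^ 4 + 6 * z 0 ^ 2 * S ^ 2 + S
^ 4`. With the exact second moment of `S` and the induction hypothesis this is below three times the
square of the enlarged sum. -/
theorem sum_sign_pow_four {n : ℕ} (z : Fin n → ℝ) :
    ∑ σ : Fin n → Bool, (∑ j, sgn (σ j) * z j) ^ 4 ≤ 3 * 2 ^ n * (∑ j, z j ^ 2) ^ 2 := by
  induction n with
  | zero => simp
  | succ n ih =>
    rw [sum_fin_succ_pi]
    simp only [Fin.sum_univ_succ, Fin.cons_zero, Fin.cons_succ, Fintype.sum_bool]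
    rw [← Finset.sum_add_distrib]
    have : ∀ S : ℝ, (sgn true * z 0 + S) ^ 4 + (sgn false * z 0 + S) ^ 4 =
        2 * z 0 ^ 4 + 12 * z 0 ^ 2 * S ^ 2 + 2 * S ^ 4 := fun S => by
      simp only [sgn]; norm_num; ring
    simp only [this]
    rw [Finset.sum_add_distrib, Finset.sum_add_distrib, ← Finset.mul_sum, ← Finset.mul_sum,
      ← Finset.mul_sum, sum_sign_sq]
    have h := ih fun j => z j.succ
    simp only [Finset.sum_const, Finset.card_univ, Fintype.card_fun, Fintype.card_bool,
      Fintype.card_fin, nsmul_eq_mul, Nat.cast_pow, Nat.cast_ofNat]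
    have h0 : 0 ≤ (2 : ℝ) ^ n * z 0 ^ 4 := by positivity
    rw [pow_succ (2 : ℝ) n]
    nlinarith

/-- The second moment of a sum of independent centered random variables. -/
theorem sum_pi_sq {α : Type*} [Fintype α] (g : α → ℝ) (hg : ∑ a, g a = 0) (m : ℕ) :
    (Fintype.card α : ℝ) * ∑ ω : Fin m → α, (∑ t, g (ω t)) ^ 2 =
      m * (Fintype.card α : ℝ) ^ m * ∑ a, g a ^ 2 := by
  induction m with
  | zero => simp
  | succ m ih =>
    rw [sum_fin_succ_pi]
    simp only [Fin.sum_univ_succ, Fin.cons_zero, Fin.cons_succ, add_sq, Finset.sum_add_distrib]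
    have h1 : ∑ a, ∑ ω : Fin m → α, 2 * g a * ∑ t, g (ω t) = 0 := by
      simp only [← Finset.mul_sum]
      rw [← Finset.sum_mul, ← Finset.mul_sum, hg]
      ring
    rw [h1]
    simp only [Finset.sum_const, Finset.card_univ, Fintype.card_fun, Fintype.card_fin,
      nsmul_eq_mul, ← Finset.mul_sum, Nat.cast_pow, Nat.cast_add, Nat.cast_one]
    rw [mul_add, ih]
    ring

/-- With `a = ∑ j, z j ^ 2`, one squared sign sum has mean `a` and fourth-moment bound `3 * a ^ 2`,
so its variance is at most `2 * a ^ 2`. The variances of `m` independent copies add up. -/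
theorem sum_sign_energy_sq_le {n m : ℕ} (z : Fin n → ℝ) :
    ∑ σ : Fin m → Fin n → Bool,
      (∑ t, (∑ j, sgn (σ t j) * z j) ^ 2 - m * ∑ j, z j ^ 2) ^ 2 ≤
      2 * m * (∑ j, z j ^ 2) ^ 2 * (2 ^ n) ^ m := by
  set a := ∑ j, z j ^ 2
  have hcard : (Fintype.card (Fin n → Bool) : ℝ) = 2 ^ n := by simp
  have h1 := sum_pi_sq (fun σ : Fin n → Bool => (∑ j, sgn (σ j) * z j) ^ 2 - a)
    (by rw [Finset.sum_sub_distrib, sum_sign_sq]; simp [a]) m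
  have h2 : ∑ σ : Fin n → Bool, ((∑ j, sgn (σ j) * z j) ^ 2 - a) ^ 2 ≤ 2 * 2 ^ n * a ^ 2 := by
    have h3 := sum_sign_pow_four z
    have h4 := sum_sign_sq z
    have : ∀ σ : Fin n → Bool, ((∑ j, sgn (σ j) * z j) ^ 2 - a) ^ 2 =
      (∑ j, sgn (σ j) * z j) ^ 4 - 2 * a * (∑ j, sgn (σ j) * z j) ^ 2 + a ^ 2 := fun σ => by ring
    simp only [this]
    rw [Finset.sum_add_distrib, Finset.sum_sub_distrib, ← Finset.mul_sum, h4]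
    simp only [Finset.sum_const, Finset.card_univ, nsmul_eq_mul, hcard]
    have h5 : ∑ j, z j ^ 2 = a := rfl
    rw [h5] at *
    nlinarith
  have h3 : ∀ σ : Fin m → Fin n → Bool, ∑ t, (∑ j, sgn (σ t j) * z j) ^ 2 - m * a =
      ∑ t, ((∑ j, sgn (σ t j) * z j) ^ 2 - a) := fun σ => by
    rw [Finset.sum_sub_distrib]; simp
  simp only [h3]
  rw [hcard] at h1
  have hpos : (0 : ℝ) < 2 ^ n := by positivity
  refine le_of_mul_le_mul_left ?_ hpos
  rw [h1]
  calc _ ≤ (m : ℝ) * (2 ^ n) ^ m * (2 * 2 ^ n * a ^ 2) :=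
        mul_le_mul_of_nonneg_left h2 (by positivity)
    _ = _ := by ring

open Classical in
/-- Chebyshev's inequality for the energy of `m` random sums. -/
theorem card_sign_energy_le {n m : ℕ} (z : Fin n → ℝ) {η δ : ℝ} (hη : 0 < η) (hm : 0 < m)
    (hδ : 2 ≤ δ * (η ^ 2 * m)) :
    ((Finset.univ.filter fun σ : Fin m → Fin n → Bool =>
      η * (m * ∑ j, z j ^ 2) <
        |∑ t, (∑ j, sgn (σ t j) * z j) ^ 2 - m * ∑ j, z j ^ 2|).card : ℝ) ≤
      δ * (2 ^ n) ^ m := by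
  have h := sum_sign_energy_sq_le (m := m) z
  have hδ0 : 0 ≤ δ := by
    by_contra! hcon
    have : 0 < η ^ 2 * m := by positivity
    nlinarith
  -- Chebyshev divides by the square of the threshold, so `z = 0`, where nothing deviates, is
  -- separate.
  rcases (Finset.sum_nonneg fun j _ => sq_nonneg (z j) : 0 ≤ ∑ j, z j ^ 2).eq_or_lt with h0 | h0
  · have hz : ∀ j, z j = 0 := by
      intro j
      have := (Finset.sum_eq_zero_iff_of_nonneg fun j _ => sq_nonneg (z j)).1 h0.symm j
        (Finset.mem_univ j)
      exact pow_eq_zero_iff (two_ne_zero) |>.1 this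
    rw [Finset.filter_false_of_mem]
    · simp; positivity
    · intro σ _
      simp [hz]
  · set a := ∑ j, z j ^ 2
    set S := Finset.univ.filter fun σ : Fin m → Fin n → Bool =>
      η * (m * a) < |∑ t, (∑ j, sgn (σ t j) * z j) ^ 2 - m * a|
    have h1 : (S.card : ℝ) * (η * (m * a)) ^ 2 ≤ 2 * m * a ^ 2 * (2 ^ n) ^ m := by
      refine le_trans ?_ h
      rw [← nsmul_eq_mul]
      refine (Finset.card_nsmul_le_sum S _ _ fun σ hσ => ?_).trans
        (Finset.sum_le_univ_sum_of_nonneg fun σ => sq_nonneg _)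
      have := (Finset.mem_filter.1 hσ).2
      rw [← sq_abs (_ - _)]
      exact pow_le_pow_left₀ (by positivity) this.le 2
    have hm' : (0 : ℝ) < m := by exact_mod_cast hm
    have h2 : 0 < m * a ^ 2 := by positivity
    refine le_of_mul_le_mul_right ?_ (mul_pos h2 (by positivity : 0 < η ^ 2 * (m : ℝ)))
    have h3 : (0 : ℝ) ≤ (2 ^ n) ^ m * (m * a ^ 2) := by positivity
    nlinarith

/-! ### Random hashing of the blocks -/

/-- Overwriting the value at `p` of a colliding hash function by an arbitrary bucket is injective,
because the old value can be read off at `q`. -/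
theorem card_collision_le {B W : ℕ} {p q : Fin B} (hpq : p ≠ q) :
    (Finset.univ.filter fun h : Fin B → Fin W => h p = h q).card * W ≤ W ^ B := by
  have := Finset.card_le_card_of_injOn (s := (Finset.univ.filter fun h : Fin B → Fin W => h p = h q)
    ×ˢ (Finset.univ : Finset (Fin W))) (t := (Finset.univ : Finset (Fin B → Fin W)))
    (fun hc => Function.update hc.1 p hc.2) (fun _ _ => Finset.mem_coe.2 (Finset.mem_univ _)) ?_
  · simpa using this
  · rintro ⟨h, c⟩ hh ⟨h', c'⟩ hh' heq
    simp only [Finset.coe_product, Set.mem_prod, Finset.mem_coe, Finset.mem_filter,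
      Finset.mem_univ, true_and, and_true] at hh hh'
    have e : ∀ i, Function.update h p c i = Function.update h' p c' i := fun i => congrFun heq i
    have hc := e p
    rw [Function.update_self, Function.update_self] at hc
    have hne : ∀ i, i ≠ p → h i = h' i := fun i hi => by
      have := e i
      rwa [Function.update_of_ne hi, Function.update_of_ne hi] at this
    refine Prod.ext (funext fun i => ?_) hc
    rcases eq_or_ne i p with rfl | hi
    · show h i = h' i
      rw [hh, hh', hne q hpq.symm]
    · exact hne i hi

open Classical in
theorem card_heavy_collision_le {B W : ℕ} (H : Finset (Fin B)) (q : Fin B) :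
    (Finset.univ.filter fun h : Fin B → Fin W => ∃ p ∈ H, p ≠ q ∧ h p = h q).card * W ≤
      H.card * W ^ B := by
  have hsub : (Finset.univ.filter fun h : Fin B → Fin W => ∃ p ∈ H, p ≠ q ∧ h p = h q) ⊆
      (H.erase q).biUnion fun p => Finset.univ.filter fun h : Fin B → Fin W => h p = h q := by
    intro h hh
    obtain ⟨p, hp, hpq, hpe⟩ := (Finset.mem_filter.1 hh).2
    exact Finset.mem_biUnion.2 ⟨p, Finset.mem_erase.2 ⟨hpq, hp⟩,
      Finset.mem_filter.2 ⟨Finset.mem_univ _, hpe⟩⟩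
  calc _ ≤ (∑ p ∈ H.erase q, (Finset.univ.filter fun h : Fin B → Fin W => h p = h q).card) * W :=
        Nat.mul_le_mul_right _ ((Finset.card_le_card hsub).trans Finset.card_biUnion_le)
    _ = ∑ p ∈ H.erase q, (Finset.univ.filter fun h : Fin B → Fin W => h p = h q).card * W :=
        Finset.sum_mul _ _ _
    _ ≤ ∑ p ∈ H.erase q, W ^ B :=
        Finset.sum_le_sum fun p hp => card_collision_le (Finset.ne_of_mem_erase hp)
    _ ≤ _ := by
        rw [Finset.sum_const, smul_eq_mul]
        exact Nat.mul_le_mul_right _ (Finset.card_le_card (Finset.erase_subset _ _))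

/-- The energy of the blocks outside `H` that collide with `q`. -/
noncomputable def tailNoise {B W : ℕ} (s : Fin B → ℝ) (H : Finset (Fin B)) (q : Fin B)
    (h : Fin B → Fin W) : ℝ :=
  ∑ p ∈ (Hᶜ).erase q, if h p = h q then s p else 0

theorem sum_tailNoise_le {B W : ℕ} {s : Fin B → ℝ} (hs : ∀ p, 0 ≤ s p)
    (H : Finset (Fin B)) (q : Fin B) :
    (∑ h : Fin B → Fin W, tailNoise s H q h) * W ≤ (∑ p ∈ Hᶜ, s p) * W ^ B := by
  unfold tailNoise
  rw [Finset.sum_comm, Finset.sum_mul, Finset.sum_mul]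
  calc _ ≤ ∑ p ∈ (Hᶜ).erase q, s p * (W : ℝ) ^ B := by
        refine Finset.sum_le_sum fun p hp => ?_
        rw [← Finset.sum_filter, Finset.sum_const, nsmul_eq_mul]
        have h1 : ((Finset.univ.filter fun h : Fin B → Fin W => h p = h q).card : ℝ) * W ≤
            (W : ℝ) ^ B := by
          exact_mod_cast card_collision_le (W := W) (Finset.ne_of_mem_erase hp)
        nlinarith [hs p]
    _ ≤ _ := Finset.sum_le_sum_of_subset_of_nonneg (Finset.erase_subset _ _) fun p _ _ =>
        mul_nonneg (hs p) (by positivity)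

-- Markov's inequality for the noise, whose mean is at most the tail energy divided by `W`. A
-- vanishing tail makes the threshold zero, but then there is no noise at all.
open Classical in
theorem card_tailNoise_le {B W : ℕ} (hW : 0 < W) {s : Fin B → ℝ} (hs : ∀ p, 0 ≤ s p)
    (H : Finset (Fin B)) (q : Fin B) {κ : ℝ} (hκ : 0 < κ) :
    ((Finset.univ.filter fun h : Fin B → Fin W =>
      κ * (∑ p ∈ Hᶜ, s p) / W < tailNoise s H q h).card : ℝ) * κ ≤ W ^ B := by
  have hW' : (0 : ℝ) < W := by exact_mod_cast hW
  have hN : ∀ h : Fin B → Fin W, 0 ≤ tailNoise s H q h := fun h =>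
    Finset.sum_nonneg fun p _ => by split_ifs <;> simp [hs]
  rcases (Finset.sum_nonneg fun p _ => hs p : 0 ≤ ∑ p ∈ Hᶜ, s p).eq_or_lt with h0 | h0
  · rw [Finset.filter_false_of_mem]
    · simp
    · intro h _
      rw [← h0, not_lt, mul_zero, zero_div, h0]
      unfold tailNoise
      refine (Finset.sum_le_sum fun p _ => ?_).trans
        (Finset.sum_le_sum_of_subset_of_nonneg (Finset.erase_subset _ _) fun p _ _ => hs p)
      split_ifs <;> simp [hs]
  · set E := ∑ p ∈ Hᶜ, s p
    set S := Finset.univ.filter fun h : Fin B → Fin W => κ * E / W < tailNoise s H q h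
    have h1 : (S.card : ℝ) * (κ * E / W) ≤ ∑ h : Fin B → Fin W, tailNoise s H q h := by
      rw [← nsmul_eq_mul]
      exact (Finset.card_nsmul_le_sum S _ _ fun h hh => (Finset.mem_filter.1 hh).2.le).trans
        (Finset.sum_le_univ_sum_of_nonneg hN)
    have h2 := (mul_le_mul_of_nonneg_right h1 hW'.le).trans (sum_tailNoise_le hs H q)
    have h3 : (S.card : ℝ) * (κ * E / W) * W = S.card * κ * E := by field_simp
    rw [h3, mul_comm E] at h2
    exact le_of_mul_le_mul_right h2 h0

/-! ### Groups -/

/-- The random choices for a group: a hash function of the blocks, and signs for each of the `m`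
entries of the group in each column. -/
abbrev Sample (B W m n : ℕ) : Type := (Fin B → Fin W) × (Fin m → Fin n → Bool)

/-- The energy of the block `p`. -/
noncomputable def blockEnergy {B b : ℕ} (x : Fin (B * b) → ℝ) (p : Fin B) : ℝ :=
  ∑ j with j.divNat = p, x j ^ 2

theorem blockEnergy_nonneg {B b : ℕ} (x : Fin (B * b) → ℝ) (p : Fin B) : 0 ≤ blockEnergy x p :=
  Finset.sum_nonneg fun _ _ => sq_nonneg _

/-- The coordinates of the blocks that collide with `q`. -/
noncomputable def bucketVec {B W b : ℕ} (x : Fin (B * b) → ℝ) (h : Fin B → Fin W) (q : Fin B)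
    (j : Fin (B * b)) : ℝ :=
  if h j.divNat = h q then x j else 0

/-- The energy of the sketch in the bucket of the block `q`. -/
noncomputable def bucketEnergy {B W m b : ℕ} (x : Fin (B * b) → ℝ) (g : Sample B W m (B * b))
    (q : Fin B) : ℝ :=
  ∑ t, (∑ j, sgn (g.2 t j) * bucketVec x g.1 q j) ^ 2

theorem sum_bucketVec_sq {B W b : ℕ} (x : Fin (B * b) → ℝ) (h : Fin B → Fin W) (q : Fin B) :
    ∑ j, bucketVec x h q j ^ 2 = ∑ p, if h p = h q then blockEnergy x p else 0 := by
  rw [← Finset.sum_fiberwise Finset.univ (fun j : Fin (B * b) => j.divNat)]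
  refine Finset.sum_congr rfl fun p _ => ?_
  unfold blockEnergy bucketVec
  split_ifs with hp
  · refine Finset.sum_congr rfl fun j hj => ?_
    rw [(Finset.mem_filter.1 hj).2, if_pos hp]
  · refine Finset.sum_eq_zero fun j hj => ?_
    rw [(Finset.mem_filter.1 hj).2, if_neg hp]
    simp

theorem blockEnergy_le_sum_bucketVec_sq {B W b : ℕ} (x : Fin (B * b) → ℝ) (h : Fin B → Fin W)
    (q : Fin B) : blockEnergy x q ≤ ∑ j, bucketVec x h q j ^ 2 := by
  rw [sum_bucketVec_sq]
  refine le_trans (by simp) (Finset.single_le_sum (f := fun p => if h p = h q then blockEnergy x p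
    else 0) (fun p _ => ?_) (Finset.mem_univ q))
  split_ifs <;> simp [blockEnergy_nonneg]

theorem sum_bucketVec_sq_le {B W b : ℕ} (x : Fin (B * b) → ℝ) (h : Fin B → Fin W)
    {q : Fin B} {H : Finset (Fin B)} (hH : ¬ ∃ p ∈ H, p ≠ q ∧ h p = h q) :
    ∑ j, bucketVec x h q j ^ 2 ≤ blockEnergy x q + tailNoise (blockEnergy x) H q h := by
  rw [sum_bucketVec_sq, ← Finset.add_sum_erase _ _ (Finset.mem_univ q), if_pos rfl]
  refine add_le_add le_rfl ?_
  unfold tailNoise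
  refine (Finset.sum_subset (fun p hp => ?_) fun p hp hp' => ?_).ge
  · exact Finset.mem_erase.2 ⟨Finset.ne_of_mem_erase hp, Finset.mem_univ _⟩
  · rw [if_neg]
    intro hpe
    refine hH ⟨p, ?_, Finset.ne_of_mem_erase hp, hpe⟩
    by_contra hcon
    exact hp' (Finset.mem_erase.2 ⟨Finset.ne_of_mem_erase hp, Finset.mem_compl.2 hcon⟩)

open Classical in
/-- The samples for which the energy of the bucket of `q` is far from the energy of `q`. -/
noncomputable def badSamples {B b : ℕ} (W m : ℕ) (x : Fin (B * b) → ℝ) (η Δ : ℝ) (q : Fin B) :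
    Finset (Sample B W m (B * b)) :=
  Finset.univ.filter fun g => ¬ ((1 - η) * (m * blockEnergy x q) ≤ bucketEnergy x g q ∧
    bucketEnergy x g q ≤ (1 + η) * (m * (blockEnergy x q + Δ)))

-- Each of the three failures, `S₁` (a block of `H` collides with `q`), `S₂` (too much tail noise)
-- and `S₃` (deviating signs), has probability at most `1 / κ`; the hypotheses on `W` and `m` are
-- what the first and the third need. The lower estimate uses the signs only, since other blocks in
-- the bucket can only increase its energy.
open Classical in
theorem card_badSamples_le {B W m b : ℕ} (x : Fin (B * b) → ℝ) (H : Finset (Fin B)) (q : Fin B)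
    {η κ : ℝ} (hη : 0 < η) (hη1 : η < 1) (hκ : 0 < κ) (hW : 0 < W) (hm : 0 < m)
    (hHW : κ * H.card ≤ W) (hηm : 2 * κ ≤ η ^ 2 * m) :
    ((badSamples W m x η (κ * (∑ p ∈ Hᶜ, blockEnergy x p) / W) q).card : ℝ) * κ ≤
      3 * Fintype.card (Sample B W m (B * b)) := by
  set Δ := κ * (∑ p ∈ Hᶜ, blockEnergy x p) / W
  set S₁ := Finset.univ.filter fun h : Fin B → Fin W => ∃ p ∈ H, p ≠ q ∧ h p = h q
  set S₂ := Finset.univ.filter fun h : Fin B → Fin W => Δ < tailNoise (blockEnergy x) H q h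
  set S₃ : (Fin B → Fin W) → Finset (Fin m → Fin (B * b) → Bool) := fun h =>
    Finset.univ.filter fun σ => η * (m * ∑ j, bucketVec x h q j ^ 2) <
        |∑ t, (∑ j, sgn (σ t j) * bucketVec x h q j) ^ 2 - m * ∑ j, bucketVec x h q j ^ 2|
  have hsub : badSamples W m x η Δ q ⊆ (S₁ ×ˢ Finset.univ ∪ S₂ ×ˢ Finset.univ) ∪
      Finset.univ.biUnion fun h => (S₃ h).map ⟨fun σ => (h, σ), Prod.mk_right_injective h⟩ := by
    rintro ⟨h, σ⟩ hg
    by_contra hcon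
    simp only [Finset.mem_union, Finset.mem_product, Finset.mem_univ, and_true,
      Finset.mem_biUnion, Finset.mem_map, Function.Embedding.coeFn_mk, true_and, not_or,
      not_exists, not_and] at hcon
    obtain ⟨⟨h1, h2⟩, h3⟩ := hcon
    have h1 : ¬ ∃ p ∈ H, p ≠ q ∧ h p = h q := by simpa [S₁] using h1
    have h2 : tailNoise (blockEnergy x) H q h ≤ Δ := by simpa [S₂] using h2
    have h3 : |∑ t, (∑ j, sgn (σ t j) * bucketVec x h q j) ^ 2 -
        m * ∑ j, bucketVec x h q j ^ 2| ≤ η * (m * ∑ j, bucketVec x h q j ^ 2) := by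
      have := h3 h σ
      simpa [S₃] using this
    have h4 := blockEnergy_le_sum_bucketVec_sq x h q
    have h5 := (sum_bucketVec_sq_le x h h1).trans (add_le_add le_rfl h2)
    refine (Finset.mem_filter.1 hg).2 ⟨?_, ?_⟩
    · have h6 := (abs_le.1 h3).1
      have h7 : (m : ℝ) * blockEnergy x q ≤ m * ∑ j, bucketVec x h q j ^ 2 :=
        mul_le_mul_of_nonneg_left h4 (by positivity)
      have h8 := mul_le_mul_of_nonneg_left h7 (by linarith : 0 ≤ 1 - η)
      unfold bucketEnergy
      linarith
    · have h6 := (abs_le.1 h3).2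
      have h7 : (m : ℝ) * ∑ j, bucketVec x h q j ^ 2 ≤ m * (blockEnergy x q + Δ) :=
        mul_le_mul_of_nonneg_left h5 (by positivity)
      have h8 := mul_le_mul_of_nonneg_left h7 (by linarith : 0 ≤ 1 + η)
      unfold bucketEnergy
      linarith
  have hcard := (Finset.card_le_card hsub).trans ((Finset.card_union_le _ _).trans
    (add_le_add (Finset.card_union_le _ _) Finset.card_biUnion_le))
  simp only [Finset.card_product, Finset.card_map, Finset.card_univ] at hcard
  have hcard' : ((badSamples W m x η Δ q).card : ℝ) ≤
      S₁.card * Fintype.card (Fin m → Fin (B * b) → Bool) +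
      S₂.card * Fintype.card (Fin m → Fin (B * b) → Bool) + ∑ h, ((S₃ h).card : ℝ) := by
    exact_mod_cast hcard
  have hW' : (0 : ℝ) < W := by exact_mod_cast hW
  have h1 : (S₁.card : ℝ) * κ ≤ W ^ B := by
    have h1 : (S₁.card : ℝ) * W ≤ H.card * W ^ B := by
      exact_mod_cast card_heavy_collision_le (W := W) H q
    refine le_of_mul_le_mul_right ?_ hW'
    calc (S₁.card : ℝ) * κ * W = S₁.card * W * κ := by ring
      _ ≤ H.card * W ^ B * κ := mul_le_mul_of_nonneg_right h1 hκ.le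
      _ = κ * H.card * W ^ B := by ring
      _ ≤ W * W ^ B := mul_le_mul_of_nonneg_right hHW (by positivity)
      _ = _ := by ring
  have h2 : (S₂.card : ℝ) * κ ≤ W ^ B := card_tailNoise_le hW (blockEnergy_nonneg x) H q hκ
  have hT : (Fintype.card (Fin m → Fin (B * b) → Bool) : ℝ) = (2 ^ (B * b)) ^ m := by simp
  have hS : (Fintype.card (Sample B W m (B * b)) : ℝ) = W ^ B * (2 ^ (B * b)) ^ m := by simp
  have h3 : (∑ h, ((S₃ h).card : ℝ)) * κ ≤ W ^ B * (2 ^ (B * b)) ^ m := by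
    have : ∀ h, ((S₃ h).card : ℝ) ≤ 1 / κ * (2 ^ (B * b)) ^ m := fun h =>
      card_sign_energy_le _ hη hm (by rw [div_mul_eq_mul_div, le_div_iff₀ hκ, one_mul]; exact hηm)
    calc _ ≤ (∑ _h : Fin B → Fin W, 1 / κ * (2 ^ (B * b)) ^ m) * κ :=
          mul_le_mul_of_nonneg_right (Finset.sum_le_sum fun h _ => this h) hκ.le
      _ = _ := by
          simp only [Finset.sum_const, Finset.card_univ, Fintype.card_fun, Fintype.card_fin,
            nsmul_eq_mul, Nat.cast_pow]
          field_simp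
  rw [hS]
  rw [hT] at hcard'
  have hP : (0 : ℝ) ≤ (2 ^ (B * b)) ^ m := by positivity
  have := mul_le_mul_of_nonneg_right hcard' hκ.le
  have := mul_le_mul_of_nonneg_right h1 hP
  have := mul_le_mul_of_nonneg_right h2 hP
  nlinarith

/-! ### Independent repetitions -/

-- Union bound over the sets of `L'` positions at which `ω` is in `S`: there are at most `2 ^ (4 *
-- L')` of them, and each has probability at most `r ^ (-L')` by independence.
open Classical in
theorem card_many_bad_le {α : Type*} [Fintype α] {r L' : ℕ} (S : Finset α)
    (hS : r * S.card ≤ Fintype.card α) :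
    r ^ L' * (Finset.univ.filter fun ω : Fin (4 * L') → α =>
      L' ≤ (Finset.univ.filter fun l => ω l ∈ S).card).card ≤
      2 ^ (4 * L') * Fintype.card α ^ (4 * L') := by
  set L := 4 * L'
  have hsub : (Finset.univ.filter fun ω : Fin L → α =>
      L' ≤ (Finset.univ.filter fun l => ω l ∈ S).card) ⊆
      (Finset.powersetCard L' (Finset.univ : Finset (Fin L))).biUnion fun T =>
        Fintype.piFinset fun l => if l ∈ T then S else Finset.univ := by
    intro ω hω
    obtain ⟨T, hT, hTc⟩ := Finset.exists_subset_card_eq (Finset.mem_filter.1 hω).2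
    refine Finset.mem_biUnion.2 ⟨T, Finset.mem_powersetCard.2 ⟨Finset.subset_univ _, hTc⟩, ?_⟩
    rw [Fintype.mem_piFinset]
    intro l
    split_ifs with hl
    · exact (Finset.mem_filter.1 (hT hl)).2
    · exact Finset.mem_univ _
  have hT : ∀ T ∈ Finset.powersetCard L' (Finset.univ : Finset (Fin L)),
      r ^ L' * (Fintype.piFinset fun l => if l ∈ T then S else Finset.univ).card ≤
        Fintype.card α ^ L := by
    intro T hT
    have hTc := (Finset.mem_powersetCard.1 hT).2
    have : r ^ L' = ∏ l : Fin L, if l ∈ T then r else 1 := by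
      rw [Finset.prod_ite_mem, Finset.univ_inter, Finset.prod_const, hTc]
    rw [this, Fintype.card_piFinset, ← Finset.prod_mul_distrib]
    calc _ ≤ ∏ _l : Fin L, Fintype.card α := by
          refine Finset.prod_le_prod' fun l _ => ?_
          split_ifs
          · exact hS
          · simp
      _ = _ := by simp
  calc _ ≤ r ^ L' * ∑ T ∈ Finset.powersetCard L' (Finset.univ : Finset (Fin L)),
        (Fintype.piFinset fun l => if l ∈ T then S else Finset.univ).card :=
        Nat.mul_le_mul_left _ ((Finset.card_le_card hsub).trans Finset.card_biUnion_le)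
    _ ≤ ∑ T ∈ Finset.powersetCard L' (Finset.univ : Finset (Fin L)), Fintype.card α ^ L := by
        rw [Finset.mul_sum]
        exact Finset.sum_le_sum hT
    _ ≤ _ := by
        rw [Finset.sum_const, Finset.card_powersetCard, Finset.card_univ, Fintype.card_fin,
          smul_eq_mul]
        exact Nat.mul_le_mul_right _ (Nat.choose_le_two_pow _ _)


/-! ### The sketching matrix -/

/-- The row `(l * m + t) * W + w` adds up, with the signs `(ω l).2 t`, the coordinates of the blocks
with the hash value `w` under `(ω l).1`. -/
def sketchMatrix {L B W m b : ℕ} (ω : Fin L → Sample B W m (B * b)) :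
    Matrix (Fin (L * m * W)) (Fin (B * b)) ℝ := fun i j =>
  if (ω i.divNat.divNat).1 j.divNat = i.modNat then
    sgn ((ω i.divNat.divNat).2 i.divNat.modNat j) else 0

theorem sgn_ne_zero (a : Bool) : sgn a ≠ 0 := by cases a <;> simp [sgn]

theorem sketchMatrix_ne_zero_iff {L B W m b : ℕ} (ω : Fin L → Sample B W m (B * b))
    (i : Fin (L * m * W)) (j : Fin (B * b)) :
    sketchMatrix ω i j ≠ 0 ↔ (ω i.divNat.divNat).1 j.divNat = i.modNat := by
  unfold sketchMatrix
  split_ifs with h <;> simp [h, sgn_ne_zero]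

/-- Among the `W` rows of each of the `L * m` bucket tables, a column has exactly one nonzero entry.
Both lists are strictly increasing with the same members, hence equal; the order matters because the
program identifies groups by position. -/
theorem colSupport_sketchMatrix {L B W m b : ℕ} (ω : Fin L → Sample B W m (B * b))
    (j : Fin (B * b)) :
    colSupport (sketchMatrix ω) j =
      (List.finRange (L * m)).map fun r => Fin.mkDivMod r ((ω r.divNat).1 j.divNat) := by
  have hlt : ((List.finRange (L * m)).map fun r =>
      Fin.mkDivMod r ((ω r.divNat).1 j.divNat)).Pairwise (· < ·) := by
    rw [List.pairwise_map]
    refine (List.pairwise_lt_finRange _).imp fun {r r'} hr => ?_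
    rw [Fin.lt_def, Fin.coe_mkDivMod, Fin.coe_mkDivMod]
    have h1 := ((ω r.divNat).1 j.divNat).isLt
    have h2 : W * ((r : ℕ) + 1) ≤ W * (r' : ℕ) := Nat.mul_le_mul_left _ hr
    rw [mul_add, mul_one] at h2
    omega
  have hlt' : (colSupport (sketchMatrix ω) j).Pairwise (· < ·) :=
    (List.pairwise_lt_finRange _).filter _
  refine List.Perm.eq_of_pairwise (fun _ _ _ _ h h' => absurd h' (lt_asymm h)) hlt' hlt ?_
  refine (List.perm_ext_iff_of_nodup (hlt'.imp fun h => ne_of_lt h)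
    (hlt.imp fun h => ne_of_lt h)).2 fun i => ?_
  simp only [colSupport, List.mem_filter, List.mem_finRange, true_and, decide_eq_true_eq,
    List.mem_map]
  rw [sketchMatrix_ne_zero_iff]
  constructor
  · intro h
    exact ⟨i.divNat, by rw [h, Fin.divNat_mkDivMod_modNat]⟩
  · rintro ⟨r, rfl⟩
    rw [Fin.divNat_mkDivMod, Fin.modNat_mkDivMod]

theorem colNnz_sketchMatrix {L B W m b : ℕ} (ω : Fin L → Sample B W m (B * b)) (j : Fin (B * b)) :
    colNnz (sketchMatrix ω) j = L * m := by
  simp [colNnz, colSupport_sketchMatrix]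

theorem columnData_row_sketchMatrix {L B W m b : ℕ} (ω : Fin L → Sample B W m (B * b))
    (j : Fin (B * b)) (r : Fin (L * m)) :
    (columnData (sketchMatrix ω)).row j r = Fin.mkDivMod r ((ω r.divNat).1 j.divNat) := by
  have h : (columnData (sketchMatrix ω)).row j r =
      ((colSupport (sketchMatrix ω) j).map fun i : Fin (L * m * W) => i.val).getD r 0 := by
    rw [List.map_eq_flatMap]
    simp [columnData]
  rw [h, colSupport_sketchMatrix, List.map_map, List.getD_eq_getElem _ _ (by simp)]
  simp only [List.getElem_map, Function.comp_apply, List.getElem_finRange]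
  rfl

/-- The first column of a block. -/
theorem block_start_lt {B b q : ℕ} (hb : 0 < b) (hq : q < B) : q * b < B * b :=
  Nat.mul_lt_mul_of_pos_right hq hb

/-- The hash value depends only on the block of a column, so the rows listed for the first column of
`q` are precisely the rows of the bucket of `q`. -/
theorem groupEnergy_sketchMatrix {L B W m b : ℕ} (hb : 0 < b)
    (ω : Fin L → Sample B W m (B * b)) (x : Fin (B * b) → ℝ) (q : Fin B) (l : Fin L) :
    groupEnergy (columnData (sketchMatrix ω))
      (fun i => if h : i < L * m * W then (sketchMatrix ω *ᵥ x) ⟨i, h⟩ else 0) m (q * b) l =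
      bucketEnergy x (ω l) q := by
  unfold groupEnergy bucketEnergy
  rw [Finset.sum_range]
  refine Finset.sum_congr rfl fun t _ => ?_
  have hj := block_start_lt hb q.isLt
  set j : Fin (B * b) := ⟨q * b, hj⟩ with hjdef
  have hjd : j.divNat = q := by
    ext
    simp [hjdef, Nat.mul_div_cancel _ hb]
  have h1 := columnData_row_sketchMatrix ω j (Fin.mkDivMod l t)
  rw [Fin.divNat_mkDivMod, hjd, Fin.coe_mkDivMod l t, mul_comm m] at h1
  have h2 : ((q : ℕ) * b) = (j : ℕ) := rfl
  rw [h2, h1]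
  dsimp only
  rw [dif_pos (Fin.isLt _), Fin.eta]
  congr 1
  unfold mulVec dotProduct
  refine Finset.sum_congr rfl fun i _ => ?_
  simp only [sketchMatrix, Fin.divNat_mkDivMod, Fin.modNat_mkDivMod, bucketVec]
  split_ifs <;> simp

/-! ### Uniform measures on finitely many matrices -/

instance {M n : ℕ} : MeasurableSingletonClass (Matrix (Fin M) (Fin n) ℝ) :=
  inferInstanceAs (MeasurableSingletonClass (Fin M → Fin n → ℝ))

/-- The push-forward of the uniform distribution. It is discrete and singletons are measurable, so
the bound holds for every set `S`; the failure event of the recovery never has to be shown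
measurable. -/
theorem exists_uniform_measure {Ω : Type*} [Fintype Ω] [Nonempty Ω] {M n : ℕ}
    (f : Ω → Matrix (Fin M) (Fin n) ℝ) :
    ∃ μ : Measure (Matrix (Fin M) (Fin n) ℝ), IsProbabilityMeasure μ ∧
      (∀ P : Matrix (Fin M) (Fin n) ℝ → Prop, (∀ ω, P (f ω)) → ∀ᵐ A ∂μ, P A) ∧
      ∀ (S : Set (Matrix (Fin M) (Fin n) ℝ)) (T : Finset Ω), (∀ ω, f ω ∈ S → ω ∈ T) →
        μ S ≤ (T.card : ENNReal) / Fintype.card Ω := by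
  classical
  have key : ∀ (S : Set (Matrix (Fin M) (Fin n) ℝ)) (T : Finset Ω), (∀ ω, f ω ∈ S → ω ∈ T) →
      ((PMF.uniformOfFintype Ω).map f).toMeasure S ≤ (T.card : ENNReal) / Fintype.card Ω := by
    intro S T hT
    rw [PMF.toMeasure_apply_eq_toOuterMeasure, PMF.toOuterMeasure_map_apply]
    calc _ ≤ (PMF.uniformOfFintype Ω).toOuterMeasure (T : Set Ω) := measure_mono hT
      _ = _ := by rw [PMF.toOuterMeasure_uniformOfFintype_apply]; simp
  refine ⟨_, PMF.toMeasure.isProbabilityMeasure ((PMF.uniformOfFintype Ω).map f), fun P hP => ?_,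
    key⟩
  have := key {A | ¬ P A} ∅ fun ω hω => absurd (hP ω) hω
  rw [ae_iff]
  simpa using this

/-! ### The quality of the selected blocks -/

theorem sum_le_sum_of_forall_le {ι : Type*} {S T : Finset ι} {f g : ι → ℝ}
    (hcard : S.card = T.card) (h : ∀ i ∈ S, ∀ j ∈ T, f i ≤ g j) :
    ∑ i ∈ S, f i ≤ ∑ j ∈ T, g j := by
  rcases T.eq_empty_or_nonempty with rfl | hT
  · obtain rfl : S = ∅ := by simpa using hcard
    simp
  · obtain ⟨j, hj, hmin⟩ := T.exists_min_image g hT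
    calc ∑ i ∈ S, f i ≤ S.card • g j := Finset.sum_le_card_nsmul _ _ _ fun i hi => h i hi j hj
      _ = T.card • g j := by rw [hcard]
      _ ≤ _ := Finset.card_nsmul_le_sum _ _ _ hmin

/-- If the estimates `e` of the energies `s` are accurate, then selecting the largest estimates loses
little, compared with any other choice `H` of as many blocks. -/
theorem sum_compl_le_of_estimates {ι : Type*} [Fintype ι] [DecidableEq ι] {s e : ι → ℝ}
    {S H : Finset ι} {η m Δ : ℝ} (hs : ∀ i, 0 ≤ s i) (hm : 0 < m) (hη : 0 < η) (hη1 : η ≤ 1 / 4)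
    (hΔ : 0 ≤ Δ) (hcard : S.card = H.card) (htop : ∀ i ∉ S, ∀ j ∈ S, e i ≤ e j)
    (hlow : ∀ i, (1 - η) * (m * s i) ≤ e i) (hhigh : ∀ i, e i ≤ (1 + η) * (m * (s i + Δ)))
    (hHΔ : H.card * Δ ≤ η * ∑ i ∈ Hᶜ, s i) :
    ∑ i ∈ Sᶜ, s i ≤ (1 + 5 * η) * ∑ i ∈ Hᶜ, s i := by
  -- The two differences have the same size, and every block that was missed has an estimate no
  -- larger than every block taken in its place. The factor comes from `(1 + η) ≤ (1 - η) * (1 + 3 *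
  -- η)`, valid for `η ≤ 1 / 3`.
  have h1 : ∑ i ∈ H \ S, s i ≤ ∑ j ∈ S \ H, (1 + 3 * η) * (s j + Δ) := by
    refine sum_le_sum_of_forall_le (Finset.card_sdiff_comm hcard.symm) fun i hi j hj => ?_
    have hi' := (Finset.mem_sdiff.1 hi).2
    have hj' := (Finset.mem_sdiff.1 hj).1
    have h2 := (hlow i).trans ((htop i hi' j hj').trans (hhigh j))
    have h3 : (1 - η) * s i ≤ (1 + η) * (s j + Δ) := by
      refine le_of_mul_le_mul_left ?_ hm
      linarith
    have h4 : 0 ≤ s j + Δ := add_nonneg (hs j) hΔ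
    have h5 : (1 + η) * (s j + Δ) ≤ (1 - η) * ((1 + 3 * η) * (s j + Δ)) := by
      have : 0 ≤ η * (1 - 3 * η) := mul_nonneg hη.le (by linarith)
      nlinarith [mul_nonneg this h4]
    exact le_of_mul_le_mul_left (h3.trans h5) (by linarith)
  have h2 : ∑ i ∈ Sᶜ, s i = ∑ i ∈ (S ∪ H)ᶜ, s i + ∑ i ∈ H \ S, s i := by
    rw [← Finset.sum_union]
    · congr 1; ext i; simp; tauto
    · rw [Finset.disjoint_left]; intro i hi; simp at hi ⊢; tauto
  have h3 : ∑ i ∈ Hᶜ, s i = ∑ i ∈ (S ∪ H)ᶜ, s i + ∑ i ∈ S \ H, s i := by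
    rw [← Finset.sum_union]
    · congr 1; ext i; simp; tauto
    · rw [Finset.disjoint_left]; intro i hi; simp at hi ⊢; tauto
  have h4 : ∑ j ∈ S \ H, (1 + 3 * η) * (s j + Δ) =
      (1 + 3 * η) * (∑ j ∈ S \ H, s j + (S \ H).card * Δ) := by
    rw [← Finset.mul_sum, Finset.sum_add_distrib, Finset.sum_const, nsmul_eq_mul]
  have h5 : ((S \ H).card : ℝ) * Δ ≤ H.card * Δ := by
    refine mul_le_mul_of_nonneg_right ?_ hΔ
    rw [← hcard]
    exact_mod_cast Finset.card_le_card Finset.sdiff_subset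
  have h6 : 0 ≤ ∑ i ∈ (S ∪ H)ᶜ, s i := Finset.sum_nonneg fun i _ => hs i
  have h7 : 0 ≤ ∑ i ∈ Hᶜ, s i := Finset.sum_nonneg fun i _ => hs i
  have h8 : ∑ i ∈ S \ H, s i ≤ ∑ i ∈ Hᶜ, s i := by linarith
  have h9 : (1 + 3 * η) * ((S \ H).card * Δ) ≤ 2 * (η * ∑ i ∈ Hᶜ, s i) := by
    have h10 : ((S \ H).card : ℝ) * Δ ≤ η * ∑ i ∈ Hᶜ, s i := h5.trans hHΔ
    have h11 : 0 ≤ ((S \ H).card : ℝ) * Δ := by positivity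
    nlinarith
  rw [h4] at h1
  -- The swap costs `3 * η` times the energy of `S \ H`, and the `Δ` terms cost at most `2 * η`
  -- times the energy outside `H`.
  nlinarith

theorem norm_sub_restrictBlocks_sq {B b : ℕ} (x : EuclideanSpace ℝ (Fin (B * b)))
    (U : Finset ℕ) :
    ‖x - restrictBlocks b U x‖ ^ 2 =
      ∑ p ∈ Finset.univ.filter fun p : Fin B => (p : ℕ) ∉ U, blockEnergy x.ofLp p := by
  rw [Finset.sum_filter, EuclideanSpace.norm_sq_eq,
    ← Finset.sum_fiberwise Finset.univ fun j : Fin (B * b) => j.divNat]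
  refine Finset.sum_congr rfl fun p _ => ?_
  unfold blockEnergy
  by_cases hp : (p : ℕ) ∈ U
  · rw [if_neg (not_not.2 hp)]
    refine Finset.sum_eq_zero fun j hj => ?_
    have : (j : ℕ) / b = p := congrArg Fin.val (Finset.mem_filter.1 hj).2
    simp [restrictBlocks, this, hp]
  · rw [if_pos hp]
    refine Finset.sum_congr rfl fun j hj => ?_
    have : (j : ℕ) / b = p := congrArg Fin.val (Finset.mem_filter.1 hj).2
    simp [restrictBlocks, this, hp]

theorem sum_blockEnergy_le_norm_sub_sq {B b : ℕ} (x z : EuclideanSpace ℝ (Fin (B * b)))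
    {U : Finset ℕ} (hz : ∀ i, z i ≠ 0 → (i : ℕ) / b ∈ U) :
    ∑ p ∈ Finset.univ.filter fun p : Fin B => (p : ℕ) ∉ U, blockEnergy x.ofLp p ≤ ‖x - z‖ ^ 2 := by
  rw [EuclideanSpace.norm_sq_eq, ← Finset.sum_fiberwise Finset.univ fun j : Fin (B * b) => j.divNat]
  refine (Finset.sum_le_sum fun p hp => ?_).trans (Finset.sum_le_sum_of_subset_of_nonneg
    (Finset.filter_subset _ _) fun p _ _ => Finset.sum_nonneg fun j _ => sq_nonneg _)
  refine Finset.sum_le_sum fun j hj => ?_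
  have h1 : (j : ℕ) / b = p := congrArg Fin.val (Finset.mem_filter.1 hj).2
  have h2 : z j = 0 := by
    by_contra hcon
    exact (Finset.mem_filter.1 hp).2 (h1 ▸ hz j hcon)
  simp [h2]

/-- The best choice of blocks. -/
theorem exists_sum_le_blockErr_sq {B b : ℕ} (k : ℕ)
    (x : EuclideanSpace ℝ (Fin (B * b))) :
    ∃ H : Finset (Fin B), H.card = min (k / b) B ∧
      ∑ p ∈ Hᶜ, blockEnergy x.ofLp p ≤ blockErr k b x ^ 2 ∧ 0 ≤ blockErr k b x := by
  classical
  obtain ⟨H, hH, hmin⟩ := (Finset.powersetCard (min (k / b) B)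
    (Finset.univ : Finset (Fin B))).exists_min_image
    (fun H => ∑ p ∈ Hᶜ, blockEnergy x.ofLp p) (Finset.powersetCard_nonempty.2 (by simp))
  have hle : √(∑ p ∈ Hᶜ, blockEnergy x.ofLp p) ≤ blockErr k b x := by
    refine le_csInf ⟨_, 0, ⟨∅, by simp, by simp, by simp⟩, rfl⟩ ?_
    rintro r ⟨z, ⟨U, -, hUc, hz⟩, rfl⟩
    refine Real.sqrt_le_iff.2 ⟨norm_nonneg _, ?_⟩
    set T : Finset (Fin B) := Finset.univ.filter fun p => (p : ℕ) ∈ U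
    have hT : T.card ≤ min (k / b) B := by
      refine le_min ?_ ?_
      · refine le_trans ?_ hUc
        exact Finset.card_le_card_of_injOn (fun p => (p : ℕ)) (fun p hp => (Finset.mem_filter.1 hp).2)
          (Fin.val_injective.injOn)
      · simpa using Finset.card_le_univ T
    -- The minimum defining `H` runs over sets of exactly this size, so a smaller support is
    -- enlarged, which only lowers the energy outside.
    obtain ⟨T', hTT', hT'⟩ := Finset.exists_superset_card_eq hT (by simp)
    refine (hmin T' (Finset.mem_powersetCard.2 ⟨Finset.subset_univ _, hT'⟩)).trans
      (le_trans ?_ (sum_blockEnergy_le_norm_sub_sq x z hz))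
    refine Finset.sum_le_sum_of_subset_of_nonneg (fun p hp => ?_)
      fun p _ _ => blockEnergy_nonneg _ _
    refine Finset.mem_filter.2 ⟨Finset.mem_univ _, fun hpU => ?_⟩
    exact Finset.mem_compl.1 hp (hTT' (Finset.mem_filter.2 ⟨Finset.mem_univ _, hpU⟩))
  have h0 : 0 ≤ blockErr k b x := (Real.sqrt_nonneg _).trans hle
  exact ⟨H, (Finset.mem_powersetCard.1 hH).2, (Real.sqrt_le_left h0).1 hle, h0⟩


/-! ### Parameters -/

/-- The rounded logarithm is at most `log n / log 2 + 1 ≤ 2 * log n / log 2`, and `log 2 > 2 / 3`.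
-/
theorem clog_two_le {n : ℕ} (hn : 2 ≤ n) : (Nat.clog 2 n : ℝ) ≤ 3 * Real.log n := by
  have hpos : 0 < Nat.clog 2 n := Nat.clog_pos one_lt_two hn
  have h1 : 2 ^ (Nat.clog 2 n).pred < n := Nat.pow_pred_clog_lt_self one_lt_two hn
  have h2 : ((Nat.clog 2 n).pred : ℝ) * Real.log 2 ≤ Real.log n := by
    rw [← Real.log_pow]
    exact Real.log_le_log (by positivity) (by exact_mod_cast h1.le)
  have h3 : Real.log 2 ≤ Real.log n := Real.log_le_log (by norm_num) (by exact_mod_cast hn)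
  have h4 : (Nat.clog 2 n : ℝ) = ((Nat.clog 2 n).pred : ℝ) + 1 := by
    exact_mod_cast (Nat.succ_pred_eq_of_pos hpos).symm
  have h5 := Real.log_two_gt_d9
  rw [h4]
  have h6 : (0 : ℝ) ≤ ((Nat.clog 2 n).pred : ℝ) := Nat.cast_nonneg _
  nlinarith

theorem exists_depth {n : ℕ} (hn : 2 ≤ n) :
    ∃ d : ℕ, 1 ≤ d ∧ n ≤ 2 ^ 4 ^ (d + 1) ∧ ((4 ^ (d + 1) : ℕ) : ℝ) ≤ 192 * Real.log n := by
  set c := Nat.clog 2 n with hc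
  have hpos : 0 < c := Nat.clog_pos one_lt_two hn
  have h1 : c ≤ 4 ^ Nat.clog 4 c := Nat.le_pow_clog (by norm_num) c
  have h2 : 4 ^ Nat.clog 4 c ≤ 4 * c := by
    rcases Nat.lt_or_ge c 2 with h | h
    · rw [show c = 1 by omega]
      simp
    · have h3 := Nat.pow_pred_clog_lt_self (b := 4) (by norm_num) h
      have h4 : 0 < Nat.clog 4 c := Nat.clog_pos (by norm_num) h
      rw [← Nat.succ_pred_eq_of_pos h4, pow_succ]
      omega
  -- The number of groups must be a power of four, and at least `4 ^ 2`, for `approxMedian`; the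
  -- added `1` secures the latter. Rounding costs a factor of at most `64`, and `192 = 64 * 3`.
  refine ⟨Nat.clog 4 c + 1, by omega, ?_, ?_⟩
  · refine (Nat.le_pow_clog one_lt_two n).trans (Nat.pow_le_pow_right (by norm_num) ?_)
    rw [pow_succ, pow_succ]
    omega
  · have h3 : 4 ^ (Nat.clog 4 c + 1 + 1) ≤ 64 * c := by
      rw [pow_succ, pow_succ]
      omega
    have h4 : ((4 ^ (Nat.clog 4 c + 1 + 1) : ℕ) : ℝ) ≤ 64 * c := by exact_mod_cast h3
    have := clog_two_le hn
    linarith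

/-! ### The estimates fail with small probability -/

open Classical in
/-- The sequences of length `4 * L` that meet one of the sets `S q` at least `L` times. -/
noncomputable def manyBad {α ι : Type*} [Fintype α] [Fintype ι] (L : ℕ) (S : ι → Finset α) :
    Finset (Fin (4 * L) → α) :=
  Finset.univ.biUnion fun q => Finset.univ.filter fun ω : Fin (4 * L) → α =>
    L ≤ (Finset.univ.filter fun l => ω l ∈ S q).card

/-- For one index the failure probability is at most `2 ^ (4 * L) / 2 ^ (12 * L) = 2 ^ (-8 * L)`.
The union over at most `2 ^ (4 * L)` indices leaves `2 ^ (-4 * L)`, which is why each group is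
required to fail with probability at most `2 ^ (-12)`. -/
theorem card_manyBad_le {α ι : Type*} [Fintype α] [Fintype ι] {L : ℕ} {S : ι → Finset α}
    (hS : ∀ q, 2 ^ 12 * (S q).card ≤ Fintype.card α) (hι : Fintype.card ι ≤ 2 ^ (4 * L)) :
    2 ^ (4 * L) * (manyBad L S).card ≤ Fintype.card α ^ (4 * L) := by
  classical
  generalize hN : Fintype.card α ^ (4 * L) = N
  generalize hP : 2 ^ (4 * L) = P at hι ⊢
  have hP0 : 0 < P := hP ▸ by positivity
  have h12 : (2 ^ 12) ^ L = P * (P * P) := by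
    rw [← hP, ← pow_mul, ← pow_add, ← pow_add]
    congr 1
    omega
  have h2 : P * P * (manyBad L S).card ≤ P * N := by
    refine (Nat.mul_le_mul_left _ Finset.card_biUnion_le).trans ?_
    rw [Finset.mul_sum]
    refine (Finset.sum_le_card_nsmul _ _ N fun q _ => ?_).trans ?_
    · have h1 := card_many_bad_le (L' := L) (S q) (hS q)
      rw [h12, hP, hN, mul_assoc] at h1
      exact Nat.le_of_mul_le_mul_left h1 hP0
    · simpa using Nat.mul_le_mul_right N hι
  rw [mul_assoc] at h2
  exact Nat.le_of_mul_le_mul_left h2 hP0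

theorem four_mul_card_lt_of_notMem_manyBad {α ι : Type*} [Fintype α] [Fintype ι] {L : ℕ}
    {S : ι → Finset α} {ω : Fin (4 * L) → α} (hω : ω ∉ manyBad L S) (q : ι) {p : ℕ → Prop}
    [DecidablePred p] (hp : ∀ l : Fin (4 * L), p l → ω l ∈ S q) :
    4 * ((Finset.range (4 * L)).filter p).card < 4 * L := by
  classical
  refine Nat.mul_lt_mul_of_pos_left (lt_of_not_ge fun hL => hω ?_) (by norm_num)
  refine Finset.mem_biUnion.2 ⟨q, Finset.mem_univ _, Finset.mem_filter.2 ⟨Finset.mem_univ _, ?_⟩⟩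
  refine hL.trans (Finset.card_le_card_of_surjOn (fun l : Fin (4 * L) => (l : ℕ)) fun l hl => ?_)
  obtain ⟨h1, h2⟩ := Finset.mem_filter.1 (Finset.mem_coe.1 hl)
  exact ⟨⟨l, Finset.mem_range.1 h1⟩, Finset.mem_coe.2 (Finset.mem_filter.2
    ⟨Finset.mem_univ _, hp ⟨l, Finset.mem_range.1 h1⟩ h2⟩), rfl⟩

/-- Outside the bad choices, every central value of the estimates of a block is accurate. -/
theorem isCentral_bounds {B b L W m : ℕ} {x : Fin (B * b) → ℝ} {η Δ : ℝ}
    {ω : Fin (4 * L) → Sample B W m (B * b)} (hω : ω ∉ manyBad L (badSamples W m x η Δ))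
    {q : Fin B} {v : ℕ → ℝ} (hv : ∀ l : Fin (4 * L), v l = bucketEnergy x (ω l) q) {e : ℝ}
    (he : IsCentral v (4 * L) e) :
    (1 - η) * (m * blockEnergy x q) ≤ e ∧ e ≤ (1 + η) * (m * (blockEnergy x q + Δ)) := by
  refine ⟨he.le _ (four_mul_card_lt_of_notMem_manyBad hω q fun l hl => ?_),
    he.ge _ (four_mul_card_lt_of_notMem_manyBad hω q fun l hl => ?_)⟩
  · rw [hv] at hl
    exact Finset.mem_filter.2 ⟨Finset.mem_univ _, fun h => absurd h.1 (not_le.2 hl)⟩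
  · rw [hv] at hl
    exact Finset.mem_filter.2 ⟨Finset.mem_univ _, fun h => absurd h.2 (not_le.2 hl)⟩

/-! ### Recovery from a random sketch -/

theorem groupSize_pos {ε : ℝ} (hε : 0 < ε) : 0 < groupSize ε := Nat.ceil_pos.2 (by positivity)

/-- `H`, `η` and `Δ` are quantified after the output: one run of the program, which knows none of
them, gives the unconditional bounds and, outside the bad choices, the quality. -/
theorem recovery_sketchMatrix {B b k d W : ℕ} {ε : ℝ} (hε : 0 < ε) (hb : 0 < b) (hB : 0 < B)
    (hd : 1 ≤ d) (hkb : b ≤ k) (ω : Fin (4 * 4 ^ d) → Sample B W (groupSize ε) (B * b))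
    (x : EuclideanSpace ℝ (Fin (B * b))) :
    ∃ U τ, recovery.Outputs b k ε (sketchMatrix ω) (sketchMatrix ω *ᵥ x.ofLp) U τ ∧
      U ⊆ Finset.range B ∧ U.card ≤ k / b ∧
      τ ≤ 2000 * (B * (4 * 4 ^ d * groupSize ε + Nat.clog 2 B)) ∧
      ∀ (H : Finset (Fin B)) (η Δ : ℝ), H.card = min (k / b) B → 0 < η → η ≤ 1 / 4 → 0 ≤ Δ →
        H.card * Δ ≤ η * ∑ p ∈ Hᶜ, blockEnergy x.ofLp p →
        ω ∉ manyBad (4 ^ d) (badSamples W (groupSize ε) x.ofLp η Δ) →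
        ‖x - restrictBlocks b U x‖ ^ 2 ≤ (1 + 5 * η) * ∑ p ∈ Hᶜ, blockEnergy x.ofLp p := by
  have hout := recovery_outputs hε hb hB (show 2 ≤ d + 1 by omega) hkb (sketchMatrix ω)
    (sketchMatrix ω *ᵥ x.ofLp) fun q hq => by
      simp only [columnData, dif_pos (block_start_lt hb hq), colNnz_sketchMatrix, pow_succ']
  rw [pow_succ'] at hout
  obtain ⟨U, τ, e, hU, hτ, htop, he⟩ := hout
  refine ⟨U, τ, hU, htop.subset, htop.card.trans_le (min_le_left _ _), hτ, ?_⟩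
  intro H η Δ hH hη hη1 hΔ hHΔ hω
  have hbd : ∀ q : Fin B, _ := fun q : Fin B => isCentral_bounds hω (q := q)
    (fun l => groupEnergy_sketchMatrix hb ω x.ofLp q l) (he q q.isLt)
  set S : Finset (Fin B) := Finset.univ.filter fun p => (p : ℕ) ∈ U with hS
  have hSU : S.card = U.card := by
    refine Finset.card_bij (fun p _ => (p : ℕ)) (fun p hp => (Finset.mem_filter.1 hp).2)
      (fun _ _ _ _ h => Fin.ext h) fun i hi => ?_
    exact ⟨⟨i, Finset.mem_range.1 (htop.subset hi)⟩,
      Finset.mem_filter.2 ⟨Finset.mem_univ _, hi⟩, rfl⟩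
  rw [norm_sub_restrictBlocks_sq, ← Finset.compl_filter]
  refine sum_compl_le_of_estimates (e := fun q : Fin B => e q) (m := groupSize ε)
    (fun _ => blockEnergy_nonneg _ _) (by exact_mod_cast groupSize_pos hε) hη hη1 hΔ
    (by rw [hSU, htop.card, hH]) (fun i hi j hj => ?_) (fun i => (hbd i).1) (fun i => (hbd i).2) hHΔ
  exact htop.le i i.isLt (by simpa [hS] using hi) j (by simpa [hS] using hj)

/-- The number of buckets in each hash table. -/
noncomputable def tableSize (K : ℕ) (ε : ℝ) : ℕ := ⌈2 ^ 16 * K / ε⌉₊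

/-- For each `x` the recovery fails on few random choices only. -/
theorem exists_failure_set {B b k d : ℕ} {ε : ℝ} (hε : 0 < ε) (hε1 : ε ≤ 1) (hb : 0 < b)
    (hB : 0 < B) (hd : 1 ≤ d) (hBd : B ≤ 2 ^ (4 * 4 ^ d)) (hkb : b ≤ k)
    (x : EuclideanSpace ℝ (Fin (B * b))) :
    ∃ T : Finset (Fin (4 * 4 ^ d) → Sample B (tableSize (k / b) ε) (groupSize ε) (B * b)),
      2 ^ (4 * 4 ^ d) * T.card ≤
        Fintype.card (Fin (4 * 4 ^ d) → Sample B (tableSize (k / b) ε) (groupSize ε) (B * b)) ∧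
      ∀ ω ∉ T, ∃ U τ, recovery.Outputs b k ε (sketchMatrix ω) (sketchMatrix ω *ᵥ x.ofLp) U τ ∧
        ‖x - restrictBlocks b U x‖ ≤ (1 + ε) * blockErr k b x := by
  obtain ⟨H, hH, hHerr, herr⟩ := exists_sum_le_blockErr_sq k x
  have hK : 0 < k / b := Nat.div_pos hkb hb
  have hW : (2 ^ 16 * (k / b : ℕ) / ε : ℝ) ≤ tableSize (k / b) ε := Nat.le_ceil _
  have hW0 : 0 < tableSize (k / b) ε := Nat.ceil_pos.2 (by positivity)
  have hm : (2 ^ 19 / ε ^ 2 : ℝ) ≤ groupSize ε := Nat.le_ceil _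
  set W := tableSize (k / b) ε
  set m := groupSize ε with hmdef
  have hW0' : (0 : ℝ) < W := by exact_mod_cast hW0
  have hHK : (H.card : ℝ) ≤ (k / b : ℕ) := by exact_mod_cast hH.trans_le (min_le_left _ _)
  have hHW : 2 ^ 16 * (H.card : ℝ) ≤ ε * W := by
    rw [div_le_iff₀ hε] at hW
    linarith
  set E := ∑ p ∈ Hᶜ, blockEnergy x.ofLp p
  have hE : 0 ≤ E := Finset.sum_nonneg fun _ _ => blockEnergy_nonneg _ _
  -- This is the Markov threshold for `κ = 2 ^ 14`. Since `2 ^ 16 * H.card ≤ ε * W`, it satisfies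
  -- `H.card * Δ ≤ ε / 4 * E`.
  set Δ : ℝ := 2 ^ 14 * E / W with hΔ
  -- With `κ = 2 ^ 14` the failure probability is `3 / 2 ^ 14 < 2 ^ (-12)`; the constant `2 ^ 19` in
  -- `groupSize` makes `(ε / 4) ^ 2 * m ≥ 2 ^ 15 = 2 * κ`.
  have hbad : ∀ q, 2 ^ 12 * (badSamples W m x.ofLp (ε / 4) Δ q).card ≤
      Fintype.card (Sample B W m (B * b)) := fun q => by
    have h1 : ((badSamples W m x.ofLp (ε / 4) Δ q).card : ℝ) * 2 ^ 14 ≤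
        3 * Fintype.card (Sample B W m (B * b)) := by
      convert card_badSamples_le (m := m) x.ofLp H q (η := ε / 4) (κ := 2 ^ 14) (by positivity)
        (by linarith) (by norm_num) hW0 (groupSize_pos hε) (by nlinarith) (by
          rw [div_le_iff₀ (by positivity)] at hm
          linarith)
    have h2 : (2 ^ 12 * (badSamples W m x.ofLp (ε / 4) Δ q).card : ℝ) ≤
        Fintype.card (Sample B W m (B * b)) := by
      have h3 : (0 : ℝ) ≤ (Fintype.card (Sample B W m (B * b)) : ℝ) := Nat.cast_nonneg _
      linarith
    exact_mod_cast h2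
  refine ⟨manyBad (4 ^ d) (badSamples W m x.ofLp (ε / 4) Δ), ?_, fun ω hω => ?_⟩
  · rw [Fintype.card_fun, Fintype.card_fin]
    exact card_manyBad_le hbad (by simpa using hBd)
  · obtain ⟨U, τ, hU, -, -, -, hq⟩ := recovery_sketchMatrix hε hb hB hd hkb ω x
    refine ⟨U, τ, hU, ?_⟩
    have h1 := hq H (ε / 4) Δ hH (by positivity) (by linarith) (by positivity) (by
      rw [hΔ, mul_div_assoc', div_le_iff₀ hW0']
      nlinarith) hω
    refine abs_le_of_sq_le_sq' ?_ (by positivity) |>.2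
    rw [mul_pow]
    have h2 : (1 + 5 * (ε / 4)) ≤ (1 + ε) ^ 2 := by nlinarith
    exact h1.trans (mul_le_mul h2 hHerr hE (by positivity))

/-! ### Sizes -/

theorem groupSize_le {ε : ℝ} (hε : 0 < ε) (hε1 : ε ≤ 1) : (groupSize ε : ℝ) ≤ 2 ^ 20 / ε ^ 2 := by
  have h1 : (groupSize ε : ℝ) < 2 ^ 19 / ε ^ 2 + 1 := Nat.ceil_lt_add_one (by positivity)
  have h2 : (1 : ℝ) ≤ 1 / ε ^ 2 := one_le_one_div (by positivity) (pow_le_one₀ hε.le hε1)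
  have h3 : (2 : ℝ) ^ 19 / ε ^ 2 = 2 ^ 19 * (1 / ε ^ 2) := by ring
  have h4 : (2 : ℝ) ^ 20 / ε ^ 2 = 2 ^ 20 * (1 / ε ^ 2) := by ring
  rw [h3] at h1
  rw [h4]
  linarith

theorem tableSize_le {K : ℕ} {ε : ℝ} (hK : 0 < K) (hε : 0 < ε) (hε1 : ε ≤ 1) :
    (tableSize K ε : ℝ) ≤ 2 ^ 17 * K / ε := by
  have h1 : (tableSize K ε : ℝ) < 2 ^ 16 * K / ε + 1 := Nat.ceil_lt_add_one (by positivity)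
  have h2 : (1 : ℝ) ≤ K / ε := by
    rw [one_le_div hε]
    exact hε1.trans (by exact_mod_cast hK)
  rw [mul_div_assoc] at h1 ⊢
  linarith

/-- The construction uses only order `k / (ε ^ 3 * b) * log n` rows; `ε ≤ 1` weakens this to the
fifth power. The rounding in `tableSize` is harmless because `k / b ≥ 1`. -/
theorem rows_le {b k N : ℕ} {ε l : ℝ} (hε : 0 < ε) (hε1 : ε ≤ 1) (hb : 0 < b) (hkb : b ≤ k)
    (hN : (N : ℝ) ≤ 192 * l) :
    ((N * groupSize ε * tableSize (k / b) ε : ℕ) : ℝ) ≤ 2 ^ 45 * (k / (ε ^ 5 * b) * l) := by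
  have hl : 0 ≤ l := by linarith [Nat.cast_nonneg (α := ℝ) N]
  have h1 : ((k / b : ℕ) : ℝ) ≤ k / b := Nat.cast_div_le
  have h2 : (1 : ℝ) / ε ^ 3 ≤ 1 / ε ^ 5 :=
    one_div_le_one_div_of_le (by positivity) (pow_le_pow_of_le_one hε.le hε1 (by norm_num))
  push_cast
  calc (N : ℝ) * groupSize ε * tableSize (k / b) ε
      ≤ 192 * l * (2 ^ 20 / ε ^ 2) * (2 ^ 17 * (k / b : ℕ) / ε) := by
        gcongr
        · exact groupSize_le hε hε1
        · exact tableSize_le (Nat.div_pos hkb hb) hε hε1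
    _ = 192 * 2 ^ 37 * l * (1 / ε ^ 3) * (k / b : ℕ) := by field_simp
    _ ≤ 192 * 2 ^ 37 * l * (1 / ε ^ 5) * (k / b) := by gcongr
    _ = 192 * 2 ^ 37 * (k / (ε ^ 5 * b) * l) := by field_simp
    _ ≤ _ := by
        refine mul_le_mul_of_nonneg_right (by norm_num) ?_
        positivity

theorem nnz_le {N : ℕ} {ε l : ℝ} (hε : 0 < ε) (hε1 : ε ≤ 1) (hN : (N : ℝ) ≤ 192 * l) :
    ((N * groupSize ε : ℕ) : ℝ) ≤ 2 ^ 28 * (1 / ε ^ 2 * l) := by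
  have hl : 0 ≤ l := by linarith [Nat.cast_nonneg (α := ℝ) N]
  push_cast
  calc (N : ℝ) * groupSize ε ≤ 192 * l * (2 ^ 20 / ε ^ 2) := by
        gcongr
        exact groupSize_le hε hε1
    _ = 192 * 2 ^ 20 * (1 / ε ^ 2 * l) := by ring
    _ ≤ _ := by
        refine mul_le_mul_of_nonneg_right (by norm_num) ?_
        positivity

/-- The logarithm from sorting the blocks is of order `log n`, hence dominated by the `log n / ε ^
2` entries read per block. -/
theorem time_le {B b N : ℕ} {ε : ℝ} (hε : 0 < ε) (hε1 : ε ≤ 1) (hb : 0 < b) (hn : 2 ≤ B * b)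
    (hN : (N : ℝ) ≤ 192 * Real.log (B * b : ℕ)) :
    ((2000 * (B * (N * groupSize ε + Nat.clog 2 B)) : ℕ) : ℝ) ≤
      2 ^ 45 * ((B * b : ℕ) / (ε ^ 2 * b) * Real.log (B * b : ℕ)) := by
  have hl : 0 ≤ Real.log (B * b : ℕ) := Real.log_natCast_nonneg _
  have h1 := nnz_le hε hε1 hN
  have h2 : (Nat.clog 2 B : ℝ) ≤ 3 * (1 / ε ^ 2 * Real.log (B * b : ℕ)) := by
    have h3 : (Nat.clog 2 B : ℝ) ≤ Nat.clog 2 (B * b) := by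
      exact_mod_cast Nat.clog_mono_right 2 (Nat.le_mul_of_pos_right B hb)
    refine (h3.trans (clog_two_le hn)).trans (mul_le_mul_of_nonneg_left ?_ (by norm_num))
    exact le_mul_of_one_le_left hl (one_le_one_div (by positivity) (pow_le_one₀ hε.le hε1))
  have h4 : ((B * b : ℕ) : ℝ) / (ε ^ 2 * b) * Real.log (B * b : ℕ) =
      B * (1 / ε ^ 2 * Real.log (B * b : ℕ)) := by
    have : (b : ℝ) ≠ 0 := by positivity
    rw [Nat.cast_mul B b]
    field_simp
  rw [h4]
  generalize 1 / ε ^ 2 * Real.log (B * b : ℕ) = t at h1 h2 ⊢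
  push_cast at h1 ⊢
  have h5 : (B : ℝ) * (N * groupSize ε + Nat.clog 2 B) ≤ B * (2 ^ 28 * t + 3 * t) :=
    mul_le_mul_of_nonneg_left (add_le_add h1 h2) (Nat.cast_nonneg _)
  have h6 : (0 : ℝ) ≤ B * t :=
    mul_nonneg (Nat.cast_nonneg _) (by linarith [Nat.cast_nonneg (α := ℝ) (Nat.clog 2 B)])
  nlinarith

theorem five_le {B b : ℕ} {ε : ℝ} (hε : 0 < ε) (hε1 : ε ≤ 1) (hb : 0 < b) (hB : 0 < B)
    (hn : 2 ≤ B * b) :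
    (5 : ℝ) ≤ 2 ^ 45 * ((B * b : ℕ) / (ε ^ 2 * b) * Real.log (B * b : ℕ)) := by
  have h1 : Real.log 2 ≤ Real.log (B * b : ℕ) :=
    Real.log_le_log (by norm_num) (by exact_mod_cast hn)
  have h2 := Real.log_two_gt_d9
  have h3 : (1 : ℝ) ≤ (B * b : ℕ) / (ε ^ 2 * b) := by
    rw [one_le_div (by positivity), Nat.cast_mul]
    refine mul_le_mul_of_nonneg_right ?_ (Nat.cast_nonneg _)
    exact (pow_le_one₀ hε.le hε1).trans (by exact_mod_cast hB)
  nlinarith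

theorem div_le_ofReal_rpow_neg_one {n N t P : ℕ} (hn : 2 ≤ n) (hnP : n ≤ P) (h : P * t ≤ N) :
    (t : ENNReal) / N ≤ ENNReal.ofReal ((n : ℝ) ^ (-1 : ℝ)) := by
  have hn0 : (0 : ℝ) < n := by exact_mod_cast (by omega : 0 < n)
  rw [Real.rpow_neg_one, ENNReal.ofReal_inv_of_pos hn0, ENNReal.ofReal_natCast]
  refine ENNReal.div_le_of_le_mul ?_
  have h1 : (n : ENNReal) * t ≤ N := by exact_mod_cast (Nat.mul_le_mul_right t hnP).trans h
  calc (t : ENNReal) = (n : ENNReal)⁻¹ * (n * t) := by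
        rw [← mul_assoc, ENNReal.inv_mul_cancel (by exact_mod_cast (by omega : n ≠ 0))
          (ENNReal.natCast_ne_top n), one_mul]
    _ ≤ _ := by gcongr

end BlockSparse

/-! ### Assembling the theorem -/

open BlockSparse in
theorem mainTheorem4 :
    ∃ (P : BlockSparse.Program) (C c : ℝ), 0 < C ∧ 0 < c ∧
      ∀ (n b k : ℕ) (ε : ℝ), 2 ≤ n → 0 < b → b ∣ n → 0 < ε → ε ≤ 1 →
        ∃ (M : ℕ) (μ : Measure (Matrix (Fin M) (Fin n) ℝ)),
          IsProbabilityMeasure μ ∧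
          -- number of rows
          (M : ℝ) ≤ C * ((k : ℝ) / (ε ^ 5 * b) * Real.log n) ∧
          (∀ᵐ A ∂μ,
            -- column sparsity
            (∀ j : Fin n, (BlockSparse.colNnz A j : ℝ) ≤ C * (1 / ε ^ 2 * Real.log n)) ∧
            -- recovery of at most `k / b` blocks, and its running time
            ∀ x : EuclideanSpace ℝ (Fin n), ∃ (U : Finset ℕ) (τ : ℕ),
              P.Outputs b k ε A (A *ᵥ x.ofLp) U τ ∧
              U ⊆ Finset.range (n / b) ∧ U.card ≤ k / b ∧
              (τ : ℝ) ≤ C * ((n : ℝ) / (ε ^ 2 * b) * Real.log n)) ∧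
          -- for each `x`, the recovered support fails to be good with probability at most `n ^ (-c)`
          ∀ x : EuclideanSpace ℝ (Fin n),
            μ {A | ¬ ∃ (U : Finset ℕ) (τ : ℕ),
                P.Outputs b k ε A (A *ᵥ x.ofLp) U τ ∧
                ‖x - BlockSparse.restrictBlocks b U x‖ ≤
                  (1 + ε) * BlockSparse.blockErr k b x} ≤
              ENNReal.ofReal ((n : ℝ) ^ (-c)) := by
  refine ⟨recovery, 2 ^ 45, 1, by norm_num, one_pos, ?_⟩
  intro n b k ε hn hb hbn hε hε1
  obtain ⟨B, rfl⟩ := hbn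
  -- With `n` in the form `B * b`, `Fin.divNat` of a coordinate is its block.
  rw [mul_comm b B] at *
  have hB : 0 < B := Nat.pos_of_ne_zero (by rintro rfl; simp at hn)
  rw [Nat.mul_div_cancel _ hb]
  rcases lt_or_ge k b with hkb | hkb
  -- No block is allowed, so the matrix without rows suffices: the empty output is optimal and the
  -- failure event is empty.
  · obtain ⟨μ, hμ, hae, hfail⟩ :=
      exists_uniform_measure fun _ : Unit => (0 : Matrix (Fin 0) (Fin (B * b)) ℝ)
    refine ⟨0, μ, hμ, ?_, hae _ fun _ => ⟨fun j => ?_, fun x => ⟨∅, 5,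
      recovery_outputs_empty hkb _ _, by simp, by simp, ?_⟩⟩, fun x => ?_⟩
    · rw [Nat.cast_zero]
      have := Real.log_natCast_nonneg (B * b)
      positivity
    · have h0 : colNnz (0 : Matrix (Fin 0) (Fin (B * b)) ℝ) j = 0 := by
        simp [colNnz, colSupport]
      rw [h0, Nat.cast_zero]
      have := Real.log_natCast_nonneg (B * b)
      positivity
    · exact_mod_cast five_le hε hε1 hb hB hn
    · refine (hfail _ ∅ fun _ h => absurd ⟨∅, 5, recovery_outputs_empty hkb _ _, ?_⟩ h).trans
        (by simp)
      obtain ⟨H, hH, hHerr, herr⟩ := exists_sum_le_blockErr_sq k x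
      have hH0 : H = ∅ := by simpa [Nat.div_eq_of_lt hkb] using hH
      have h1 : ‖x - restrictBlocks b ∅ x‖ ≤ blockErr k b x := by
        refine (abs_le_of_sq_le_sq' ?_ herr).2
        rw [norm_sub_restrictBlocks_sq]
        simpa [hH0] using hHerr
      exact h1.trans (le_mul_of_one_le_left herr (by linarith))
  · obtain ⟨d, hd, hnd, hd192⟩ := exists_depth hn
    rw [pow_succ'] at hnd hd192
    have hW0 : 0 < tableSize (k / b) ε := by
      have : 0 < k / b := Nat.div_pos hkb hb
      exact Nat.ceil_pos.2 (by positivity)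
    -- Makes the sample space nonempty, so that it carries a uniform distribution.
    have : NeZero (tableSize (k / b) ε) := ⟨hW0.ne'⟩
    obtain ⟨μ, hμ, hae, hfail⟩ := exists_uniform_measure
      fun ω : Fin (4 * 4 ^ d) → Sample B (tableSize (k / b) ε) (groupSize ε) (B * b) =>
        sketchMatrix ω
    refine ⟨_, μ, hμ, rows_le hε hε1 hb hkb hd192, hae _ fun ω => ⟨fun j => ?_, fun x => ?_⟩,
      fun x => ?_⟩
    · rw [colNnz_sketchMatrix]
      refine (nnz_le hε hε1 hd192).trans (mul_le_mul_of_nonneg_right (by norm_num) ?_)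
      have := Real.log_natCast_nonneg (B * b)
      positivity
    · obtain ⟨U, τ, hU, hUB, hUc, hτ, -⟩ := recovery_sketchMatrix hε hb hB hd hkb ω x
      exact ⟨U, τ, hU, hUB, hUc, (Nat.cast_le.2 hτ).trans (time_le hε hε1 hb hn hd192)⟩
    -- The failure probability is at most `2 ^ (-(4 * 4 ^ d)) ≤ 1 / n`, which gives the exponent `c
    -- = 1`.
    · obtain ⟨T, hT, hgood⟩ := exists_failure_set hε hε1 hb hB hd
        ((Nat.le_mul_of_pos_right B hb).trans hnd) hkb x
      refine (hfail _ T fun ω hω => ?_).trans (div_le_ofReal_rpow_neg_one hn hnd hT)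
      by_contra hcon
      exact hω (hgood ω hcon)
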